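/- Let $0<q<1$ and $m\ge 1$; put $\mu=1+q^{2-m}$, $[u]_q=\frac{q^u-1}{q-1}$, $\Gamma_q(t)=\frac{(q;q)_\infty}{(q^t;q)_\infty}(1-q)^{1-t}$, $e_q(t)=\sum_j\frac{t^j}{[j]_q!}$ (continued analytically by $e_q(t)=1/E_q(-t)$), $E_q(t)=\sum_j q^{j(j-1)/2}\frac{t^j}{[j]_q!}$, and for $\gamma>0$ let $\int_0^{\gamma\cdot\infty}f(t)\,d_qt=(1-q)\gamma\sum_{k\in\mathbb Z}f(q^k\gamma)q^k$. **Quantum Euclidean space.** For $1\le i\le m$ let $i'=m+1-i$, $\rho_i=\frac m2-i$ if $i<i'$, $\rho_i=0$ if $i=i'$, $\rho_i=-\rho_{i'}$ if $i>i'$. Let $C^{ij}=C_{ij}=q^{-\rho_i}\delta_{ij'}$ and let $\hat R$ be the braid matrix of the quantum orthogonal group $O_q(m)$, $$\hat R^{ij}_{kl}=q^{\delta_{ij}-\delta_{ij'}}\delta_{il}\delta_{jk}+(q-q^{-1})\big(\theta_{i<j}\,\delta_{ik}\delta_{jl}-\theta_{i<l}\,\delta_{ij'}\delta_{kl'}\,q^{\rho_l-\rho_i}\big),$$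 where $\theta_{a<b}$ is $1$ if $a<b$ and $0$ otherwise. It has the spectral decomposition $\hat R=q\mathcal P_S-q^{-1}\mathcal P_A+q^{1-m}\mathcal P_1$ with complementary projections. (Repeated indices are summed.) Let $\mathcal P$ be the complex algebra with generators $x^1,\dots,x^m$ and relations $(\mathcal P_A)^{ij}_{kl}x^kx^l=0$, $\mathcal P_k$ its part of degree $k$, $\mathcal O_q$ the corresponding algebra of formal power series, and $\mathbf x^2=x^iC_{ij}x^j$. The partial derivatives $\partial^i$ on $\mathcal P$ are the unique linear operators with $\partial^i1=0$ and $\partial^ix^j=C^{ij}+q(\hat R^{-1})^{ij}_{kl}x^k\partial^l$. Let $\Delta=\partial^iC_{ij}\partial^j$, $\mathcal S_k=\mathcal P_k\cap\ker\Delta$, and $$\int_{\mathbb S_q^{m-1}}R=\sum_{k\ge0}\frac{2\,\Gamma_{q^2}(\frac12)^m}{\mu^{2k}[k]_{q^2}!\,\Gamma_{q^2}(k+\frac m2)}(\Delta^kR)(0)\quad(R\in\mathcal P),\qquad \int_{\gamma\cdot\mathbb R^m_q}R_k(\mathbf x)f(\mathbf x^2)=\int_0^{\gamma\cdot\infty}d_qr\,r^{m+k-1}f(r^2)\int_{\mathbb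 S_q^{m-1}}R_k\quad(R_k\in\mathcal P_k).$$ Let $\mathbf y$ be a second copy of the coordinates. The Fourier kernel $\exp_{\hat R}(\mathbf x|\mathbf y)$ is the unique formal series (with all $x$ to the left of all $y$) such that $\partial_x^j\exp_{\hat R}(\mathbf x|\mathbf y)=\exp_{\hat R}(\mathbf x|\mathbf y)\,y^j$ and $\exp_{\hat R}(0|\mathbf y)=1$. **Function spaces.** For $\alpha,\beta>0$ let $\mathcal V_\alpha=\mathcal P\,e_{q^2}\!\big(-\alpha\frac{q^2\mathbf x^2}{\mu}\big)$, $\overline{\mathcal V}_\beta=\mathcal P\,E_{q^2}\!\big(-\beta\frac{\mathbf x^2}{\mu}\big)$ (subspaces of $\mathcal O_q$), $\mathcal V_{[\alpha]}=\bigcup_{j\ge0}\mathcal V_{q^{-2j}\alpha}$ and $\overline{\mathcal V}_{[\beta]}=\bigcup_{j\ge0}\overline{\mathcal V}_{q^{2j}\beta}$. **First transform.** For $f\in\overline{\mathcal V}_{[\beta]}$ let $$\overline{\mathcal F}^{\pm}[f](\mathbf y)=\frac{1+q}{2\mu^{m/2}\Gamma_{q^2}(\frac12)^m}\int_{\sqrt{\mu/((1-q^2)\beta)}\,\cdot\,\mathbb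 R^m_q}f(\mathbf x)\exp_{\hat R}(\pm i\mathbf x|\mathbf y),$$ the integral over $\mathbf x$ being taken in each degree in $\mathbf y$. **Second transform.** With $J^{(2)}_\nu(x|q^2)=q^{\nu^2}\big(\frac x{1+q}\big)^\nu\sum_{i\ge0}\frac{(-1)^iq^{2i(i+\nu)}}{[i]_{q^2}!\,\Gamma_{q^2}(i+\nu+1)}\big(\frac x{1+q}\big)^{2i}$ and $\gamma>0$ let $$\mathcal H_\nu^{q,\gamma}[f](r)=\frac{1+q}\mu\int_0^{\gamma\cdot\infty}d_qt\,\frac{J_\nu^{(2)}\big(q\frac{1+q}\mu rt\,|\,q^2\big)}{(rt)^\nu}t^{2\nu+1}f(t),\qquad c(\sqrt\alpha\gamma)=\frac{q^{(\frac m2-1)\frac m2}}{\Gamma_{q^2}(\frac m2)}\int_0^{\frac{\alpha q^2\gamma^2}\mu\cdot\infty}d_{q^2}u\,u^{\frac m2-1}e_{q^2}(-u).$$ Then $\mathcal F^{\pm}$ is the linear map on $\mathcal V_{[\alpha]}$ such that, for $S_k\in\mathcal S_k$ and $\psi(u)=a(u)\,e_{q^2}(-q^{-2j}\alpha\frac{q^2u}\mu)$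 with $a\in\mathbb C[u]$ and $j\ge 0$, $$\mathcal F^{\pm}[S_k(\mathbf y)\psi(\mathbf y^2)](\mathbf x)=(\pm i)^kS_k(\mathbf x)\,\frac1{c(\sqrt\alpha\gamma)}\Big[\mathcal H^{q,\gamma}_{\frac m2+k-1}[t\mapsto\psi(t^2)](r)\Big]_{r^2=\mathbf x^2},$$ where the function of $r^2$ in brackets is expanded in its Taylor series at the origin. **Theorem.** The partial derivatives and the Fourier kernel exist and are unique, and for all $\alpha,\beta,\gamma>0$ the integrals defining $\overline{\mathcal F}^\pm$ converge on $\overline{\mathcal V}_{[\beta]}$ and $\mathcal F^\pm$ is well defined on $\mathcal V_{[\alpha]}$ by the above. These transforms are maps $\overline{\mathcal F}^{\pm}:\overline{\mathcal V}_{[\beta]}\to\mathcal V_{[1/\beta]}$ and $\mathcal F^{\pm}:\mathcal V_{[\alpha]}\to\overline{\mathcal V}_{[1/\alpha]}$, and they are each other's inverse: $$\overline{\mathcal F}^{\mp}\circ\mathcal F^{\pm}=\mathrm{id}_{\mathcal V_{[\alpha]}}\qquad\text{and}\qquad\mathcal F^{\mp}\circ\overline{\mathcal F}^{\pm}=\mathrm{id}_{\overline{\mathcal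 V}_{[\beta]}}.$$ -/

import Mathlib

open scoped TensorProduct Topology

/-! ### `q`-calculus (for a real base `0 < q < 1`) -/

namespace QCalc

/-- The `q`-factorial `[n]_q! = [n]_q ⋯ [1]_q` with `[k]_q = (q ^ k - 1) / (q - 1)`. -/
noncomputable def qFactorial (q : ℝ) (n : ℕ) : ℝ :=
  ∏ i ∈ Finset.range n, (q ^ (i + 1) - 1) / (q - 1)

/-- The infinite `q`-shifted factorial `(u; q)_∞ = ∏_{k ≥ 0} (1 - u q ^ k)`. -/
noncomputable def qPochInf (q u : ℝ) : ℝ := ∏' k : ℕ, (1 - u * q ^ k)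

/-- The `q`-Gamma function `Γ_q(t) = (q; q)_∞ / (q ^ t; q)_∞ * (1 - q) ^ (1 - t)`. -/
noncomputable def qGamma (q t : ℝ) : ℝ :=
  qPochInf q q / qPochInf q (q ^ t) * (1 - q) ^ (1 - t)

/-- The infinite Jackson integral `∫_0^{γ·∞} f(t) d_q t = (1 - q) γ ∑_{k ∈ ℤ} f(q ^ k γ) q ^ k`. -/
noncomputable def jackson (q γ : ℝ) (f : ℝ → ℂ) : ℂ :=
  ((1 - q) * γ : ℝ) * ∑' k : ℤ, f (q ^ k * γ) * ((q ^ k : ℝ) : ℂ)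

/-- The Taylor coefficients of `e_q(t) = ∑ t ^ j / [j]_q!`. -/
noncomputable def smallExpCoeff (q : ℝ) (j : ℕ) : ℝ := (qFactorial q j)⁻¹

/-- The Taylor coefficients of `E_q(t) = ∑ q ^ (j (j - 1) / 2) t ^ j / [j]_q!`. -/
noncomputable def bigExpCoeff (q : ℝ) (j : ℕ) : ℝ := q ^ (j * (j - 1) / 2) / qFactorial q j

/-- The entire function `E_q`. -/
noncomputable def bigExp (q t : ℝ) : ℝ := ∑' j : ℕ, bigExpCoeff q j * t ^ j

/-- The function `e_q`, analytically continued from `|t| < 1 / (1 - q)` by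
`e_q(t) = 1 / E_q(-t)`. -/
noncomputable def smallExp (q t : ℝ) : ℝ := (bigExp q (-t))⁻¹

/-- The second `q`-Bessel function `J_ν^{(2)}(x | q ^ 2)`, for `x > 0`. -/
noncomputable def besselTwo (q ν x : ℝ) : ℝ :=
  q ^ (ν ^ 2) * (x / (1 + q)) ^ ν *
    ∑' i : ℕ, q ^ (2 * (i : ℝ) * (i + ν)) * (-1) ^ i /
      (qFactorial (q ^ 2) i * qGamma (q ^ 2) (i + ν + 1)) * (x / (1 + q)) ^ (2 * i)

end QCalc

/-! ### Quantum Euclidean space `ℝ^m_q` -/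

namespace QEuclid

open QCalc

section Space

variable (q : ℝ) (m : ℕ)

/-- The constant `μ = 1 + q ^ (2 - m)`. -/
noncomputable def mu : ℝ := 1 + q ^ (2 - (m : ℤ))

/-- The numbers `ρ_i`: they are `m/2 - 1, m/2 - 2, …, 1 - m/2`, where for odd `m` the value `0` of
the middle index is inserted (between `1/2` and `-1/2`), and for even `m` the value `0` is taken
twice. The index `i' = m + 1 - i` of the literature is `i.rev`. -/
noncomputable def rho (i : Fin m) : ℝ :=
  if i < i.rev then (m : ℝ) / 2 - 1 - (i : ℕ)
  else if i.rev < i then -((m : ℝ) / 2 - 1 - (i.rev : ℕ))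
  else 0

/-- The metric `C_{ij} = C^{ij} = q ^ (-ρ_i) δ_{i, j'}`. -/
noncomputable def metric (i j : Fin m) : ℝ := if j = i.rev then q ^ (-rho m i) else 0

/-- The braid matrix `R̂^{ij}_{kl}` of the quantum orthogonal group `O_q(m)`, with row index `(i, j)`
and column index `(k, l)`. -/
noncomputable def braid : Matrix (Fin m × Fin m) (Fin m × Fin m) ℝ := fun a b =>
  (if a.1 = b.2 ∧ a.2 = b.1 then
      q ^ ((if a.1 = a.2 then 1 else 0) - (if a.1 = a.2.rev then 1 else 0) : ℤ)
    else 0)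
  + (q - q⁻¹) *
    ((if a.1 < a.2 ∧ a = b then 1 else 0)
      - (if a.1 < b.2 ∧ a.1 = a.2.rev ∧ b.1 = b.2.rev then q ^ (rho m b.2 - rho m a.1) else 0))

/-- The projection `P_A` of the spectral decomposition `R̂ = q P_S - q⁻¹ P_A + q ^ (1 - m) P_1`, that
is, the projection on the eigenspace for `-q⁻¹` along the eigenspaces for `q` and `q ^ (1 - m)`. -/
noncomputable def projA : Matrix (Fin m × Fin m) (Fin m × Fin m) ℝ :=
  ((-q⁻¹ - q) * (-q⁻¹ - q ^ (1 - (m : ℤ))))⁻¹ •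
    ((braid q m - q • 1) * (braid q m - q ^ (1 - (m : ℤ)) • 1))

/-- The defining relations `(P_A)^{ij}_{kl} x^k x^l = 0`. -/
inductive Rel : FreeAlgebra ℂ (Fin m) → FreeAlgebra ℂ (Fin m) → Prop
  | comm (a : Fin m × Fin m) :
      Rel (∑ b : Fin m × Fin m,
        ((projA q m a b : ℝ) : ℂ) • (FreeAlgebra.ι ℂ b.1 * FreeAlgebra.ι ℂ b.2)) 0

/-- The algebra `𝒫` of polynomials on `ℝ^m_q`. -/
abbrev Poly : Type := RingQuot (Rel q m)

/-- The coordinates `x^i` (or `y^i`, for the second copy of the space). -/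
noncomputable def coord (i : Fin m) : Poly q m :=
  RingQuot.mkAlgHom ℂ (Rel q m) (FreeAlgebra.ι ℂ i)

theorem coord_rel (a : Fin m × Fin m) :
    ∑ b : Fin m × Fin m, ((projA q m a b : ℝ) : ℂ) • (coord q m b.1 * coord q m b.2) = 0 := by
  have h := RingQuot.mkAlgHom_rel ℂ (Rel.comm (q := q) (m := m) a)
  simpa only [map_sum, map_smul, map_mul, map_zero, coord] using h

/-- The norm squared `x² = x^i C_{ij} x^j`. -/
noncomputable def normSq : Poly q m :=
  ∑ i, ∑ j, ((metric q m i j : ℝ) : ℂ) • (coord q m i * coord q m j)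

/-- The space `𝒫_k` of homogeneous polynomials of degree `k`, spanned by the products of `k`
coordinates. -/
noncomputable def homog (k : ℕ) : Submodule ℂ (Poly q m) :=
  (Submodule.span ℂ (Set.range (coord q m))) ^ k

/-- The value `R(0)` of a polynomial at the origin. -/
noncomputable def evalZero : Poly q m →ₐ[ℂ] ℂ :=
  RingQuot.liftAlgHom ℂ ⟨FreeAlgebra.lift ℂ (fun _ => 0), by
    rintro _ _ ⟨a⟩
    simp only [map_sum, map_smul, map_mul, FreeAlgebra.lift_ι_apply, mul_zero, smul_zero,
      Finset.sum_const_zero, map_zero]⟩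

/-- Formal power series on `ℝ^m_q`, as sequences of homogeneous components with the Cauchy product:
the coefficient of `T ^ n` of such a series is the component of degree `n`. So the algebra `𝒪_q` is
the subalgebra of the series whose coefficient of `T ^ n` lies in `𝒫_n` for all `n`; all the spaces
of functions below lie in it. -/
abbrev Series : Type := PowerSeries (Poly q m)

/-- The embedding of `𝒫` in `𝒪_q`: a polynomial is sent to its homogeneous components. -/
noncomputable def toSeries : Poly q m →ₐ[ℂ] Series q m :=
  RingQuot.liftAlgHom ℂ ⟨FreeAlgebra.lift ℂ (fun i => PowerSeries.monomial 1 (coord q m i)), by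
    rintro _ _ ⟨a⟩
    have h := congrArg (PowerSeries.monomial (R := Poly q m) 2) (coord_rel q m a)
    rw [map_sum] at h
    simp only [map_sum, map_smul, map_mul, FreeAlgebra.lift_ι_apply, map_zero] at h ⊢
    rw [← h]
    refine Finset.sum_congr rfl fun b _ => ?_
    rw [PowerSeries.monomial_mul_monomial]
    ext n
    simp only [PowerSeries.coeff_smul, PowerSeries.coeff_monomial]
    split_ifs
    · rfl
    · exact smul_zero _⟩

/-- For a power series `f` in one variable, the element `f(x²)` of `𝒪_q`. -/
noncomputable def radial (f : PowerSeries ℂ) : Series q m :=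
  PowerSeries.mk fun n => if Even n then PowerSeries.coeff (n / 2) f • normSq q m ^ (n / 2) else 0

/-- The action of the partial derivatives `∂^i` on polynomials: `∂^i 1 = 0` and
`∂^i x^j = C^{ij} + q (R̂⁻¹)^{ij}_{kl} x^k ∂^l`. -/
def IsPartials (D : Fin m → Module.End ℂ (Poly q m)) : Prop :=
  (∀ i, D i 1 = 0) ∧
  ∀ (i j : Fin m) (f : Poly q m),
    D i (coord q m j * f) = ((metric q m i j : ℝ) : ℂ) • f +
      (q : ℂ) • ∑ b : Fin m × Fin m,
        (((braid q m)⁻¹ (i, j) b : ℝ) : ℂ) • (coord q m b.1 * D b.2 f)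

/-- The partial derivatives `∂^i` on `𝒫`. -/
noncomputable def pderiv : Fin m → Module.End ℂ (Poly q m) := Classical.epsilon (IsPartials q m)

/-- The Laplace operator `Δ = ∂^i C_{ij} ∂^j`. -/
noncomputable def laplace : Module.End ℂ (Poly q m) :=
  ∑ i, ∑ j, ((metric q m i j : ℝ) : ℂ) • (pderiv q m i * pderiv q m j)

/-- The spherical harmonics `𝒮_k = 𝒫_k ∩ ker Δ`. -/
noncomputable def harmonics (k : ℕ) : Submodule ℂ (Poly q m) :=
  homog q m k ⊓ LinearMap.ker (laplace q m)

/-- The integral over the quantum sphere,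
`∫ R = ∑_k 2 Γ_{q²}(1/2) ^ m / (μ ^ (2k) [k]_{q²}! Γ_{q²}(k + m/2)) (Δ^k R)(0)`
(a finite sum for each polynomial `R`). -/
noncomputable def sphereInt (R : Poly q m) : ℂ :=
  ∑' k : ℕ, ((2 * qGamma (q ^ 2) (1 / 2) ^ m /
      (mu q m ^ (2 * k) * qFactorial (q ^ 2) k * qGamma (q ^ 2) (k + m / 2)) : ℝ) : ℂ) *
    evalZero q m ((laplace q m ^ k) R)

/-- The spherical integral at radius `r`, `∑_n r ^ n ∫_{S} g_n` with `g_n` the component of degree `n`.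
Since `∫_S x² R = ∫_S R`, its value on `R_k(x) f(x²)`, with `R_k` homogeneous of degree `k`, is
`r ^ k f(r²) ∫_S R_k`. -/
noncomputable def sphereMean (g : Series q m) (r : ℝ) : ℂ :=
  ∑' n : ℕ, (r : ℂ) ^ n * sphereInt q m (PowerSeries.coeff n g)

/-- The integral `∫_{γ·ℝ^m_q}`: on `R_k(x) f(x²)`, with `R_k` homogeneous of degree `k`, it is
`∫_0^{γ·∞} d_q r r ^ (m + k - 1) f(r²) ∫_S R_k`. -/
noncomputable def integral (γ : ℝ) (g : Series q m) : ℂ :=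
  jackson q γ fun r => (r : ℂ) ^ (m - 1) * sphereMean q m g r

/-- Convergence of the series and of the Jackson integral in `integral`. -/
def Converges (γ : ℝ) (g : Series q m) : Prop :=
  (∀ r : ℝ, Summable fun n : ℕ => (r : ℂ) ^ n * sphereInt q m (PowerSeries.coeff n g)) ∧
  Summable fun k : ℤ => (((q ^ k * γ : ℝ) : ℂ) ^ (m - 1) * sphereMean q m g (q ^ k * γ)) *
    ((q ^ k : ℝ) : ℂ)

/-- The Fourier kernel `exp_R̂(x|y) = ∑_l e_l`, with `e_l` the part of degree `l` in `y`, as formal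
series of elements of `𝒫(x) ⊗ 𝒫(y)` (all `x` to the left of all `y`). It is characterized by
`∂_x^j exp_R̂(x|y) = exp_R̂(x|y) y^j` and `exp_R̂(0|y) = 1`. -/
def IsKernel (e : ℕ → Poly q m ⊗[ℂ] Poly q m) : Prop :=
  (∀ j, TensorProduct.map (pderiv q m j) LinearMap.id (e 0) = 0) ∧
  (∀ l j, TensorProduct.map (pderiv q m j) LinearMap.id (e (l + 1)) = e l * (1 ⊗ₜ coord q m j)) ∧
  ∀ l, TensorProduct.map (evalZero q m).toLinearMap LinearMap.id (e l) =
    if l = 0 then (1 : ℂ) ⊗ₜ[ℂ] (1 : Poly q m) else 0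

/-- The components of the Fourier kernel `exp_R̂(x|y)`. -/
noncomputable def kernel : ℕ → Poly q m ⊗[ℂ] Poly q m := Classical.epsilon (IsKernel q m)

open Classical in
/-- The application of a linear functional `φ` to the first factor, `p(x) ⊗ r(y) ↦ φ(p) r(y)`. -/
noncomputable def contract (φ : Poly q m → ℂ) : Poly q m ⊗[ℂ] Poly q m →ₗ[ℂ] Poly q m :=
  if h : IsLinearMap ℂ φ then
    (TensorProduct.lid ℂ (Poly q m)).toLinearMap ∘ₗ TensorProduct.map (h.mk' φ) LinearMap.id
  else 0

/-! ### The spaces of weighted polynomials -/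

/-- The Gaussian `e_{q²}(-α q² u / μ)` as a formal power series in `u`. -/
noncomputable def smallGauss (α : ℝ) : PowerSeries ℂ :=
  PowerSeries.mk fun j => ((smallExpCoeff (q ^ 2) j * (-(α * q ^ 2 / mu q m)) ^ j : ℝ) : ℂ)

/-- The Gaussian `E_{q²}(-β u / μ)` as a formal power series in `u`. -/
noncomputable def bigGauss (β : ℝ) : PowerSeries ℂ :=
  PowerSeries.mk fun j => ((bigExpCoeff (q ^ 2) j * (-(β / mu q m)) ^ j : ℝ) : ℂ)

/-- The space `𝒱_α = 𝒫 ⊗ e_{q²}(-α q² x² / μ)`. -/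
noncomputable def V (α : ℝ) : Set (Series q m) :=
  Set.range fun P : Poly q m => toSeries q m P * radial q m (smallGauss q m α)

/-- The space `𝒱̄_β = 𝒫 ⊗ E_{q²}(-β x² / μ)`. -/
noncomputable def VBar (β : ℝ) : Set (Series q m) :=
  Set.range fun P : Poly q m => toSeries q m P * radial q m (bigGauss q m β)

/-- The space `𝒱_[α] = ⋃_j 𝒱_{q^(-2j) α}`. -/
noncomputable def VClass (α : ℝ) : Set (Series q m) := ⋃ j : ℕ, V q m ((q ^ (2 * j))⁻¹ * α)

/-- The space `𝒱̄_[β] = ⋃_j 𝒱̄_{q^(2j) β}`. -/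
noncomputable def VBarClass (β : ℝ) : Set (Series q m) := ⋃ j : ℕ, VBar q m (q ^ (2 * j) * β)

/-! ### The first Fourier transform -/

/-- The scale `γ = √(μ / ((1 - q²) β))` of the integration on `𝒱̄_[β]`, for which
`E_{q²}(-β r² / μ)` vanishes at `r = q ^ (-k) γ`, `k = 0, 1, 2, …`. -/
noncomputable def scale (β : ℝ) : ℝ := √(mu q m / ((1 - q ^ 2) * β))

/-- The first Fourier transform `F̄^±` on `𝒱̄_[β]`, with `s = ±i`:
`(1 + q) / (2 μ^(m/2) Γ_{q²}(1/2)^m) ∫_x f(x) exp_R̂(±i x|y)`, where the integral over `x` is taken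
in each degree in `y`. -/
noncomputable def firstFourier (s : ℂ) (β : ℝ) (f : Series q m) : Series q m :=
  PowerSeries.mk fun l =>
    (((1 + q) / (2 * mu q m ^ ((m : ℝ) / 2) * qGamma (q ^ 2) (1 / 2) ^ m) : ℝ) : ℂ) •
      contract q m (fun p => integral q m (scale q m β) (f * toSeries q m p))
        (s ^ l • kernel q m l)

/-! ### The second Fourier transform -/

/-- The second `q`-Hankel transform `H_ν^{q,γ}[f](r)`. -/
noncomputable def hankelTwo (ν γ : ℝ) (f : ℝ → ℂ) (r : ℝ) : ℂ :=
  (((1 + q) / mu q m : ℝ) : ℂ) * jackson q γ fun t =>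
    ((besselTwo q ν (q * ((1 + q) / mu q m) * r * t) / (r * t) ^ ν * t ^ (2 * ν + 1) : ℝ) : ℂ) * f t

/-- The constant `c(√α γ) =
q^((m/2 - 1) m/2) / Γ_{q²}(m/2) ∫_0^{(α q² γ² / μ)·∞} d_{q²}u u^(m/2 - 1) e_{q²}(-u)`. -/
noncomputable def cConst (α γ : ℝ) : ℂ :=
  ((q ^ (((m : ℝ) / 2 - 1) * ((m : ℝ) / 2)) / qGamma (q ^ 2) (m / 2) : ℝ) : ℂ) *
    jackson (q ^ 2) (α * q ^ 2 * γ ^ 2 / mu q m) fun u =>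
      ((u ^ ((m : ℝ) / 2 - 1) * smallExp (q ^ 2) (-u) : ℝ) : ℂ)

/-- `Φ` is the Taylor expansion at the origin of the function `g`, given on the positive reals. -/
def IsTaylor (g : ℝ → ℂ) (Φ : PowerSeries ℂ) : Prop :=
  ∀ᶠ u : ℝ in 𝓝[>] 0, HasSum (fun n : ℕ => PowerSeries.coeff n Φ * (u : ℂ) ^ n) (g u)

/-- The graph of the second Fourier transform `F^±` on `𝒱_[α]`, with `s = ±i`. The transform is the
linear map with
`F^±[S_k(y) ψ(y²)](x) = (±i)^k S_k(x) c(√α γ)⁻¹ (H_{m/2+k-1}^{q,γ}[ψ ∘ (·)²] ∘ √)(x²)`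
for `S_k` in `𝒮_k` and `ψ(u) = a(u) e_{q²}(-α' q² u / μ)` with `a` a polynomial and
`α' = q ^ (-2j) α`. -/
noncomputable def secondGraph (s : ℂ) (α γ : ℝ) : Submodule ℂ (Series q m × Series q m) :=
  Submodule.span ℂ {z | ∃ (k j : ℕ) (S : Poly q m) (a : Polynomial ℂ) (Φ : PowerSeries ℂ),
    S ∈ harmonics q m k ∧
    IsTaylor (fun u => (cConst q m α γ)⁻¹ *
      hankelTwo q m ((m : ℝ) / 2 + k - 1) γ
        (fun t => a.eval ((t : ℂ) ^ 2) *
          ((smallExp (q ^ 2) (-((q ^ (2 * j))⁻¹ * α * q ^ 2 / mu q m) * t ^ 2) : ℝ) : ℂ)) √u) Φ ∧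
    z = (toSeries q m S * radial q m ((a : PowerSeries ℂ) * smallGauss q m ((q ^ (2 * j))⁻¹ * α)),
      s ^ k • (toSeries q m S * radial q m Φ))}

open Classical in
/-- The second Fourier transform `F^±` on `𝒱_[α]`, with `s = ±i`: the function with graph
`secondGraph`. -/
noncomputable def secondFourier (s : ℂ) (α γ : ℝ) (f : Series q m) : Series q m :=
  if h : ∃ g, (f, g) ∈ secondGraph q m s α γ then h.choose else 0

end Space

end QEuclid

/-!
The proof reduces both transforms to their values on the products of a spherical harmonic `S` of degree
`k` with a `q`-Gaussian. Write `e_b` and `E_b` for the `q`-Gaussians with the radial functions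
`e_{q²}(-b q² x² / μ)` and `E_{q²}(-b x² / μ)`. Then

* the first transform with the sign `s = ±i` maps `S E_b` to `s^k (q² / b)^{m/2+k} S e_{1/b}`
  (`QEuclid.firstFourier_harmonic_mul_bigGauss`),
* the second transform maps `S e_b` to `s^k (b q²)^{-(m/2+k)} S E_{1/b}` (`QEuclid.bochnerGraph`,
  `QEuclid.secondFourier_mem_bochnerGraph`).

For opposite signs these maps are inverse to each other. By their functional equations, the multiples
of a `q`-Gaussian by polynomials in `x²` are the linear combinations of its rescalings by powers of
`q²`, so that the products above span the function spaces (`QEuclid.mem_VClass_iff`,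
`QEuclid.mem_VBarClass_iff`). The relations for the second transform are consistent: by the uniqueness
of the decomposition into spherical harmonics and by interpolation at the pairwise different
parameters, a vanishing combination of the `S e_b` forces the corresponding combination of the images
to vanish (`QEuclid.eq_zero_of_mem_bochnerGraph`).

The algebra underneath consists of identities for the braid matrix: the braid relation, the formula for
the inverse and the invariance of the metric. All of them are proved by descent. Both sides commute with
the simple root vectors of `so_m` (`QEuclid.rop_root2`), which connect the rows of a tensor, so that it
suffices to compare one row (`QEuclid.descent_two`, `QEuclid.descent_three`). The partial derivatives
come from the representation of the polynomials on jets (`QEuclid.exists_isPartials`). The commutation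
relations with the coordinates show that `x²` is central, and give the Laplace operator on `x^{2j} S`
and with it the decomposition into spherical harmonics (`QEuclid.laplace_normSq_pow_mul`,
`QEuclid.mem_span_harmonics`). The pairing `⟨p, r⟩ = (p(∂) r)(0)` is nondegenerate, and the Fourier
kernel is its canonical element (`QEuclid.existsUnique_isKernel`, `QEuclid.contract_kernel`).

For the first transform, the integral over the sphere of `S r` is a multiple of the pairing of `r` with
`x^{2j} S` (`QEuclid.sphereInt_harmonic_mul`). This holds since the polarizations of `S` with respect to
the coordinates and to the partial derivatives commute (`QEuclid.polar_deriv_polar_coord`). The radial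
integrals are the moments of `E_{q²}`, that is, values of the `q`-Gamma function
(`QCalc.hasSum_bigExp_moment`). For the second transform, the series of the second `q`-Bessel function
is integrated term by term against `e_{q²}`, whose moments satisfy the recursion of the `q`-Gamma
function (`QCalc.hasSum_bessel_smallExp`); the constant `c(√α γ)` removes the dependence on `γ`
(`QEuclid.hankel_constant`).
-/

namespace QEuclid
open QCalc

/-! ### The weights of the vector representation -/

section Rho
variable {m : ℕ}

theorem rho_rev (i : Fin m) : rho m i.rev = -rho m i := by
  unfold rho
  rw [Fin.rev_rev]
  rcases lt_trichotomy i i.rev with h | h | h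
  · simp [h, h.not_gt]
  · simp [← h]
  · simp [h, h.not_gt]

theorem rho_of_succ_lt_rev {i l : Fin m} (hl : (l : ℕ) = i + 1) (h : l < l.rev) :
    rho m i = rho m l + 1 := by
  have hi : i < i.rev := by
    rw [Fin.lt_def, Fin.val_rev] at *; omega
  unfold rho
  rw [if_pos h, if_pos hi, hl]; push_cast; ring

theorem rho_of_eq_rev {l : Fin m} (h : l = l.rev) : rho m l = 0 := by
  unfold rho
  simp [← h]

theorem rho_of_succ_eq_rev {i l : Fin m} (hl : (l : ℕ) = i + 1) (h : l = l.rev) :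
    rho m i = 1 / 2 := by
  have h' : (l : ℕ) = m - (l + 1) := by rw [← Fin.val_rev, ← h]
  have hi : i < i.rev := by
    rw [Fin.lt_def, Fin.val_rev] at *; omega
  unfold rho
  rw [if_pos hi]
  have : (m : ℝ) = 2 * (i : ℕ) + 3 := by
    have : m = 2 * (i : ℕ) + 3 := by omega
    exact_mod_cast this
  rw [this]; ring

theorem rho_of_succ_eq_rev_self {i l : Fin m} (hl : (l : ℕ) = i + 1) (h : l = i.rev) :
    rho m i = 0 := by
  have h' : (l : ℕ) = m - (i + 1) := by rw [← Fin.val_rev, ← h]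
  have hi : i < i.rev := by
    rw [Fin.lt_def, Fin.val_rev] at *; omega
  unfold rho
  rw [if_pos hi]
  have : (m : ℝ) = 2 * (i : ℕ) + 2 := by
    have : m = 2 * (i : ℕ) + 2 := by omega
    exact_mod_cast this
  rw [this]; ring

theorem rho_of_last {i : Fin m} (hi : (i : ℕ) + 1 = m) (hm : 2 ≤ m) :
    rho m i = 1 - (m : ℝ) / 2 := by
  have h1 : (i.rev : ℕ) = 0 := by rw [Fin.val_rev]; omega
  have h2 : i.rev < i := by rw [Fin.lt_def]; omega
  unfold rho
  rw [if_neg h2.not_gt, if_pos h2, h1]; push_cast; ring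

/-- Induction over the indices along the action of the simple roots of `so_m`, downwards from the
last index. A step moves from `l` to `i` and from `i'` to `l'` for neighbours `i < l ≤ l'`, and
between the two middle indices if `m` is even. -/
theorem descent {P : Fin m → Prop} (h0 : ∀ i : Fin m, (i : ℕ) + 1 = m → P i)
    (h1 : ∀ i l : Fin m, (l : ℕ) = i + 1 → l ≤ l.rev → (P l → P i) ∧ (P i.rev → P l.rev))
    (h2 : ∀ i l : Fin m, (l : ℕ) = i + 1 → l = i.rev → P l → P i) (i : Fin m) : P i := by
  obtain ⟨k, hk⟩ : ∃ k, k + (i : ℕ) + 1 = m := ⟨m - (i + 1), by omega⟩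
  induction k generalizing i with
  | zero => exact h0 i (by omega)
  | succ k ih =>
    have hl : (i : ℕ) + 1 < m := by omega
    have hP := ih ⟨i + 1, hl⟩ (by simp only; omega)
    by_cases c : (⟨i + 1, hl⟩ : Fin m) ≤ (⟨i + 1, hl⟩ : Fin m).rev
    · exact (h1 i _ rfl c).1 hP
    · rw [Fin.le_def, Fin.val_rev] at c
      simp only at c
      by_cases d : (i : ℕ) + 1 = m - (i + 1)
      · exact h2 i _ rfl (by rw [Fin.ext_iff, Fin.val_rev]; simpa using d) hP
      · have := (h1 (⟨i + 1, hl⟩ : Fin m).rev i.rev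
          (by simp only [Fin.val_rev]; omega)
          (by rw [Fin.le_def]; simp only [Fin.val_rev]; omega)).2
        simpa using this (by simpa using hP)

end Rho

/-! ### The braid matrix as an operator on tensors -/

section Operators
variable (q : ℝ) (m : ℕ) {M N : Type*} [AddCommGroup M] [Module ℝ M] [AddCommGroup N] [Module ℝ N]

/-- The action of the braid matrix on the two-index tensors with entries in a module. -/
noncomputable def rop : (Fin m → Fin m → M) →ₗ[ℝ] (Fin m → Fin m → M) where
  toFun f a b := ∑ p : Fin m × Fin m, braid q m (a, b) p • f p.1 p.2
  map_add' f g := by ext a b; simp [Finset.sum_add_distrib]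
  map_smul' r f := by ext a b; simp [Finset.smul_sum, smul_comm r]

/-- The contraction of a two-index tensor with the metric. -/
noncomputable def cap : (Fin m → Fin m → M) →ₗ[ℝ] M where
  toFun f := ∑ p : Fin m × Fin m, metric q m p.1 p.2 • f p.1 p.2
  map_add' f g := by simp [Finset.sum_add_distrib]
  map_smul' r f := by simp [Finset.smul_sum, smul_comm r]

/-- The metric times a vector, as a two-index tensor. -/
noncomputable def cup : M →ₗ[ℝ] (Fin m → Fin m → M) where
  toFun x a b := metric q m a b • x
  map_add' f g := by ext; simp
  map_smul' r f := by ext; simp [smul_comm r]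

/-- The inverse `R̂⁻¹ = R̂ - (q - q⁻¹) (1 - K)` of the action of the braid matrix, with `K` the
product of the two metrics. -/
noncomputable def rinv : (Fin m → Fin m → M) →ₗ[ℝ] (Fin m → Fin m → M) :=
  rop q m - (q - q⁻¹) • (LinearMap.id - cup q m ∘ₗ cap q m)

/-- The action of a two-index operator on the first two of three indices. -/
def on12 (A : (Fin m → Fin m → M) →ₗ[ℝ] (Fin m → Fin m → N)) :
    (Fin m → Fin m → Fin m → M) →ₗ[ℝ] (Fin m → Fin m → Fin m → N) where
  toFun f a b c := A (fun a b => f a b c) a b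
  map_add' f g := by
    ext a b c
    exact congrFun (congrFun (A.map_add (fun a b => f a b c) (fun a b => g a b c)) a) b
  map_smul' r f := by
    ext a b c
    exact congrFun (congrFun (A.map_smul r (fun a b => f a b c)) a) b

/-- The action of a two-index operator on the last two of three indices. -/
def on23 (A : (Fin m → Fin m → M) →ₗ[ℝ] (Fin m → Fin m → N)) :
    (Fin m → Fin m → Fin m → M) →ₗ[ℝ] (Fin m → Fin m → Fin m → N) where
  toFun f a := A (f a)
  map_add' f g := by ext a; simp
  map_smul' r f := by ext a; simp

variable {q m}

theorem on12_apply (A : (Fin m → Fin m → M) →ₗ[ℝ] (Fin m → Fin m → N)) (f) (a b c : Fin m) :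
    on12 m A f a b c = A (fun a b => f a b c) a b := rfl

theorem on23_apply (A : (Fin m → Fin m → M) →ₗ[ℝ] (Fin m → Fin m → N)) (f) (a : Fin m) :
    on23 m A f a = A (f a) := rfl

theorem cap_apply (f : Fin m → Fin m → M) :
    cap q m f = ∑ a : Fin m, q ^ (-rho m a) • f a a.rev := by
  simp only [cap, LinearMap.coe_mk, AddHom.coe_mk, metric, Fintype.sum_prod_type, ite_smul,
    zero_smul]
  simp

theorem cup_apply (x : M) (a b : Fin m) :
    cup q m x a b = if b = a.rev then q ^ (-rho m a) • x else 0 := by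
  simp only [cup, LinearMap.coe_mk, AddHom.coe_mk, metric, ite_smul, zero_smul]

/-- The rows of the braid matrix. -/
theorem rop_apply (hq : 0 < q) (f : Fin m → Fin m → M) (a b : Fin m) :
    rop q m f a b = q ^ ((if a = b then 1 else 0) - (if a = b.rev then 1 else 0) : ℤ) • f b a
      + (q - q⁻¹) • ((if a < b then f a b else 0) -
        if a = b.rev then q ^ (-rho m a) • ∑ n, (if a < n then q ^ rho m n • f n.rev n else 0)
        else 0) := by
  simp only [rop, LinearMap.coe_mk, AddHom.coe_mk, braid]
  generalize q - q⁻¹ = z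
  simp only [add_smul, sub_smul, mul_smul, ite_smul,
    zero_smul, one_smul, Finset.sum_add_distrib, ← Finset.smul_sum, Finset.sum_sub_distrib]
  refine congrArg₂ _ ?_ (congrArg _ (congrArg₂ _ ?_ ?_))
  · rw [Finset.sum_eq_single (b, a)]
    · simp
    · rintro ⟨c, d⟩ - h
      rw [if_neg]; rintro ⟨rfl, rfl⟩; exact h rfl
    · simp
  · rw [Finset.sum_eq_single (a, b)]
    · simp
    · rintro ⟨c, d⟩ - h
      rw [if_neg]; rintro ⟨-, h'⟩; exact h h'.symm
    · simp
  · split_ifs with h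
    · rw [Fintype.sum_prod_type, Finset.sum_comm, Finset.smul_sum]
      refine Finset.sum_congr rfl fun n _ => ?_
      simp only [h, true_and]
      rw [Finset.sum_eq_single n.rev]
      · simp only [and_true]
        split_ifs
        · rw [smul_smul, ← Real.rpow_add hq]; congr 2; ring
        · simp
      · intro b _ hb; simp [hb]
      · simp
    · simp [h]

end Operators

/-! ### Equivariance under the simple root vectors -/

section Root
variable (q : ℝ) {m : ℕ}

/-- The torus weight `q ^ (δ_{ia} - δ_{i'a})`, a diagonal entry of the `L`-operators. -/
noncomputable def wt (i a : Fin m) : ℝ :=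
  q ^ ((if a = i then 1 else 0) - (if a = i.rev then 1 else 0) : ℤ)

/-- The simple root vector `v_i ↦ v_l`, `v_{l'} ↦ -κ v_{i'}` of `so_m` in the vector
representation, with `κ = q ^ (ρ_l - ρ_i)`. -/
noncomputable def root (i l : Fin m) (g : Fin m → ℝ) (a : Fin m) : ℝ :=
  (if a = l then g i else 0) - if a = i.rev then q ^ (rho m l - rho m i) * g l.rev else 0

/-- The action of a simple root vector on two-index tensors, by its coproduct. -/
noncomputable def root2 (i l : Fin m) (f : Fin m → Fin m → ℝ) (a b : Fin m) : ℝ :=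
  wt q i a * root q i l (f a) b + wt q l b * root q i l (fun a => f a b) a

variable {q}

theorem wt_rev_mul (hq : 0 < q) (i a : Fin m) : wt q i a * wt q i a.rev = 1 := by
  unfold wt
  rw [← zpow_add₀ hq.ne']
  simp only [Fin.rev_eq_iff, Fin.rev_rev]
  rw [show (_ - _ + (_ - _) : ℤ) = 0 by ring_nf, zpow_zero]

/-- The braid matrix commutes with the torus. -/
theorem wt_rop (hq : 0 < q) (i a b : Fin m) (f : Fin m → Fin m → ℝ) :
    rop q m (fun a b => wt q i a * wt q i b * f a b) a b
      = wt q i a * wt q i b * rop q m f a b := by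
  rw [rop_apply hq, rop_apply hq]
  simp only [smul_eq_mul]
  by_cases h : a = b.rev
  · subst h
    have h' : ∀ n : Fin m, wt q i n.rev * wt q i n = 1 := fun n => by
      rw [mul_comm, wt_rev_mul hq]
    simp only [h', wt_rev_mul hq, one_mul]
  · simp only [h, if_false]
    split_ifs <;> ring

/-- Only four terms of the sum survive, and they combine in pairs. -/
theorem sum_mul_root2 (hq : 0 < q) {i l : Fin m} (hl : (l : ℕ) = i + 1) (h : l ≤ l.rev)
    (f : Fin m → Fin m → ℝ) (c : Fin m → ℝ) :
    ∑ n, c n * (q ^ rho m n * root2 q i l f n.rev n) =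
      (c l - c i) * (q ^ rho m l * f l.rev i)
        + (c l.rev - c i.rev) * (q ^ rho m l.rev * wt q l l.rev * f i l.rev) := by
  have e : ∀ n, c n * (q ^ rho m n * root2 q i l f n.rev n) =
      ((if n = l then c n * (q ^ rho m n * (wt q i n.rev * f n.rev i)) else 0)
      - (if n = i.rev then
        c n * (q ^ rho m n * (wt q i n.rev * (q ^ (rho m l - rho m i) * f n.rev l.rev))) else 0))
      + ((if n = l.rev then c n * (q ^ rho m n * (wt q l n * f i n)) else 0)
      - (if n = i then
        c n * (q ^ rho m n * (wt q l n * (q ^ (rho m l - rho m i) * f l.rev n))) else 0)) := by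
    intro n
    simp only [root2, root, Fin.rev_eq_iff, Fin.rev_rev]
    split_ifs <;> ring
  simp only [e, Finset.sum_add_distrib, Finset.sum_sub_distrib, Finset.sum_ite_eq',
    Finset.mem_univ, if_true, Fin.rev_rev]
  have lt1 : i < l := by rw [Fin.lt_def]; omega
  have lt2 : l.rev < i.rev := Fin.rev_lt_rev.2 lt1
  have n1 : l.rev ≠ i := by intro h'; rw [h'] at h; exact absurd h lt1.not_ge
  have n2 : l.rev ≠ i.rev := lt2.ne
  have n3 : i ≠ l := lt1.ne
  have n4 : i ≠ i.rev := (lt1.trans_le (h.trans lt2.le)).ne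
  have n5 : i ≠ l.rev := n1.symm
  have k1 : wt q i l.rev = 1 := by simp [wt, n1, n2]
  have k2 : wt q i i = q := by simp [wt, n4]
  have k3 : wt q l i = 1 := by simp [wt, n3, n5]
  have E1 : q ^ rho m i * q ^ (rho m l - rho m i) = q ^ rho m l := by
    rw [← Real.rpow_add hq]; congr 1; ring
  have E2 : q ^ rho m i.rev * (q * q ^ (rho m l - rho m i)) = q ^ rho m l.rev * wt q l l.rev := by
    rw [rho_rev, rho_rev]
    rcases h.lt_or_eq with h | h
    · have e0 : wt q l l.rev = q⁻¹ := by simp [wt, h.ne']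
      have e1 : q ^ (rho m l - (rho m l + 1)) = q⁻¹ := by
        rw [← Real.rpow_neg_one]; congr 1; ring
      have e2 : q ^ (-(rho m l + 1)) = q ^ (-rho m l) * q⁻¹ := by
        rw [← Real.rpow_neg_one, ← Real.rpow_add hq]; congr 1; ring
      rw [e0, rho_of_succ_lt_rev hl h, e1, e2]
      field_simp
    · have e0 : wt q l l.rev = 1 := by simp [wt, ← h]
      have e1 : q ^ (-(1 / 2 : ℝ)) * q ^ (-(1 / 2 : ℝ)) = q⁻¹ := by
        rw [← Real.rpow_neg_one, ← Real.rpow_add hq]; congr 1; norm_num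
      rw [e0, rho_of_eq_rev h, rho_of_succ_eq_rev hl h, zero_sub, mul_left_comm, e1]
      simp [hq.ne']
  rw [k1, k2, k3]
  linear_combination (-(c i.rev * f i l.rev)) * E2 - c i * f l.rev i * E1

theorem sum_root2 (hq : 0 < q) {i l : Fin m} (hl : (l : ℕ) = i + 1) (h : l ≤ l.rev)
    (f : Fin m → Fin m → ℝ) (a : Fin m) :
    ∑ n, (if a < n then q ^ rho m n * root2 q i l f n.rev n else 0) =
      (if a = i then q ^ rho m l * f l.rev i else 0)
        - if a = l.rev then q ^ rho m l.rev * wt q l l.rev * f i l.rev else 0 := by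
  have e := sum_mul_root2 hq hl h f fun n => if a < n then 1 else 0
  simp only [ite_mul, one_mul, zero_mul] at e
  rw [e]
  have lt1 : i < l := by rw [Fin.lt_def]; omega
  have lt2 : l.rev < i.rev := Fin.rev_lt_rev.2 lt1
  have c1 : a < l ↔ (a = i ∨ a < i) := by rw [Fin.lt_def, Fin.lt_def, Fin.ext_iff]; omega
  have c2 : a < i.rev ↔ (a = l.rev ∨ a < l.rev) := by
    simp only [Fin.lt_def, Fin.ext_iff, Fin.val_rev]; omega
  have lt4 : i < l.rev := lt1.trans_le h
  rcases eq_or_ne a i with rfl | a1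
  · simp [lt1, lt4, lt4.trans lt2, lt4.ne]
  · rcases eq_or_ne a l.rev with rfl | a2
    · simp [h.not_gt, lt2, a1, lt4.not_gt]
    · simp [c1, c2, a1, a2]

theorem sum_lt_eq_of_succ {i l : Fin m} (hl : (l : ℕ) = i + 1) (g : Fin m → ℝ) :
    ∑ n, (if i < n then g n else 0) = g l + ∑ n, (if l < n then g n else 0) := by
  have e : ∀ n, (if i < n then g n else 0) = (if n = l then g n else 0) + if l < n then g n else 0 := by
    intro n
    have : i < n ↔ n = l ∨ l < n := by rw [Fin.lt_def, Fin.lt_def, Fin.ext_iff]; omega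
    simp only [this]
    by_cases h : n = l
    · simp [h]
    · simp [h]
  simp only [e, Finset.sum_add_distrib, Finset.sum_ite_eq', Finset.mem_univ, if_true]

/-- The generic case `l < l'`. Both sides are linear in the entries of `f`, so it suffices to compare
them for `a` and `b` each equal to one of `i, l, l', i'` or to none of these four indices; in the last
case all comparisons with `i` and `l` (or with `i'` and `l'`) agree, since these are neighbours. -/
theorem rop_root2_of_lt (hq : 0 < q) {i l : Fin m} (hl : (l : ℕ) = i + 1) (h : l < l.rev)
    (f : Fin m → Fin m → ℝ) (a b : Fin m) :
    rop q m (root2 q i l f) a b = root2 q i l (rop q m f) a b := by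
  have lt1 : i < l := by rw [Fin.lt_def]; omega
  have lt2 : l.rev < i.rev := Fin.rev_lt_rev.2 lt1
  have hc : ∀ a, a = i ∨ a = l ∨ a = l.rev ∨ a = i.rev ∨
      ((a ≠ i ∧ a ≠ l ∧ a ≠ l.rev ∧ a ≠ i.rev) ∧ (i ≠ a ∧ l ≠ a ∧ i ≠ a.rev ∧ l ≠ a.rev ∧
        l.rev ≠ a ∧ i.rev ≠ a ∧ l.rev ≠ a.rev ∧ i.rev ≠ a.rev) ∧
        (a < l ↔ a < i) ∧ (a < i.rev ↔ a < l.rev) ∧ (l < a ↔ i < a) ∧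
        (i.rev < a ↔ l.rev < a)) := by
    intro a; simp only [Fin.lt_def, ne_eq, Fin.ext_iff, Fin.val_rev]; omega
  have lt3 : i < i.rev := lt1.trans (h.trans lt2)
  have lt4 : i < l.rev := lt1.trans h
  have lt5 : l < i.rev := h.trans lt2
  have e1 : q ^ (rho m l - rho m i) = q⁻¹ := by
    rw [rho_of_succ_lt_rev hl h, ← Real.rpow_neg_one]; congr 1; ring
  have e2 : q ^ rho m i = q ^ rho m l * q := by
    rw [rho_of_succ_lt_rev hl h, Real.rpow_add_one hq.ne']
  have e3 : q ^ rho m l.rev = (q ^ rho m l)⁻¹ := by rw [rho_rev, Real.rpow_neg hq.le]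
  have e4 : q ^ rho m i.rev = (q ^ rho m l * q)⁻¹ := by rw [rho_rev, Real.rpow_neg hq.le, e2]
  have hw : q ^ rho m l ≠ 0 := (Real.rpow_pos_of_pos hq _).ne'
  have S1 := sum_lt_eq_of_succ hl fun n => q ^ rho m n * f n.rev n
  have S2 := sum_lt_eq_of_succ (i := l.rev) (l := i.rev) (by simp only [Fin.val_rev]; omega)
    fun n => q ^ rho m n * f n.rev n
  simp only [Fin.rev_rev] at S2
  rw [rop_apply hq]
  simp only [smul_eq_mul, sum_root2 hq hl h.le]
  simp only [root2, root, rop_apply hq, wt, smul_eq_mul, Real.rpow_neg hq.le, e1]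
  simp only [Fin.rev_eq_iff, Fin.rev_rev] at *
  rcases hc a with ha | ha | ha | ha | ⟨⟨a1, a2, a3, a4⟩, ⟨x1, x2, x3, x4, x5, x6, x7, x8⟩, a5, a6, a7, a8⟩ <;>
  rcases hc b with hb | hb | hb | hb | ⟨⟨b1, b2, b3, b4⟩, ⟨y1, y2, y3, y4, y5, y6, y7, y8⟩, b5, b6, b7, b8⟩ <;>
  simp only [*, Fin.rev_rev, if_true, if_false, lt_irrefl, lt1.ne, lt1.ne', lt2.ne, lt2.ne', lt3.ne, lt3.ne',
    lt4.ne, lt4.ne', lt5.ne, lt5.ne', h.ne, h.ne', lt1.not_gt, lt2.not_gt, lt3.not_gt, lt4.not_gt,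
    lt5.not_gt, h.not_gt, sub_zero, zero_sub, sub_self, zpow_zero, zpow_one, zpow_neg, mul_zero,
    add_zero, zero_add, one_mul, ite_self] <;>
  first
    | done
    | ring1
    | (field_simp; done)
    | (field_simp; ring1)
    | (split_ifs <;> ring1)

/-- The case of odd `m` with `l = l'` the middle index, where the four indices `i, l, l', i'` collapse
to three and `ρ_i = 1/2`, `ρ_l = 0`. -/
theorem rop_root2_of_eq (hq : 0 < q) {i l : Fin m} (hl : (l : ℕ) = i + 1) (h : l.rev = l)
    (f : Fin m → Fin m → ℝ) (a b : Fin m) :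
    rop q m (root2 q i l f) a b = root2 q i l (rop q m f) a b := by
  have lt1 : i < l := by rw [Fin.lt_def]; omega
  have hi : l < i.rev := by
    conv_lhs => rw [← h]
    exact Fin.rev_lt_rev.2 lt1
  have lt3 : i < i.rev := lt1.trans hi
  have hc : ∀ a, a = i ∨ a = l ∨ a = i.rev ∨
      ((a ≠ i ∧ a ≠ l ∧ a ≠ i.rev) ∧ (i ≠ a ∧ l ≠ a ∧ i ≠ a.rev ∧ l ≠ a.rev ∧
        i.rev ≠ a ∧ i.rev ≠ a.rev) ∧
        (a < l ↔ a < i) ∧ (a < i.rev ↔ a < l) ∧ (l < a ↔ i < a) ∧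
        (i.rev < a ↔ l < a)) := by
    have h' := congrArg Fin.val h
    intro a; simp only [Fin.lt_def, ne_eq, Fin.ext_iff, Fin.val_rev] at *; omega
  have r1 := rho_of_succ_eq_rev hl h.symm
  have r2 := rho_of_eq_rev h.symm
  obtain ⟨s, hs, hs0, hs2⟩ : ∃ s, q ^ (1 / 2 : ℝ) = s ∧ s ≠ 0 ∧ s ^ 2 = q :=
    ⟨_, rfl, (Real.rpow_pos_of_pos hq _).ne', by
      rw [← Real.rpow_natCast, ← Real.rpow_mul hq.le]; norm_num⟩
  have e1 : q ^ (rho m l - rho m i) = s⁻¹ := by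
    rw [r1, r2, zero_sub, Real.rpow_neg hq.le, hs]
  have e2 : q ^ rho m i = s := by rw [r1, hs]
  have e3 : q ^ rho m l = 1 := by rw [r2, Real.rpow_zero]
  have e4 : q ^ rho m i.rev = s⁻¹ := by rw [rho_rev, Real.rpow_neg hq.le, e2]
  have S1 := sum_lt_eq_of_succ hl fun n => q ^ rho m n * f n.rev n
  have S2 := sum_lt_eq_of_succ (i := l) (l := i.rev)
    (by have h' := congrArg Fin.val h; simp only [Fin.val_rev] at *; omega)
    fun n => q ^ rho m n * f n.rev n
  simp only [Fin.rev_rev] at S2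
  rw [rop_apply hq]
  simp only [smul_eq_mul, sum_root2 hq hl h.ge]
  simp only [root2, root, rop_apply hq, wt, smul_eq_mul, Real.rpow_neg hq.le, e1]
  clear hs r1 r2
  rcases hc a with ha | ha | ha | ⟨⟨a1, a2, a4⟩, ⟨x1, x2, x3, x4, x6, x8⟩, a5, a6, a7, a8⟩ <;>
  rcases hc b with hb | hb | hb | ⟨⟨b1, b2, b4⟩, ⟨y1, y2, y3, y4, y6, y8⟩, b5, b6, b7, b8⟩ <;>
  simp only [*, Fin.rev_rev, if_true, if_false, lt_irrefl, lt1.ne, lt1.ne', hi.ne, hi.ne',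
    lt3.ne, lt3.ne', lt1.not_gt, hi.not_gt, lt3.not_gt, inv_one, sub_zero,
    zero_sub, sub_self, zpow_zero, zpow_one, zpow_neg, mul_zero,
    add_zero, zero_add, mul_one, one_mul, ite_self] <;> subst hs2 <;>
  first
    | done
    | ring1
    | (field_simp; done)
    | (field_simp; ring1)
    | (split_ifs <;> ring1)

/-- The braid matrix commutes with the simple root vectors. -/
theorem rop_root2 (hq : 0 < q) {i l : Fin m} (hl : (l : ℕ) = i + 1) (h : l ≤ l.rev)
    (f : Fin m → Fin m → ℝ) : rop q m (root2 q i l f) = root2 q i l (rop q m f) := by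
  ext a b
  rcases h.lt_or_eq with h | h
  · exact rop_root2_of_lt hq hl h f a b
  · exact rop_root2_of_eq hq hl h.symm f a b

end Root

/-! ### The braid relation -/

section Root
variable {q : ℝ} {m : ℕ}

/-- For even `m`, the braid matrix commutes with the exchange of the two middle indices `i` and `l`.
This replaces the simple root of `so_m` that the root vectors `root i l` with `l ≤ l'` leave out. -/
theorem rop_swap (hq : 0 < q) {i l : Fin m} (hl : (l : ℕ) = i + 1) (h : l = i.rev)
    (f : Fin m → Fin m → ℝ) (a b : Fin m) :
    rop q m (fun a b => f (Equiv.swap i l a) (Equiv.swap i l b)) a b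
      = rop q m f (Equiv.swap i l a) (Equiv.swap i l b) := by
  have hl' : i = l.rev := by rw [h, Fin.rev_rev]
  have lt1 : i < l := by rw [Fin.lt_def]; omega
  have r0 : rho m i = 0 := rho_of_succ_eq_rev_self hl h
  have r1 : rho m l = 0 := by rw [h, rho_rev, r0, neg_zero]
  have hc : ∀ a, a = i ∨ a = l ∨ ((a ≠ i ∧ a ≠ l) ∧ (i ≠ a ∧ l ≠ a ∧ i ≠ a.rev ∧ l ≠ a.rev) ∧
        (a < l ↔ a < i) ∧ (l < a ↔ i < a)) := by
    have h' := congrArg Fin.val h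
    intro a; simp only [Fin.lt_def, ne_eq, Fin.ext_iff, Fin.val_rev] at *; omega
  have S1 := sum_lt_eq_of_succ hl fun n => q ^ rho m n * f n.rev n
  have S : ∀ a, a ≠ i → ∑ n, (if a < n then q ^ rho m n *
      f (Equiv.swap i l n.rev) (Equiv.swap i l n) else 0)
      = ∑ n, if a < n then q ^ rho m n * f n.rev n else 0 := by
    intro a ha
    rw [← Equiv.sum_comp (Equiv.swap i l)]
    refine Finset.sum_congr rfl fun n _ => ?_
    rcases hc n with rfl | rfl | ⟨⟨n1, n2⟩, ⟨n3, n4, n5, n6⟩, n7⟩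
    · rw [Equiv.swap_apply_left, ← hl', Equiv.swap_apply_left, Equiv.swap_apply_right, ← h, r0, r1]
      congr 1
      rw [eq_iff_iff, Fin.lt_def, Fin.lt_def]
      rw [ne_eq, Fin.ext_iff] at ha
      omega
    · rw [Equiv.swap_apply_right, ← h, Equiv.swap_apply_left, Equiv.swap_apply_right, ← hl', r0, r1]
      congr 1
      rw [eq_iff_iff, Fin.lt_def, Fin.lt_def]
      rw [ne_eq, Fin.ext_iff] at ha
      omega
    · simp only [Equiv.swap_apply_of_ne_of_ne n1 n2, Equiv.swap_apply_of_ne_of_ne n5.symm n6.symm]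
  have S2 : ∑ n, (if i < n then q ^ rho m n * f (Equiv.swap i l n.rev) (Equiv.swap i l n) else 0)
      = f l i + ∑ n, if l < n then q ^ rho m n * f n.rev n else 0 := by
    rw [sum_lt_eq_of_succ hl fun n => q ^ rho m n * f (Equiv.swap i l n.rev) (Equiv.swap i l n),
      S l lt1.ne', r1, Real.rpow_zero, one_mul, Equiv.swap_apply_right, ← hl',
      Equiv.swap_apply_left]
  have S3 := S l lt1.ne'
  rw [r1, Real.rpow_zero, one_mul, ← hl'] at S1
  rw [rop_apply hq, rop_apply hq]
  simp only [smul_eq_mul, Real.rpow_neg hq.le]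
  have hd : ∀ a, a = i ∨ a = l ∨ (Equiv.swap i l a = a ∧ (a ≠ i ∧ a ≠ l) ∧
      (i ≠ a ∧ l ≠ a ∧ i ≠ a.rev ∧ l ≠ a.rev) ∧ (a < l ↔ a < i) ∧ (l < a ↔ i < a)) := fun a =>
    (hc a).imp_right (Or.imp_right fun h => ⟨Equiv.swap_apply_of_ne_of_ne h.1.1 h.1.2, h⟩)
  have h1 : i.rev = l := h.symm
  have h2 : l.rev = i := hl'.symm
  clear h hl' hc
  rcases hd a with ha | ha | ⟨a0, ⟨a1, a2⟩, ⟨x1, x2, x3, x4⟩, a5, a6⟩ <;>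
  rcases hd b with hb | hb | ⟨b0, ⟨b1, b2⟩, ⟨y1, y2, y3, y4⟩, b5, b6⟩ <;>
  simp only [*, Equiv.swap_apply_left, Equiv.swap_apply_right,
    Real.rpow_zero, inv_one, one_mul, lt1.ne, lt1.ne', lt1.not_gt, lt_irrefl, if_true, if_false,
    ne_eq, not_false_eq_true] <;>
  first
    | done
    | ring1

theorem root_zero (i l a : Fin m) : root q i l (fun _ => 0) a = 0 := by simp [root]

theorem root_self {i l : Fin m} (hl : (l : ℕ) = i + 1) (h : l ≤ l.rev) (g : Fin m → ℝ) :
    root q i l g l = g i := by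
  have : l ≠ i.rev := by
    have : l < i.rev := by
      rw [Fin.le_def] at h; rw [Fin.lt_def]; simp only [Fin.val_rev] at *; omega
    exact this.ne
  simp [root, this]

theorem root_rev {i l : Fin m} (hl : (l : ℕ) = i + 1) (h : l ≤ l.rev) (g : Fin m → ℝ) :
    root q i l g i.rev = -(q ^ (rho m l - rho m i) * g l.rev) := by
  have : i.rev ≠ l := by
    have : l < i.rev := by
      rw [Fin.le_def] at h; rw [Fin.lt_def]; simp only [Fin.val_rev] at *; omega
    exact this.ne'
  simp [root, this]

theorem wt_ne_zero (hq : 0 < q) (i a : Fin m) : wt q i a ≠ 0 := (zpow_pos hq _).ne'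

/-- A family of two-index tensors that is stable under the simple root vectors and under the
exchange of the middle indices vanishes if its last rows do. -/
theorem descent_two (hq : 0 < q) {X : Type*} (Φ : X → Fin m → Fin m → ℝ)
    (h0 : ∀ x (a b : Fin m), (a : ℕ) + 1 = m → Φ x a b = 0)
    (h1 : ∀ x (i l : Fin m), (l : ℕ) = i + 1 → l ≤ l.rev → ∃ y, root2 q i l (Φ x) = Φ y)
    (h2 : ∀ x (i l : Fin m), (l : ℕ) = i + 1 → l = i.rev →
      ∃ y, (fun a b => Φ x (Equiv.swap i l a) (Equiv.swap i l b)) = Φ y) (x : X) : Φ x = 0 := by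
  have : ∀ a, ∀ x b, Φ x a b = 0 := by
    refine descent (fun a ha x b => h0 x a b ha) (fun i l hl h => ⟨fun hP x b => ?_, fun hP x b => ?_⟩)
      (fun i l hl h hP x b => ?_)
    · obtain ⟨y, hy⟩ := h1 x i l hl h
      have := congrFun (congrFun hy l) b
      rw [hP, root2, root_self hl h, show Φ x l = fun _ => 0 from funext fun b => hP x b,
        root_zero, mul_zero, zero_add] at this
      exact (mul_eq_zero.1 this).resolve_left (wt_ne_zero hq _ _)
    · obtain ⟨y, hy⟩ := h1 x i l hl h
      have := congrFun (congrFun hy i.rev) b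
      rw [hP, root2, root_rev hl h, show Φ x i.rev = fun _ => 0 from funext fun b => hP x b,
        root_zero, mul_zero, zero_add] at this
      have := (mul_eq_zero.1 this).resolve_left (wt_ne_zero hq _ _)
      exact (mul_eq_zero.1 (neg_eq_zero.1 this)).resolve_left (Real.rpow_pos_of_pos hq _).ne'
    · obtain ⟨y, hy⟩ := h2 x i l hl h
      have := congrFun (congrFun hy l) (Equiv.swap i l b)
      rw [hP] at this
      simpa using this
  ext a b
  exact this a x b

/-- The action of a simple root vector on three-index tensors. -/
noncomputable def root3 (q : ℝ) (i l : Fin m) (f : Fin m → Fin m → Fin m → ℝ) (a b c : Fin m) : ℝ :=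
  wt q i a * wt q i b * root q i l (f a b) c + wt q i a * wt q l c * root q i l (fun b => f a b c) b
    + wt q l b * wt q l c * root q i l (fun a => f a b c) a

/-- The analogue of `descent_two` for three indices: only the rows whose first index is the last one
have to be checked. -/
theorem descent_three (hq : 0 < q) {X : Type*} (Φ : X → Fin m → Fin m → Fin m → ℝ)
    (h0 : ∀ x (a b c : Fin m), (a : ℕ) + 1 = m → Φ x a b c = 0)
    (h1 : ∀ x (i l : Fin m), (l : ℕ) = i + 1 → l ≤ l.rev → ∃ y, root3 q i l (Φ x) = Φ y)
    (h2 : ∀ x (i l : Fin m), (l : ℕ) = i + 1 → l = i.rev →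
      ∃ y, (fun a b c => Φ x (Equiv.swap i l a) (Equiv.swap i l b) (Equiv.swap i l c)) = Φ y)
    (x : X) : Φ x = 0 := by
  have : ∀ a, ∀ x b c, Φ x a b c = 0 := by
    refine descent (fun a ha x b c => h0 x a b c ha)
      (fun i l hl h => ⟨fun hP x b c => ?_, fun hP x b c => ?_⟩) (fun i l hl h hP x b c => ?_)
    · obtain ⟨y, hy⟩ := h1 x i l hl h
      have := congrFun (congrFun (congrFun hy l) b) c
      rw [hP, root3, root_self hl h, show Φ x l = fun _ _ => 0 from funext₂ fun b c => hP x b c,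
        root_zero, root_zero, mul_zero, mul_zero, zero_add, zero_add] at this
      exact (mul_eq_zero.1 this).resolve_left (mul_ne_zero (wt_ne_zero hq _ _) (wt_ne_zero hq _ _))
    · obtain ⟨y, hy⟩ := h1 x i l hl h
      have := congrFun (congrFun (congrFun hy i.rev) b) c
      rw [hP, root3, root_rev hl h, show Φ x i.rev = fun _ _ => 0 from funext₂ fun b c => hP x b c,
        root_zero, root_zero, mul_zero, mul_zero, zero_add, zero_add] at this
      have := (mul_eq_zero.1 this).resolve_left
        (mul_ne_zero (wt_ne_zero hq _ _) (wt_ne_zero hq _ _))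
      exact (mul_eq_zero.1 (neg_eq_zero.1 this)).resolve_left (Real.rpow_pos_of_pos hq _).ne'
    · obtain ⟨y, hy⟩ := h2 x i l hl h
      have := congrFun (congrFun (congrFun hy l) (Equiv.swap i l b)) (Equiv.swap i l c)
      rw [hP] at this
      simpa using this
  ext a b c
  exact this a x b c

theorem rop_root (i l c : Fin m) (f : Fin m → Fin m → Fin m → ℝ) (a b : Fin m) :
    rop q m (fun a b => root q i l (f a b) c) a b
      = root q i l (fun c => rop q m (fun a b => f a b c) a b) c := by
  have : (fun a b => root q i l (f a b) c) = (if c = l then (1 : ℝ) else 0) • (fun a b => f a b i)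
      - (if c = i.rev then q ^ (rho m l - rho m i) else 0) • fun a b => f a b l.rev := by
    ext a b; simp only [root, Pi.sub_apply, Pi.smul_apply, smul_eq_mul]; split_ifs <;> simp
  rw [this, map_sub, map_smul, map_smul]
  simp only [root, Pi.sub_apply, Pi.smul_apply, smul_eq_mul]
  split_ifs <;> simp

theorem on12_rop_root3 (hq : 0 < q) {i l : Fin m} (hl : (l : ℕ) = i + 1) (h : l ≤ l.rev)
    (f : Fin m → Fin m → Fin m → ℝ) :
    on12 m (rop q m) (root3 q i l f) = root3 q i l (on12 m (rop q m) f) := by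
  ext a b c
  rw [on12_apply]
  have : (fun a b => root3 q i l f a b c) = (fun a b => wt q i a * wt q i b * root q i l (f a b) c)
      + wt q l c • root2 q i l (fun a b => f a b c) := by
    ext a b; simp only [root3, root2, Pi.add_apply, Pi.smul_apply, smul_eq_mul]; ring
  rw [this, map_add, map_smul, rop_root2 hq hl h, Pi.add_apply, Pi.add_apply, wt_rop hq, rop_root]
  have e : on12 m (rop q m) f a b = fun c => rop q m (fun a b => f a b c) a b := rfl
  simp only [root3, root2, Pi.smul_apply, smul_eq_mul, on12_apply, e]; ring

theorem on23_rop_root3 (hq : 0 < q) {i l : Fin m} (hl : (l : ℕ) = i + 1) (h : l ≤ l.rev)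
    (f : Fin m → Fin m → Fin m → ℝ) :
    on23 m (rop q m) (root3 q i l f) = root3 q i l (on23 m (rop q m) f) := by
  ext a b c
  rw [on23_apply]
  have : root3 q i l f a = (fun b c => wt q l b * wt q l c * root q i l (fun a => f a b c) a)
      + wt q i a • root2 q i l (f a) := by
    ext b c; simp only [root3, root2, Pi.add_apply, Pi.smul_apply, smul_eq_mul]; ring
  rw [this, map_add, map_smul, rop_root2 hq hl h, Pi.add_apply, Pi.add_apply, wt_rop hq,
    rop_root i l a (fun b c a => f a b c)]
  simp only [root3, root2, Pi.smul_apply, smul_eq_mul, on23_apply]; ring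

/-- In the last row the braid matrix is diagonal up to the exchange of the indices. -/
theorem rop_last (hq : 0 < q) (f : Fin m → Fin m → ℝ) {a : Fin m} (ha : (a : ℕ) + 1 = m)
    (b : Fin m) : rop q m f a b = wt q a b * f b a := by
  have h1 : ∀ n, ¬ a < n := fun n => by rw [Fin.lt_def]; omega
  have h2 : a = b.rev ↔ b = a.rev := by rw [eq_comm, Fin.rev_eq_iff]
  rw [rop_apply hq]
  simp [h1, h2, wt, eq_comm (a := a) (b := b)]

/-- The braid relation (Yang-Baxter equation). Both sides commute with the simple root vectors, so by
descent it suffices to compare the rows whose first index is the last one, where the braid matrix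
acts by the torus. -/
theorem braid_relation_real (hq : 0 < q) (f : Fin m → Fin m → Fin m → ℝ) :
    on12 m (rop q m) (on23 m (rop q m) (on12 m (rop q m) f))
      = on23 m (rop q m) (on12 m (rop q m) (on23 m (rop q m) f)) := by
  rw [← sub_eq_zero]
  refine descent_three hq (fun f => on12 m (rop q m) (on23 m (rop q m) (on12 m (rop q m) f))
      - on23 m (rop q m) (on12 m (rop q m) (on23 m (rop q m) f))) ?_ ?_ ?_ f
  · intro f a b c ha
    have e1 : ∀ (g : Fin m → Fin m → Fin m → ℝ) b c,
        on12 m (rop q m) g a b c = wt q a b * g b a c :=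
      fun g b c => rop_last hq (fun a b => g a b c) ha b
    have e2 : ∀ (g : Fin m → Fin m → Fin m → ℝ) b c,
        on23 m (rop q m) g b a c = wt q a c * g b c a :=
      fun g b c => rop_last hq (g b) ha c
    have e3 : on23 m (rop q m) (on12 m (rop q m) (on23 m (rop q m) f)) a b c =
        rop q m (fun b c => wt q a b * wt q a c * f b c a) b c := by
      have : on12 m (rop q m) (on23 m (rop q m) f) a
          = fun b c => wt q a b * wt q a c * f b c a := by
        ext b c; rw [e1, e2, mul_assoc]
      rw [on23_apply, this]
    simp only [Pi.sub_apply]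
    rw [e3, wt_rop hq, e1, e2, on12_apply]
    ring
  · intro f i l hl h
    refine ⟨root3 q i l f, ?_⟩
    simp only [on12_rop_root3 hq hl h, on23_rop_root3 hq hl h]
    ext a b c
    simp only [root3, root, Pi.sub_apply]
    split_ifs <;> ring
  · intro f i l hl h
    refine ⟨fun a b c => f (Equiv.swap i l a) (Equiv.swap i l b) (Equiv.swap i l c), ?_⟩
    have e1 : ∀ g : Fin m → Fin m → Fin m → ℝ, on12 m (rop q m) (fun a b c => g (Equiv.swap i l a)
        (Equiv.swap i l b) (Equiv.swap i l c)) = fun a b c => on12 m (rop q m) g (Equiv.swap i l a)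
        (Equiv.swap i l b) (Equiv.swap i l c) := by
      intro g; ext a b c
      exact rop_swap hq hl h (fun a b => g a b (Equiv.swap i l c)) a b
    have e2 : ∀ g : Fin m → Fin m → Fin m → ℝ, on23 m (rop q m) (fun a b c => g (Equiv.swap i l a)
        (Equiv.swap i l b) (Equiv.swap i l c)) = fun a b c => on23 m (rop q m) g (Equiv.swap i l a)
        (Equiv.swap i l b) (Equiv.swap i l c) := by
      intro g; ext a b c
      exact rop_swap hq hl h (g (Equiv.swap i l a)) b c
    ext a b c
    simp only [e1, e2, Pi.sub_apply]

end Root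

/-! ### The inverse of the braid matrix and the invariance of the metric -/

section Invariance
variable {q : ℝ} {m : ℕ}

/-- The contraction with the metric is invariant under the simple root vectors. -/
theorem cap_root2 (hq : 0 < q) {i l : Fin m} (hl : (l : ℕ) = i + 1) (h : l ≤ l.rev)
    (f : Fin m → Fin m → ℝ) : cap q m (root2 q i l f) = 0 := by
  rw [cap_apply, ← Equiv.sum_comp Fin.revPerm]
  have := sum_mul_root2 hq hl h f fun _ => 1
  simpa [rho_rev] using this

/-- The metric is invariant under the simple root vectors. -/
theorem root2_cup (hq : 0 < q) {i l : Fin m} (hl : (l : ℕ) = i + 1) (h : l ≤ l.rev) (x : ℝ) :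
    root2 q i l (cup q m x) = 0 := by
  have lt1 : i < l := by rw [Fin.lt_def]; omega
  have lt2 : l.rev < i.rev := Fin.rev_lt_rev.2 lt1
  have n1 : i ≠ l.rev := (lt1.trans_le h).ne
  have n4 : i ≠ i.rev := (lt1.trans_le (h.trans lt2.le)).ne
  have n7 : l ≠ i.rev := (h.trans_lt lt2).ne
  have hw := (Real.rpow_pos_of_pos hq (rho m l)).ne'
  have hw' := (Real.rpow_pos_of_pos hq (rho m i)).ne'
  have e0 : q ^ (rho m l - rho m i) = q ^ rho m l * (q ^ (rho m i))⁻¹ := by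
    rw [Real.rpow_sub hq]; rfl
  have key : q⁻¹ * q ^ rho m i = wt q l l * (q ^ (rho m l - rho m i) * q ^ rho m l) := by
    rcases h.lt_or_eq with h | h
    · have k : wt q l l = q := by simp [wt, h.ne]
      rw [k, e0, rho_of_succ_lt_rev hl h, Real.rpow_add_one hq.ne']
      field_simp
    · have k : wt q l l = 1 := by simp [wt, ← h]
      have e1 : q ^ (1 / 2 : ℝ) * q ^ (1 / 2 : ℝ) = q := by
        rw [← Real.rpow_add hq]; norm_num
      have e2 : q ^ (1 / 2 : ℝ) ≠ 0 := (Real.rpow_pos_of_pos hq _).ne'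
      rw [k, e0, rho_of_eq_rev h, rho_of_succ_eq_rev hl h, Real.rpow_zero]
      generalize q ^ (1 / 2 : ℝ) = s at e1 e2
      subst e1
      field_simp
  have k1 : wt q i i.rev = q⁻¹ := by simp [wt, n4.symm]
  have k2 : wt q i l = 1 := by simp [wt, lt1.ne', n7]
  have k3 : wt q l i.rev = 1 := by simp [wt, n7.symm, Fin.rev_inj, lt1.ne]
  ext a b
  simp only [root2, root, cup_apply, Pi.zero_apply, smul_eq_mul, Fin.rev_rev,
    Real.rpow_neg hq.le, Fin.rev_inj]
  have hi : i = a.rev ↔ a = i.rev := by rw [eq_comm, Fin.rev_eq_iff]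
  have hl' : l = a.rev ↔ a = l.rev := by rw [eq_comm, Fin.rev_eq_iff]
  have e5 : q ^ rho m i.rev = (q ^ rho m i)⁻¹ := by rw [rho_rev, Real.rpow_neg hq.le]
  have e6 : q ^ rho m l.rev = (q ^ rho m l)⁻¹ := by rw [rho_rev, Real.rpow_neg hq.le]
  by_cases a1 : a = l
  · subst a1
    by_cases b1 : b = i.rev
    · subst b1
      simp only [n7, n7.symm, if_true, if_false, k2, k3, e0, hi]
      field_simp
      ring
    · simp [b1, n7, hi]
  · by_cases a2 : a = i.rev
    · subst a2
      by_cases b1 : b = l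
      · subst b1
        simp only [n7, n7.symm, if_true, if_false, k1, e5, e6, inv_inv, Fin.rev_rev]
        linear_combination x * key
      · simp [b1, n7, n7.symm]
    · have : l.rev = a.rev ↔ a = l := by rw [Fin.rev_inj, eq_comm]
      simp [a1, a2, hi, eq_comm (a := l) (b := a)]

theorem swap_rev {i l : Fin m} (h : l = i.rev) (a : Fin m) :
    (Equiv.swap i l a).rev = Equiv.swap i l a.rev := by
  have hl' : i = l.rev := by rw [h, Fin.rev_rev]
  by_cases a1 : a = i
  · rw [a1, Equiv.swap_apply_left, ← h, ← hl', Equiv.swap_apply_right]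
  by_cases a2 : a = l
  · rw [a2, Equiv.swap_apply_right, ← h, ← hl', Equiv.swap_apply_left]
  rw [Equiv.swap_apply_of_ne_of_ne a1 a2, Equiv.swap_apply_of_ne_of_ne]
  · rwa [ne_eq, Fin.rev_eq_iff, ← h]
  · rwa [ne_eq, Fin.rev_eq_iff, ← hl']

theorem rho_swap {i l : Fin m} (hl : (l : ℕ) = i + 1) (h : l = i.rev) (a : Fin m) :
    rho m (Equiv.swap i l a) = rho m a := by
  have r0 : rho m i = 0 := rho_of_succ_eq_rev_self hl h
  have r1 : rho m l = 0 := by rw [h, rho_rev, r0, neg_zero]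
  by_cases a1 : a = i
  · rw [a1, Equiv.swap_apply_left, r0, r1]
  by_cases a2 : a = l
  · rw [a2, Equiv.swap_apply_right, r0, r1]
  rw [Equiv.swap_apply_of_ne_of_ne a1 a2]

theorem cap_swap {i l : Fin m} (hl : (l : ℕ) = i + 1) (h : l = i.rev)
    (f : Fin m → Fin m → ℝ) :
    cap q m (fun a b => f (Equiv.swap i l a) (Equiv.swap i l b)) = cap q m f := by
  rw [cap_apply, cap_apply, ← Equiv.sum_comp (Equiv.swap i l)]
  refine Finset.sum_congr rfl fun a _ => ?_
  rw [swap_rev h, Equiv.swap_apply_self, Equiv.swap_apply_self, rho_swap hl h]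

theorem cup_swap {i l : Fin m} (hl : (l : ℕ) = i + 1) (h : l = i.rev) (x : ℝ) (a b : Fin m) :
    cup q m x (Equiv.swap i l a) (Equiv.swap i l b) = cup q m x a b := by
  rw [cup_apply, cup_apply, rho_swap hl h, swap_rev h]
  simp only [(Equiv.swap i l).apply_eq_iff_eq]

theorem rinv_apply (f : Fin m → Fin m → ℝ) :
    rinv q m f = rop q m f - (q - q⁻¹) • (f - cup q m (cap q m f)) := rfl

theorem rinv_root2 (hq : 0 < q) {i l : Fin m} (hl : (l : ℕ) = i + 1) (h : l ≤ l.rev)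
    (f : Fin m → Fin m → ℝ) : rinv q m (root2 q i l f) = root2 q i l (rinv q m f) := by
  have e : root2 q i l (rinv q m f) = root2 q i l (rop q m f)
      - (q - q⁻¹) • (root2 q i l f - root2 q i l (cup q m (cap q m f))) := by
    ext a b
    simp only [rinv_apply, root2, root, Pi.sub_apply, Pi.smul_apply, smul_eq_mul]
    split_ifs <;> ring
  rw [e, rinv_apply, rop_root2 hq hl h, cap_root2 hq hl h, root2_cup hq hl h, map_zero]

theorem rinv_swap (hq : 0 < q) {i l : Fin m} (hl : (l : ℕ) = i + 1) (h : l = i.rev)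
    (f : Fin m → Fin m → ℝ) (a b : Fin m) :
    rinv q m (fun a b => f (Equiv.swap i l a) (Equiv.swap i l b)) a b
      = rinv q m f (Equiv.swap i l a) (Equiv.swap i l b) := by
  simp only [rinv_apply, Pi.sub_apply, Pi.smul_apply, rop_swap hq hl h, cap_swap hl h,
    cup_swap hl h]

/-- `rinv` is a right inverse of the braid matrix, by descent from the last row. -/
theorem rop_rinv_real (hq : 0 < q) (f : Fin m → Fin m → ℝ) : rop q m (rinv q m f) = f := by
  rw [← sub_eq_zero]
  refine descent_two hq (fun f => rop q m (rinv q m f) - f) ?_ ?_ ?_ f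
  · intro f a b ha
    have h1 : ∀ n, n ≤ a := fun n => by rw [Fin.le_def]; omega
    have h2 : ∀ n, a.rev ≤ n := fun n => by rw [Fin.le_def, Fin.val_rev]; omega
    have hw := (Real.rpow_pos_of_pos hq (rho m b)).ne'
    rw [Pi.sub_apply, Pi.sub_apply, rop_last hq _ ha, rinv_apply]
    simp only [Pi.sub_apply, Pi.smul_apply, rop_apply hq, cup_apply, cap_apply, wt, smul_eq_mul,
      Real.rpow_neg hq.le]
    have hS : (∑ n, (q ^ rho m n)⁻¹ * f n n.rev) = ∑ n, q ^ rho m n * f n.rev n := by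
      rw [← Equiv.sum_comp Fin.revPerm]
      simp [rho_rev, Real.rpow_neg hq.le]
    rw [hS]
    have hT : ∑ n, q ^ rho m n * f n.rev n = q ^ rho m a.rev * f a a.rev +
        ∑ n, if a.rev < n then q ^ rho m n * f n.rev n else 0 := by
      have : ∀ n, q ^ rho m n * f n.rev n = (if n = a.rev then q ^ rho m n * f n.rev n else 0) +
          if a.rev < n then q ^ rho m n * f n.rev n else 0 := by
        intro n
        rcases eq_or_lt_of_le (h2 n) with h | h
        · simp [← h]
        · simp [h, h.ne']
      rw [Finset.sum_congr rfl fun n _ => this n, Finset.sum_add_distrib]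
      simp
    have ht : a = b.rev ↔ b = a.rev := by rw [eq_comm, Fin.rev_eq_iff]
    rw [hT]
    have e0 : q ^ rho m a.rev = (q ^ rho m a)⁻¹ := by rw [rho_rev, Real.rpow_neg hq.le]
    have e1 := (Real.rpow_pos_of_pos hq (rho m a)).ne'
    by_cases c1 : b = a
    · subst c1
      by_cases c2 : b = b.rev
      · have c3 : q ^ rho m b = 1 := by
          rw [rho_of_eq_rev c2, Real.rpow_zero]
        simp only [← c2, lt_irrefl, if_true, if_false, c3]
        simp
      · simp only [c2, lt_irrefl, if_true, if_false]
        simp only [sub_zero, zpow_one, mul_zero]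
        field_simp
        ring
    · have c3 : b < a := lt_of_le_of_ne (h1 b) c1
      by_cases c2 : b = a.rev
      · subst c2
        simp only [c1, c3, Fin.rev_rev, if_true, if_false, e0]
        simp only [zero_sub, zpow_neg, zpow_one]
        field_simp
        ring
      · have c4 : a ≠ b.rev := fun h => c2 (ht.1 h)
        simp only [c1, c2, c3, c4, if_true, if_false]
        simp
  · intro f i l hl h
    refine ⟨root2 q i l f, ?_⟩
    simp only [rinv_root2 hq hl h, rop_root2 hq hl h]
    ext a b
    simp only [root2, root, Pi.sub_apply]
    split_ifs <;> ring
  · intro f i l hl h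
    refine ⟨fun a b => f (Equiv.swap i l a) (Equiv.swap i l b), ?_⟩
    have e : rinv q m (fun a b => f (Equiv.swap i l a) (Equiv.swap i l b))
      = fun a b => rinv q m f (Equiv.swap i l a) (Equiv.swap i l b) := by
      ext a b; exact rinv_swap hq hl h f a b
    ext a b
    simp only [e, Pi.sub_apply, rop_swap hq hl h]

/-- The metric is an eigenvector of the braid matrix, by descent from the last row. -/
theorem rop_cup_real (hq : 0 < q) (x : ℝ) :
    rop q m (cup q m x) = q ^ (1 - (m : ℤ)) • cup q m x := by
  rw [← sub_eq_zero]
  refine descent_two hq (fun x : ℝ => rop q m (cup q m x) - q ^ (1 - (m : ℤ)) • cup q m x)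
    ?_ ?_ ?_ x
  · intro x a b ha
    rw [Pi.sub_apply, Pi.sub_apply, rop_last hq _ ha]
    simp only [Pi.smul_apply, cup_apply, smul_eq_mul]
    have ht : a = b.rev ↔ b = a.rev := by rw [eq_comm, Fin.rev_eq_iff]
    by_cases c2 : b = a.rev
    · subst c2
      simp only [Fin.rev_rev, if_true]
      by_cases hm : m = 1
      · subst hm
        have : a.rev = a := Subsingleton.elim _ _
        simp [this, wt]
      · have hm2 : 2 ≤ m := by have := a.2; omega
        have hr : a.rev ≠ a := by
          rw [ne_eq, Fin.ext_iff, Fin.val_rev]; omega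
        have : wt q a a.rev = q⁻¹ := by simp [wt, hr]
        rw [this, rho_rev, rho_of_last ha hm2, neg_neg, ← Real.rpow_neg_one, ← mul_assoc,
          ← Real.rpow_add hq, ← Real.rpow_intCast, ← mul_assoc, ← Real.rpow_add hq]
        push_cast
        ring_nf
    · have c4 : a ≠ b.rev := fun h => c2 (ht.1 h)
      simp [c2, c4]
  · intro x i l hl h
    refine ⟨0, ?_⟩
    have e : root2 q i l (rop q m (cup q m x) - q ^ (1 - (m : ℤ)) • cup q m x)
        = root2 q i l (rop q m (cup q m x)) - q ^ (1 - (m : ℤ)) • root2 q i l (cup q m x) := by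
      ext a b
      simp only [root2, root, Pi.sub_apply, Pi.smul_apply, smul_eq_mul]
      split_ifs <;> ring
    simp only [e, ← rop_root2 hq hl h, root2_cup hq hl h, map_zero]
  · intro x i l hl h
    refine ⟨x, ?_⟩
    ext a b
    simp only [Pi.sub_apply, Pi.smul_apply, ← rop_swap hq hl h, cup_swap hl h]

theorem wt_mul_cup (hq : 0 < q) (i a b : Fin m) (x : ℝ) :
    wt q i a * wt q i b * cup q m x a b = cup q m x a b := by
  rw [cup_apply]
  split_ifs with h
  · rw [h, wt_rev_mul hq, one_mul]
  · rw [mul_zero]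

theorem root_cup (i l a b c : Fin m) (v : Fin m → ℝ) :
    root q i l (fun c => cup q m (v c) a b) c = cup q m (root q i l v c) a b := by
  simp only [root, cup_apply, smul_eq_mul]
  split_ifs <;> ring

/-- The braiding of a vector past the metric. -/
theorem rop_cup_vec_real (hq : 0 < q) (v : Fin m → ℝ) :
    on12 m (rop q m) (on23 m (rop q m) fun a b c => cup q m (v c) a b)
      = fun a => cup q m (v a) := by
  rw [← sub_eq_zero]
  refine descent_three hq (fun v : Fin m → ℝ => on12 m (rop q m) (on23 m (rop q m)
    fun a b c => cup q m (v c) a b) - fun a => cup q m (v a)) ?_ ?_ ?_ v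
  · intro v a b c ha
    rw [Pi.sub_apply, Pi.sub_apply, Pi.sub_apply, on12_apply, rop_last hq _ ha, on23_apply,
      rop_last hq _ ha, ← mul_assoc, wt_mul_cup hq, sub_self]
  · intro v i l hl h
    refine ⟨root q i l v, ?_⟩
    have e1 : root3 q i l (fun a b c => cup q m (v c) a b)
        = fun a b c => cup q m (root q i l v c) a b := by
      ext a b c
      have := congrFun (congrFun (root2_cup hq hl h (v c)) a) b
      rw [← wt_mul_cup hq i a b (root q i l v c), ← root_cup]
      simp only [root3, root2, Pi.zero_apply] at *
      linear_combination wt q l c * this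
    have e2 : root3 q i l (fun a => cup q m (v a)) = fun a => cup q m (root q i l v a) := by
      ext a b c
      have := congrFun (congrFun (root2_cup hq hl h (v a)) b) c
      rw [← wt_mul_cup hq l b c (root q i l v a), ← root_cup]
      simp only [root3, root2, Pi.zero_apply] at *
      linear_combination wt q i a * this
    simp only [← e1, ← e2, on12_rop_root3 hq hl h, on23_rop_root3 hq hl h]
    ext a b c
    simp only [root3, root, Pi.sub_apply]
    split_ifs <;> ring
  · intro v i l hl h
    refine ⟨fun a => v (Equiv.swap i l a), ?_⟩
    ext a b c
    simp only [Pi.sub_apply, cup_swap hl h, on12_apply, ← rop_swap hq hl h, on23_apply]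

end Invariance

/-! ### Tensors with entries in a module -/

section Transfer
variable {q : ℝ} {m : ℕ} {M N : Type*} [AddCommGroup M] [Module ℝ M] [AddCommGroup N] [Module ℝ N]

/-- Elements of a real vector space are separated by linear functionals, which reduces identities
between natural operators on tensors with entries in a module to the case of real entries. -/
theorem eq_of_forall_dual {x y : M} (h : ∀ φ : M →ₗ[ℝ] ℝ, φ x = φ y) : x = y := by
  rw [← sub_eq_zero, ← Module.forall_dual_apply_eq_zero_iff ℝ]
  intro φ
  rw [map_sub, h, sub_self]

theorem map_rop (φ : M →ₗ[ℝ] N) (f : Fin m → Fin m → M) (a b : Fin m) :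
    φ (rop q m f a b) = rop q m (fun a b => φ (f a b)) a b := by
  simp [rop]

theorem map_cap (φ : M →ₗ[ℝ] N) (f : Fin m → Fin m → M) :
    φ (cap q m f) = cap q m (fun a b => φ (f a b)) := by
  simp [cap]

theorem map_cup (φ : M →ₗ[ℝ] N) (x : M) (a b : Fin m) :
    φ (cup q m x a b) = cup q m (φ x) a b := by
  simp [cup]

theorem map_rinv (φ : M →ₗ[ℝ] N) (f : Fin m → Fin m → M) (a b : Fin m) :
    φ (rinv q m f a b) = rinv q m (fun a b => φ (f a b)) a b := by
  change φ (rop q m f a b - (q - q⁻¹) • (f a b - cup q m (cap q m f) a b))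
    = rop q m _ a b - (q - q⁻¹) • (φ (f a b) - cup q m (cap q m _) a b)
  rw [map_sub, map_smul, map_sub, map_rop, map_cup, map_cap]

theorem map_on12_rop (φ : M →ₗ[ℝ] N) (f : Fin m → Fin m → Fin m → M) (a b c : Fin m) :
    φ (on12 m (rop q m) f a b c) = on12 m (rop q m) (fun a b c => φ (f a b c)) a b c := by
  simp only [on12_apply, map_rop]

theorem map_on23_rop (φ : M →ₗ[ℝ] N) (f : Fin m → Fin m → Fin m → M) (a b c : Fin m) :
    φ (on23 m (rop q m) f a b c) = on23 m (rop q m) (fun a b c => φ (f a b c)) a b c := by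
  simp only [on23_apply, map_rop]

theorem braid_symm (p r : Fin m × Fin m) : braid q m p r = braid q m r p := by
  obtain ⟨a, b⟩ := p
  obtain ⟨c, d⟩ := r
  have h1 : (a = d ∧ b = c) ↔ (c = b ∧ d = a) := by
    constructor <;> rintro ⟨rfl, rfl⟩ <;> exact ⟨rfl, rfl⟩
  simp only [braid, Prod.mk.injEq]
  congr 1
  · by_cases h : a = d ∧ b = c
    · obtain ⟨rfl, rfl⟩ := h
      simp only [and_self, if_true]
      have : a = b.rev ↔ b = a.rev := by rw [eq_comm, Fin.rev_eq_iff]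
      simp [this, eq_comm (a := a) (b := b)]
    · rw [if_neg h, if_neg (h1.not.1 h)]
  · congr 2
    · refine if_congr ?_ rfl rfl
      constructor <;> rintro ⟨h, rfl, rfl⟩ <;> exact ⟨h, rfl, rfl⟩
    · have : (a < d ∧ a = b.rev ∧ c = d.rev) ↔ (c < b ∧ c = d.rev ∧ a = b.rev) := by
        constructor
        · rintro ⟨h, rfl, rfl⟩
          exact ⟨by rwa [← Fin.rev_lt_rev, Fin.rev_rev], rfl, rfl⟩
        · rintro ⟨h, rfl, rfl⟩
          exact ⟨by rwa [← Fin.rev_lt_rev, Fin.rev_rev], rfl, rfl⟩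
      by_cases h : a < d ∧ a = b.rev ∧ c = d.rev
      · rw [if_pos h, if_pos (this.1 h)]
        obtain ⟨-, rfl, rfl⟩ := h
        rw [rho_rev, rho_rev]; congr 1; ring
      · rw [if_neg h, if_neg (this.not.1 h)]

/-- The braid matrix is symmetric. -/
theorem sum_rop_mul (f g : Fin m → Fin m → ℝ) :
    ∑ a, ∑ b, rop q m f a b * g a b = ∑ a, ∑ b, f a b * rop q m g a b := by
  have h (f g : Fin m → Fin m → ℝ) : ∑ a, ∑ b, rop q m f a b * g a b =
      ∑ p : Fin m × Fin m, ∑ r : Fin m × Fin m, braid q m p r * f r.1 r.2 * g p.1 p.2 := by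
    rw [Fintype.sum_prod_type]
    simp only [rop, LinearMap.coe_mk, AddHom.coe_mk, smul_eq_mul, Finset.sum_mul]
  have h' : ∑ a, ∑ b, f a b * rop q m g a b = ∑ a, ∑ b, rop q m g a b * f a b := by
    simp only [mul_comm]
  rw [h', h, h, Finset.sum_comm]
  refine Finset.sum_congr rfl fun p _ => Finset.sum_congr rfl fun r _ => ?_
  rw [braid_symm]; ring

theorem cap_mul (f : Fin m → Fin m → ℝ) (x : ℝ) :
    x * cap q m f = ∑ a, ∑ b, f a b * cup q m x a b := by
  simp only [cap, cup, LinearMap.coe_mk, AddHom.coe_mk, smul_eq_mul, Fintype.sum_prod_type,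
    Finset.mul_sum]
  refine Finset.sum_congr rfl fun p _ => Finset.sum_congr rfl fun r _ => ?_
  ring

theorem rop_cup (hq : 0 < q) (x : M) :
    rop q m (cup q m x) = q ^ (1 - (m : ℤ)) • cup q m x := by
  ext a b
  refine eq_of_forall_dual fun φ => ?_
  rw [map_rop]
  simp only [map_cup, rop_cup_real hq, Pi.smul_apply, map_smul]

theorem cap_rop (hq : 0 < q) (f : Fin m → Fin m → M) :
    cap q m (rop q m f) = q ^ (1 - (m : ℤ)) • cap q m f := by
  refine eq_of_forall_dual fun φ => ?_
  rw [map_cap, map_smul, map_cap]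
  simp only [map_rop]
  have h1 := cap_mul (q := q) (fun a b => rop q m (fun a b => φ (f a b)) a b) 1
  have h2 := cap_mul (q := q) (fun a b => φ (f a b)) 1
  rw [sum_rop_mul, rop_cup_real hq] at h1
  simp only [one_mul, Pi.smul_apply, smul_eq_mul] at *
  rw [h1, h2, Finset.mul_sum]
  refine Finset.sum_congr rfl fun a _ => ?_
  rw [Finset.mul_sum]
  exact Finset.sum_congr rfl fun b _ => by ring

theorem rinv_apply' (f : Fin m → Fin m → M) :
    rinv q m f = rop q m f - (q - q⁻¹) • (f - cup q m (cap q m f)) := rfl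

theorem rop_rinv (hq : 0 < q) (f : Fin m → Fin m → M) : rop q m (rinv q m f) = f := by
  ext a b
  refine eq_of_forall_dual fun φ => ?_
  rw [map_rop]
  simp only [map_rinv, rop_rinv_real hq]

theorem rinv_rop (hq : 0 < q) (f : Fin m → Fin m → M) : rinv q m (rop q m f) = f := by
  conv_rhs => rw [← rop_rinv hq f]
  rw [rinv_apply', rinv_apply', map_sub, map_smul, map_sub, rop_cup hq, cap_rop hq, map_smul]

theorem rinv_cup (hq : 0 < q) (x : M) :
    rinv q m (cup q m x) = q ^ ((m : ℤ) - 1) • cup q m x := by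
  have := rinv_rop hq (cup q m x)
  rw [rop_cup hq, map_smul] at this
  rw [← this, smul_smul, ← zpow_add₀ hq.ne', this]
  simp

theorem cap_rinv (hq : 0 < q) (f : Fin m → Fin m → M) :
    cap q m (rinv q m f) = q ^ ((m : ℤ) - 1) • cap q m f := by
  have := cap_rop hq (rinv q m f)
  rw [rop_rinv hq] at this
  rw [this, smul_smul, ← zpow_add₀ hq.ne']
  simp

/-- The quantum dimension `C_{ij} C^{ij}`. -/
theorem cap_cup (hq : 0 < q) (hm : 1 ≤ m) (x : M) :
    (q - q⁻¹) • cap q m (cup q m x)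
      = (q - q⁻¹ + q ^ ((m : ℤ) - 1) - q ^ (1 - (m : ℤ))) • x := by
  have h1 := congrFun (congrFun (rinv_apply' (q := q) (cup q m x)) ⟨0, hm⟩) (Fin.rev ⟨0, hm⟩)
  rw [rinv_cup hq, rop_cup hq] at h1
  simp only [Pi.sub_apply, Pi.smul_apply, cup_apply, if_pos] at h1
  have hc : q ^ (-rho m ⟨0, hm⟩) ≠ 0 := (Real.rpow_pos_of_pos hq _).ne'
  generalize q ^ (-rho m ⟨0, hm⟩) = c at hc h1
  refine smul_right_injective M hc ?_
  simp only [sub_smul, add_smul, smul_sub, smul_add, smul_comm c _ _] at h1 ⊢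
  rw [h1]; abel

/-- The matrix `R̂ - (q - q⁻¹) (1 - K)`. -/
noncomputable def braidInv (q : ℝ) (m : ℕ) : Matrix (Fin m × Fin m) (Fin m × Fin m) ℝ := fun p r =>
  braid q m p r - (q - q⁻¹) * ((if p = r then 1 else 0) - metric q m p.1 p.2 * metric q m r.1 r.2)

theorem rinv_eq_sum_braidInv (f : Fin m → Fin m → M) (a b : Fin m) :
    rinv q m f a b = ∑ p : Fin m × Fin m, braidInv q m (a, b) p • f p.1 p.2 := by
  simp only [rinv_apply', Pi.sub_apply, Pi.smul_apply, braidInv, sub_smul, mul_smul, ite_smul,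
    one_smul, zero_smul, Finset.sum_sub_distrib, ← Finset.smul_sum, smul_sub]
  simp [rop, cup, cap, Finset.smul_sum, smul_comm (metric q m a b)]

/-- The action of the inverse of the braid matrix. -/
theorem rinv_eq_sum (hq : 0 < q) (f : Fin m → Fin m → M) (a b : Fin m) :
    rinv q m f a b = ∑ p : Fin m × Fin m, (braid q m)⁻¹ (a, b) p • f p.1 p.2 := by
  have : (braid q m)⁻¹ = braidInv q m := by
    refine Matrix.inv_eq_right_inv ?_
    ext p r
    have h := congrFun (congrFun (rop_rinv hq fun a b => if (a, b) = r then (1 : ℝ) else 0) p.1) p.2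
    simp only [rop, LinearMap.coe_mk, AddHom.coe_mk] at h
    simp only [rinv_eq_sum_braidInv] at h
    simpa [Matrix.mul_apply, Matrix.one_apply] using h
  rw [this, rinv_eq_sum_braidInv]

theorem cap_cup_left (hq : 0 < q) (v : Fin m → M) (c : Fin m) :
    cap q m (fun a b => cup q m (v a) b c) = v c := by
  rw [cap_apply]
  simp only [cup_apply, Fin.rev_rev]
  rw [Finset.sum_eq_single c]
  · rw [if_pos rfl, smul_smul, ← Real.rpow_add hq, rho_rev]; simp
  · intro b _ hb; rw [if_neg hb.symm, smul_zero]
  · simp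

theorem cap_cup_right (hq : 0 < q) (v : Fin m → M) (a : Fin m) :
    cap q m (fun b c => cup q m (v c) a b) = v a := by
  rw [cap_apply]
  simp only [cup_apply]
  rw [Finset.sum_eq_single a.rev]
  · rw [if_pos rfl, smul_smul, ← Real.rpow_add hq, rho_rev]; simp
  · intro b _ hb; rw [if_neg hb, smul_zero]
  · simp

theorem rop_cup_vec (hq : 0 < q) (v : Fin m → M) :
    on12 m (rop q m) (on23 m (rop q m) fun a b c => cup q m (v c) a b)
      = fun a => cup q m (v a) := by
  ext a b c
  refine eq_of_forall_dual fun φ => ?_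
  have := congrFun (congrFun (congrFun (rop_cup_vec_real hq fun a => φ (v a)) a) b) c
  simpa only [map_on12_rop, map_on23_rop, map_cup] using this

/-- The braid relation (Yang-Baxter equation). -/
theorem braid_relation (hq : 0 < q) (f : Fin m → Fin m → Fin m → M) :
    on12 m (rop q m) (on23 m (rop q m) (on12 m (rop q m) f))
      = on23 m (rop q m) (on12 m (rop q m) (on23 m (rop q m) f)) := by
  ext a b c
  refine eq_of_forall_dual fun φ => ?_
  have := congrFun (congrFun (congrFun (braid_relation_real hq fun a b c => φ (f a b c)) a) b) c
  simpa only [map_on12_rop, map_on23_rop] using this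

/-- The braid matrix is invariant under the reversal of both indices together with their order. With
three indices this symmetry turns an operator on the first two into one on the last two. -/
theorem rop_flip (f : Fin m → Fin m → M) (a b : Fin m) :
    rop q m (fun a b => f b.rev a.rev) a b = rop q m f b.rev a.rev := by
  simp only [rop, LinearMap.coe_mk, AddHom.coe_mk]
  let e : Fin m × Fin m ≃ Fin m × Fin m :=
    (Equiv.prodComm _ _).trans (Equiv.prodCongr Fin.revPerm Fin.revPerm)
  refine Fintype.sum_equiv e _ _ fun ⟨c, d⟩ => ?_
  congr 1
  change braid q m (a, b) (c, d) = braid q m (b.rev, a.rev) (d.rev, c.rev)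
  simp only [braid, Prod.mk.injEq, Fin.rev_inj, Fin.rev_rev, Fin.rev_lt_rev]
  congr 1
  · refine if_congr and_comm ?_ rfl
    have h1 : b = a ↔ a = b := eq_comm
    have h2 : b.rev = a ↔ a = b.rev := eq_comm
    simp only [h1, h2]
  · congr 2
    · refine if_congr (and_congr_right fun _ => and_comm) rfl rfl
    · have h : (a < d ∧ a = b.rev ∧ c = d.rev) ↔ (c < b ∧ b.rev = a ∧ d.rev = c) := by
        constructor
        · rintro ⟨h, rfl, rfl⟩; exact ⟨by rw [← Fin.rev_lt_rev]; simpa using h, by simp⟩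
        · rintro ⟨h, rfl, rfl⟩; exact ⟨by rw [← Fin.rev_lt_rev]; simpa using h, by simp⟩
      by_cases h' : a < d ∧ a = b.rev ∧ c = d.rev
      · rw [if_pos h', if_pos (h.1 h')]
        obtain ⟨-, rfl, rfl⟩ := h'
        simp
      · rw [if_neg h', if_neg (h.not.1 h')]

theorem cup_flip (x : M) (a b : Fin m) : cup q m x b.rev a.rev = cup q m x a b := by
  simp only [cup_apply, Fin.rev_rev, rho_rev]
  by_cases h : b = a.rev
  · subst h; simp [rho_rev]
  · rw [if_neg h, if_neg]
    rintro rfl; simp at h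

theorem on12_rop_flip (f : Fin m → Fin m → Fin m → M) :
    on12 m (rop q m) (fun a b c => f c.rev b.rev a.rev)
      = fun a b c => on23 m (rop q m) f c.rev b.rev a.rev := by
  ext a b c
  exact rop_flip (f c.rev) a b

theorem on23_rop_flip (f : Fin m → Fin m → Fin m → M) :
    on23 m (rop q m) (fun a b c => f c.rev b.rev a.rev)
      = fun a b c => on12 m (rop q m) f c.rev b.rev a.rev := by
  ext a b c
  exact rop_flip (fun b c => f b c a.rev) b c

theorem rop_cup_vec' (hq : 0 < q) (v : Fin m → M) :
    on23 m (rop q m) (on12 m (rop q m) fun a => cup q m (v a))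
      = fun a b c => cup q m (v c) a b := by
  have h := rop_cup_vec hq fun a => v a.rev
  have h' : (fun a => cup q m (v a))
      = fun a b c => (fun a b c => cup q m (v c.rev) a b) c.rev b.rev a.rev := by
    ext a b c
    simp only [Fin.rev_rev]
    exact (cup_flip _ _ _).symm
  rw [h', on12_rop_flip fun a b c => cup q m (v c.rev) a b,
    on23_rop_flip (on23 m (rop q m) fun a b c => cup q m (v c.rev) a b), h]
  ext a b c
  simp only [Fin.rev_rev]
  exact cup_flip _ _ _

theorem rinv_cup_vec (hq : 0 < q) (v : Fin m → M) :
    on12 m (rinv q m) (fun a => cup q m (v a))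
      = on23 m (rop q m) (fun a b c => cup q m (v c) a b) := by
  rw [← rop_cup_vec hq]
  ext a b c
  simp only [on12_apply, rinv_rop hq]

theorem rinv_cup_vec' (hq : 0 < q) (v : Fin m → M) :
    on23 m (rinv q m) (fun a b c => cup q m (v c) a b)
      = on12 m (rop q m) (fun a => cup q m (v a)) := by
  rw [← rop_cup_vec' hq]
  ext a b c
  simp only [on23_apply, rinv_rop hq]

theorem sum_on12_rop_mul (f g : Fin m → Fin m → Fin m → ℝ) :
    ∑ a, ∑ b, ∑ c, on12 m (rop q m) f a b c * g a b c
      = ∑ a, ∑ b, ∑ c, f a b c * on12 m (rop q m) g a b c := by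
  have h (F : Fin m → Fin m → Fin m → ℝ) :
      ∑ a, ∑ b, ∑ c, F a b c = ∑ c, ∑ a, ∑ b, F a b c := by
    calc _ = ∑ a, ∑ c, ∑ b, F a b c := Finset.sum_congr rfl fun a _ => Finset.sum_comm
      _ = _ := Finset.sum_comm
  rw [h, h fun a b c => f a b c * _]
  exact Finset.sum_congr rfl fun c _ => sum_rop_mul (fun a b => f a b c) (fun a b => g a b c)

theorem sum_on23_rop_mul (f g : Fin m → Fin m → Fin m → ℝ) :
    ∑ a, ∑ b, ∑ c, on23 m (rop q m) f a b c * g a b c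
      = ∑ a, ∑ b, ∑ c, f a b c * on23 m (rop q m) g a b c :=
  Finset.sum_congr rfl fun a _ => sum_rop_mul (f a) (g a)

theorem sum_mul_cap_left (F : Fin m → Fin m → Fin m → ℝ) (w : Fin m → ℝ) :
    ∑ c, w c * cap q m (fun a b => F a b c)
      = ∑ a, ∑ b, ∑ c, F a b c * cup q m (w c) a b := by
  simp only [cap_mul]
  rw [Finset.sum_comm]
  exact Finset.sum_congr rfl fun a _ => Finset.sum_comm

theorem sum_mul_cap_right (F : Fin m → Fin m → Fin m → ℝ) (w : Fin m → ℝ) :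
    ∑ a, w a * cap q m (F a) = ∑ a, ∑ b, ∑ c, F a b c * cup q m (w a) b c := by
  simp only [cap_mul]

theorem eq_of_sum_mul_eq {v w : Fin m → ℝ} (h : ∀ u : Fin m → ℝ, ∑ a, u a * v a = ∑ a, u a * w a)
    (a : Fin m) : v a = w a := by
  have := h (Pi.single a 1)
  simpa [Pi.single_apply] using this

/-- The contraction with the metric is braided past a vector. This is the transpose of
`rop_cup_vec`. -/
theorem cap_left_rop_rop (hq : 0 < q) (f : Fin m → Fin m → Fin m → M) (c : Fin m) :
    cap q m (fun a b => on23 m (rop q m) (on12 m (rop q m) f) a b c) = cap q m (f c) := by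
  refine eq_of_forall_dual fun φ => ?_
  simp only [map_cap, map_on12_rop, map_on23_rop]
  refine eq_of_sum_mul_eq (v := fun c => cap q m fun a b =>
    on23 m (rop q m) (on12 m (rop q m) fun a b c => φ (f a b c)) a b c)
    (w := fun c => cap q m fun a b => φ (f c a b)) (fun u => ?_) c
  rw [sum_mul_cap_left, sum_on23_rop_mul, sum_on12_rop_mul, rop_cup_vec hq,
    ← sum_mul_cap_right]

theorem cap_right_rop_rop (hq : 0 < q) (f : Fin m → Fin m → Fin m → M) (a : Fin m) :
    cap q m (on12 m (rop q m) (on23 m (rop q m) f) a) = cap q m (fun b c => f b c a) := by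
  refine eq_of_forall_dual fun φ => ?_
  simp only [map_cap, map_on12_rop, map_on23_rop]
  refine eq_of_sum_mul_eq (v := fun a => cap q m
    (on12 m (rop q m) (on23 m (rop q m) fun a b c => φ (f a b c)) a))
    (w := fun a => cap q m fun b c => φ (f b c a)) (fun u => ?_) a
  rw [sum_mul_cap_right, sum_on12_rop_mul, sum_on23_rop_mul, rop_cup_vec' hq,
    ← sum_mul_cap_left]

end Transfer

/-! ### Contractions of three-index tensors -/

section Three
variable (q : ℝ) (m : ℕ) {M : Type*} [AddCommGroup M] [Module ℝ M]

/-- The contraction of the first two of three indices. -/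
noncomputable def capL : (Fin m → Fin m → Fin m → M) →ₗ[ℝ] (Fin m → M) where
  toFun f c := cap q m fun a b => f a b c
  map_add' f g := by
    ext c; exact map_add (cap q m) (fun a b => f a b c) (fun a b => g a b c)
  map_smul' r f := by
    ext c; exact map_smul (cap q m) r (fun a b => f a b c)

/-- The contraction of the last two of three indices. -/
noncomputable def capR : (Fin m → Fin m → Fin m → M) →ₗ[ℝ] (Fin m → M) where
  toFun f a := cap q m (f a)
  map_add' f g := by ext a; exact map_add (cap q m) (f a) (g a)
  map_smul' r f := by ext a; exact map_smul (cap q m) r (f a)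

/-- The metric in the first two indices times a vector. -/
noncomputable def cupL : (Fin m → M) →ₗ[ℝ] (Fin m → Fin m → Fin m → M) where
  toFun v a b c := cup q m (v c) a b
  map_add' v w := by
    ext a b c; exact congrFun (congrFun (map_add (cup q m) (v c) (w c)) a) b
  map_smul' r v := by
    ext a b c; exact congrFun (congrFun (map_smul (cup q m) r (v c)) a) b

/-- A vector times the metric in the last two indices. -/
noncomputable def cupR : (Fin m → M) →ₗ[ℝ] (Fin m → Fin m → Fin m → M) where
  toFun v a := cup q m (v a)
  map_add' v w := by ext a b c; exact congrFun (congrFun (map_add (cup q m) (v a) (w a)) b) c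
  map_smul' r v := by ext a b c; exact congrFun (congrFun (map_smul (cup q m) r (v a)) b) c

variable {q m}

theorem capL_cupR (hq : 0 < q) (v : Fin m → M) : capL q m (cupR q m v) = v :=
  funext fun c => cap_cup_left hq v c

theorem capR_cupL (hq : 0 < q) (v : Fin m → M) : capR q m (cupL q m v) = v :=
  funext fun c => cap_cup_right hq v c

theorem on12_rop_rinv (hq : 0 < q) (f : Fin m → Fin m → Fin m → M) :
    on12 m (rop q m) (on12 m (rinv q m) f) = f := by
  ext a b c; simp only [on12_apply, rop_rinv hq]

theorem on12_rinv_rop (hq : 0 < q) (f : Fin m → Fin m → Fin m → M) :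
    on12 m (rinv q m) (on12 m (rop q m) f) = f := by
  ext a b c; simp only [on12_apply, rinv_rop hq]

theorem on23_rop_rinv (hq : 0 < q) (f : Fin m → Fin m → Fin m → M) :
    on23 m (rop q m) (on23 m (rinv q m) f) = f := by
  ext a b c; simp only [on23_apply, rop_rinv hq]

theorem on23_rinv_rop (hq : 0 < q) (f : Fin m → Fin m → Fin m → M) :
    on23 m (rinv q m) (on23 m (rop q m) f) = f := by
  ext a b c; simp only [on23_apply, rinv_rop hq]

theorem rinv_cupR (hq : 0 < q) (v : Fin m → M) :
    on12 m (rinv q m) (cupR q m v) = on23 m (rop q m) (cupL q m v) := rinv_cup_vec hq v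

theorem rinv_cupL (hq : 0 < q) (v : Fin m → M) :
    on23 m (rinv q m) (cupL q m v) = on12 m (rop q m) (cupR q m v) := rinv_cup_vec' hq v

theorem capL_rop_rop (hq : 0 < q) (f : Fin m → Fin m → Fin m → M) :
    capL q m (on23 m (rop q m) (on12 m (rop q m) f)) = capR q m f :=
  funext fun c => cap_left_rop_rop hq f c

theorem capR_rop_rop (hq : 0 < q) (f : Fin m → Fin m → Fin m → M) :
    capR q m (on12 m (rop q m) (on23 m (rop q m) f)) = capL q m f :=
  funext fun c => cap_right_rop_rop hq f c

theorem capR_rinv_rinv (hq : 0 < q) (f : Fin m → Fin m → Fin m → M) :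
    capR q m (on12 m (rinv q m) (on23 m (rinv q m) f)) = capL q m f := by
  rw [← capL_rop_rop hq, on12_rop_rinv hq, on23_rop_rinv hq]

theorem capL_rinv_rinv (hq : 0 < q) (f : Fin m → Fin m → Fin m → M) :
    capL q m (on23 m (rinv q m) (on12 m (rinv q m) f)) = capR q m f := by
  rw [← capR_rop_rop hq, on23_rop_rinv hq, on12_rop_rinv hq]

theorem capL_rinv (hq : 0 < q) (f : Fin m → Fin m → Fin m → M) :
    capL q m (on23 m (rinv q m) f) = capR q m (on12 m (rop q m) f) := by
  rw [← capR_rop_rop hq, on23_rop_rinv hq]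

theorem capL_on12_rinv (hq : 0 < q) (f : Fin m → Fin m → Fin m → M) :
    capL q m (on12 m (rinv q m) f) = q ^ ((m : ℤ) - 1) • capL q m f :=
  funext fun c => cap_rinv hq fun a b => f a b c

theorem capL_on12_rop (hq : 0 < q) (f : Fin m → Fin m → Fin m → M) :
    capL q m (on12 m (rop q m) f) = q ^ (1 - (m : ℤ)) • capL q m f :=
  funext fun c => cap_rop hq fun a b => f a b c

theorem capR_on23_rop (hq : 0 < q) (f : Fin m → Fin m → Fin m → M) :
    capR q m (on23 m (rop q m) f) = q ^ (1 - (m : ℤ)) • capR q m f :=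
  funext fun c => cap_rop hq (f c)

theorem rop_rinv_rinv (hq : 0 < q) (f : Fin m → Fin m → Fin m → M) :
    on23 m (rop q m) (on12 m (rinv q m) (on23 m (rinv q m) f))
      = on12 m (rinv q m) (on23 m (rinv q m) (on12 m (rop q m) f)) := by
  have := braid_relation hq (on12 m (rinv q m) (on23 m (rinv q m) f))
  rw [on12_rop_rinv hq, on23_rop_rinv hq] at this
  have h2 := congrArg (fun g => on12 m (rinv q m) (on23 m (rinv q m) g)) (braid_relation hq
    (on12 m (rinv q m) (on23 m (rinv q m) f)))
  simp only [on12_rop_rinv hq, on23_rop_rinv hq, on23_rinv_rop hq, on12_rinv_rop hq] at h2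
  exact h2.symm

theorem rop_rinv_rinv' (hq : 0 < q) (f : Fin m → Fin m → Fin m → M) :
    on12 m (rop q m) (on23 m (rinv q m) (on12 m (rinv q m) f))
      = on23 m (rinv q m) (on12 m (rinv q m) (on23 m (rop q m) f)) := by
  have h2 := congrArg (fun g => on23 m (rinv q m) (on12 m (rinv q m) g)) (braid_relation hq
    (on23 m (rinv q m) (on12 m (rinv q m) f)))
  simp only [on12_rop_rinv hq, on23_rop_rinv hq, on23_rinv_rop hq, on12_rinv_rop hq] at h2
  exact h2

end Three

/-! ### The projection on the antisymmetric tensors -/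

section Antisymmetrizer
variable (q : ℝ) (m : ℕ) {M : Type*} [AddCommGroup M] [Module ℝ M]

/-- The multiple `(R̂ - q) (R̂ - q ^ (1 - m))` of the projection `P_A`. -/
noncomputable def asym : (Fin m → Fin m → M) →ₗ[ℝ] (Fin m → Fin m → M) :=
  rop q m ∘ₗ rop q m - (q + q ^ (1 - (m : ℤ))) • rop q m + (q * q ^ (1 - (m : ℤ))) • LinearMap.id

/-- The constant `(q - q⁻¹) q ^ (2 - m) / μ` in the relations of the coordinates. -/
noncomputable def kappa : ℝ := (q - q⁻¹) * q ^ (2 - (m : ℤ)) / mu q m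

variable {q m}

theorem mu_pos (hq : 0 < q) : 0 < mu q m := by unfold mu; positivity

theorem asym_apply (f : Fin m → Fin m → M) : asym q m f =
    rop q m (rop q m f) - (q + q ^ (1 - (m : ℤ))) • rop q m f + (q * q ^ (1 - (m : ℤ))) • f := rfl

theorem rop_rop (hq : 0 < q) (f : Fin m → Fin m → M) : rop q m (rop q m f) =
    f + (q - q⁻¹) • (rop q m f - q ^ (1 - (m : ℤ)) • cup q m (cap q m f)) := by
  have h := rop_rinv hq f
  rw [rinv_apply', map_sub, map_smul, map_sub, rop_cup hq] at h
  rw [← sub_eq_iff_eq_add]; exact h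

theorem mul_zpow_two_sub (hq : 0 < q) : q ^ (2 - (m : ℤ)) = q * q ^ (1 - (m : ℤ)) := by
  rw [← zpow_one_add₀ hq.ne']; congr 1; ring

theorem kappa_mul_mu (hq : 0 < q) :
    kappa q m * mu q m = (q - q⁻¹) * q * q ^ (1 - (m : ℤ)) := by
  have hmu := (mu_pos (m := m) hq).ne'
  rw [kappa, mul_zpow_two_sub hq]; field_simp

/-- The antisymmetrizer in terms of the braid matrix and the metric, without the square of `R̂`. -/
theorem asym_eq (hq : 0 < q) (f : Fin m → Fin m → M) : asym q m f =
    (q⁻¹ * mu q m) • (q • f - kappa q m • cup q m (cap q m f) - rop q m f) := by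
  have hmu := (mu_pos (m := m) hq).ne'
  rw [asym_apply, rop_rop hq]
  simp only [smul_sub, smul_smul]
  have h1 : q⁻¹ * mu q m * q = mu q m := by field_simp
  have h2 : q⁻¹ * mu q m * kappa q m = (q - q⁻¹) * q ^ (1 - (m : ℤ)) := by
    unfold kappa; rw [mul_zpow_two_sub hq]; field_simp
  have h3 : q⁻¹ * mu q m = q⁻¹ + q ^ (1 - (m : ℤ)) := by
    unfold mu; rw [mul_zpow_two_sub hq]; field_simp
  rw [h1, h2, h3, mu, mul_zpow_two_sub hq]
  module

/-- `P_A` vanishes on the image of `1 + q R̂`. -/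
theorem asym_add_rop (hq : 0 < q) (f : Fin m → Fin m → M) :
    asym q m (f + q • rop q m f) = 0 := by
  have hmu := (mu_pos (m := m) hq).ne'
  have hk : kappa q m + kappa q m * q ^ (2 - (m : ℤ)) = (q - q⁻¹) * q * q ^ (1 - (m : ℤ)) := by
    rw [← kappa_mul_mu hq, mu]; ring
  rw [asym_eq hq, map_add, map_smul, map_add, map_smul, map_add, map_smul, cap_rop hq, rop_rop hq]
  refine smul_eq_zero_of_right _ ?_
  simp only [map_smul, smul_sub, smul_add, smul_smul]
  rw [mul_zpow_two_sub hq] at hk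
  have h1 : q * (q - q⁻¹) = q * q - 1 := by field_simp
  rw [h1, show q * ((q - q⁻¹) * q ^ (1 - (m : ℤ))) = kappa q m + kappa q m * (q * q ^ (1 - (m : ℤ)))
    by rw [hk]; ring]
  module

/-- The matrix `P_A` acts as a multiple of `asym`. -/
theorem sum_projA_smul (f : Fin m → Fin m → M) (a : Fin m × Fin m) :
    ∑ b : Fin m × Fin m, projA q m a b • f b.1 b.2
      = ((-q⁻¹ - q) * (-q⁻¹ - q ^ (1 - (m : ℤ))))⁻¹ • asym q m f a.1 a.2 := by
  have key (A B : Matrix (Fin m × Fin m) (Fin m × Fin m) ℝ) (g : Fin m × Fin m → M) :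
      ∑ b, (A * B) a b • g b = ∑ c, A a c • ∑ b, B c b • g b := by
    simp only [Matrix.mul_apply, Finset.sum_smul, Finset.smul_sum, smul_smul]
    exact Finset.sum_comm
  simp only [projA, Matrix.smul_apply, smul_assoc, ← Finset.smul_sum]
  rw [key]
  congr 1
  have h (r : ℝ) (g : Fin m × Fin m → M) (c : Fin m × Fin m) :
      ∑ b, (braid q m - r • (1 : Matrix (Fin m × Fin m) (Fin m × Fin m) ℝ)) c b • g b
        = ∑ b, braid q m c b • g b - r • g c := by
    simp [sub_smul, Matrix.one_apply, Finset.sum_sub_distrib]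
  simp only [h, asym_apply, Pi.sub_apply, Pi.add_apply, Pi.smul_apply]
  change _ = rop q m (rop q m f) a.1 a.2 - (q + q ^ (1 - (m : ℤ))) • rop q m f a.1 a.2
    + (q * q ^ (1 - (m : ℤ))) • f a.1 a.2
  have hr (g : Fin m → Fin m → M) (c : Fin m × Fin m) :
      ∑ b, braid q m c b • g b.1 b.2 = rop q m g c.1 c.2 := rfl
  have h1 := hr (fun c d => rop q m f c d - q ^ (1 - (m : ℤ)) • f c d) a
  have h2 : rop q m (fun c d => rop q m f c d - q ^ (1 - (m : ℤ)) • f c d)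
      = rop q m (rop q m f) - q ^ (1 - (m : ℤ)) • rop q m f := by
    rw [← map_smul, ← map_sub]; rfl
  rw [h2] at h1
  simp only [hr]
  rw [h1]
  simp only [Pi.sub_apply, Pi.smul_apply]
  module

theorem projA_const_ne_zero (hq : 0 < q) :
    ((-q⁻¹ - q) * (-q⁻¹ - q ^ (1 - (m : ℤ))))⁻¹ ≠ 0 := by
  have h1 : 0 < q⁻¹ + q := by positivity
  have h2 : 0 < q⁻¹ + q ^ (1 - (m : ℤ)) := by positivity
  rw [show (-q⁻¹ - q) * (-q⁻¹ - q ^ (1 - (m : ℤ))) = (q⁻¹ + q) * (q⁻¹ + q ^ (1 - (m : ℤ))) by ring]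
  positivity

end Antisymmetrizer

/-! ### Relations between coordinates and partial derivatives -/

section Weyl
variable {q : ℝ} {m : ℕ} {A : Type*} [Ring A] [Module ℝ A]
  [IsScalarTower ℝ A A] [SMulCommClass ℝ A A]

/-- The products of the components of two vectors. -/
def ten2 (X Y : Fin m → A) : Fin m → Fin m → A := fun a b => X a * Y b

/-- The products of the components of three vectors. -/
def ten3 (X Y Z : Fin m → A) : Fin m → Fin m → Fin m → A := fun a b c => X a * Y b * Z c

/-- The relations of the coordinates of `ℝ^m_q`. -/
def IsVector (q : ℝ) (X : Fin m → A) : Prop := asym q m (ten2 X X) = 0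

/-- The square `C_{ab} X^a X^b` of a vector, or the contraction of two vectors. -/
noncomputable def dot (q : ℝ) (X Y : Fin m → A) : A := cap q m (ten2 X Y)

theorem dot_eq (X Y : Fin m → A) : dot q X Y = ∑ i, ∑ j, metric q m i j • (X i * Y j) := by
  rw [← Fintype.sum_prod_type']; rfl

theorem on12_rop_ten3 (X Y Z : Fin m → A) (a b c : Fin m) :
    on12 m (rop q m) (ten3 X Y Z) a b c = rop q m (ten2 X Y) a b * Z c :=
  (map_rop (LinearMap.mulRight ℝ (Z c)) (ten2 X Y) a b).symm

theorem on23_rop_ten3 (X Y Z : Fin m → A) (a b c : Fin m) :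
    on23 m (rop q m) (ten3 X Y Z) a b c = X a * rop q m (ten2 Y Z) b c := by
  have : ten3 X Y Z a = fun b c => LinearMap.mulLeft ℝ (X a) (ten2 Y Z b c) := by
    ext; simp [ten3, ten2, mul_assoc]
  rw [on23_apply, this, ← map_rop]; rfl

theorem on12_rinv_ten3 (X Y Z : Fin m → A) (a b c : Fin m) :
    on12 m (rinv q m) (ten3 X Y Z) a b c = rinv q m (ten2 X Y) a b * Z c :=
  (map_rinv (LinearMap.mulRight ℝ (Z c)) (ten2 X Y) a b).symm

theorem on23_rinv_ten3 (X Y Z : Fin m → A) (a b c : Fin m) :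
    on23 m (rinv q m) (ten3 X Y Z) a b c = X a * rinv q m (ten2 Y Z) b c := by
  have : ten3 X Y Z a = fun b c => LinearMap.mulLeft ℝ (X a) (ten2 Y Z b c) := by
    ext; simp [ten3, ten2, mul_assoc]
  rw [on23_apply, this, ← map_rinv]; rfl

theorem capL_ten3 (X Y Z : Fin m → A) (c : Fin m) :
    capL q m (ten3 X Y Z) c = dot q X Y * Z c :=
  (map_cap (LinearMap.mulRight ℝ (Z c)) (ten2 X Y)).symm

theorem capR_ten3 (X Y Z : Fin m → A) (a : Fin m) :
    capR q m (ten3 X Y Z) a = X a * dot q Y Z := by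
  have : ten3 X Y Z a = fun b c => LinearMap.mulLeft ℝ (X a) (ten2 Y Z b c) := by
    ext; simp [ten3, ten2, mul_assoc]
  change cap q m (ten3 X Y Z a) = _
  rw [this, ← map_cap]; rfl

theorem isVector_iff (hq : 0 < q) {X : Fin m → A} : IsVector q X ↔
    rop q m (ten2 X X) = q • ten2 X X - kappa q m • cup q m (dot q X X) := by
  have hmu := (mu_pos (m := m) hq).ne'
  rw [IsVector, asym_eq hq, smul_eq_zero_iff_right (mul_ne_zero (inv_ne_zero hq.ne') hmu),
    sub_eq_zero, eq_comm]
  rfl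

theorem IsVector.on12 (hq : 0 < q) {X : Fin m → A} (h : IsVector q X) (Z : Fin m → A) :
    on12 m (rop q m) (ten3 X X Z)
      = q • ten3 X X Z - kappa q m • cupL q m fun c => dot q X X * Z c := by
  ext a b c
  rw [on12_rop_ten3, (isVector_iff hq).1 h]
  simp [sub_mul, ten2, ten3, cupL, cup, smul_mul_assoc]

theorem IsVector.on23 (hq : 0 < q) {X : Fin m → A} (h : IsVector q X) (Z : Fin m → A) :
    on23 m (rop q m) (ten3 Z X X)
      = q • ten3 Z X X - kappa q m • cupR q m fun c => Z c * dot q X X := by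
  ext a b c
  rw [on23_rop_ten3, (isVector_iff hq).1 h]
  simp [mul_sub, ten2, ten3, cupR, cup, mul_assoc, mul_smul_comm]

/-- The square of a vector is central. -/
theorem IsVector.commute (hq : 0 < q) {X : Fin m → A} (h : IsVector q X) (c : Fin m) :
    X c * dot q X X = dot q X X * X c := by
  have hmu := (mu_pos (m := m) hq).ne'
  -- The braiding of the metric past `X`, applied to `X ⊗ X ⊗ X`, where both factors `R̂` act by the
  -- relations of the coordinates.
  have h1 := congrFun (capL_rop_rop hq (ten3 X X X)) c
  rw [h.on12 hq, map_sub, map_smul, map_smul, h.on23 hq, ← rinv_cupR hq, map_sub, map_smul,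
    map_smul, map_sub, map_smul, map_smul, capL_cupR hq, capL_on12_rinv hq, capL_cupR hq] at h1
  simp only [Pi.sub_apply, Pi.smul_apply, capL_ten3, capR_ten3] at h1
  have hk : q * q - kappa q m * q ^ ((m : ℤ) - 1) = 1 + q * kappa q m := by
    have h3 : q ^ (2 - (m : ℤ)) * q ^ ((m : ℤ) - 1) = q := by
      rw [← zpow_add₀ hq.ne']; norm_num
    have h4 := kappa_mul_mu (m := m) hq
    rw [mul_zpow_two_sub hq] at h3
    have h5 : mu q m = 1 + q * q ^ (1 - (m : ℤ)) := by rw [mu, mul_zpow_two_sub hq]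
    refine mul_right_cancel₀ hmu ?_
    have h6 : q * q⁻¹ = 1 := mul_inv_cancel₀ hq.ne'
    linear_combination (-q ^ ((m : ℤ) - 1) - q) * h4 - (q - q⁻¹) * h3 + (q ^ 2 - 1) * h5
      + (1 + q * q ^ (1 - (m : ℤ))) * h6
  have hpos : 1 + q * kappa q m ≠ 0 := by
    have h4 := kappa_mul_mu (m := m) hq
    have h5 : mu q m = 1 + q * q ^ (1 - (m : ℤ)) := by rw [mu, mul_zpow_two_sub hq]
    have h6 : q * q⁻¹ = 1 := mul_inv_cancel₀ hq.ne'
    have h7 : (1 + q * kappa q m) * mu q m = 1 + q ^ 3 * q ^ (1 - (m : ℤ)) := by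
      linear_combination q * h4 + h5 - q * q ^ (1 - (m : ℤ)) * h6
    have h8 : 0 < 1 + q ^ 3 * q ^ (1 - (m : ℤ)) := by positivity
    intro h
    rw [h, zero_mul] at h7
    exact h8.ne h7
  have h5 : (1 + q * kappa q m) • (X c * dot q X X) = (1 + q * kappa q m) • (dot q X X * X c) := by
    conv_rhs => rw [← hk]
    rw [← sub_eq_zero] at h1 ⊢
    rw [← neg_eq_zero, ← h1]
    module
  exact smul_right_injective A hpos h5

theorem cross_left {X D : Fin m → A} (h : ten2 D X = cup q m 1 + q • rinv q m (ten2 X D))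
    (Z : Fin m → A) : ten3 D X Z = cupL q m Z + q • on12 m (rinv q m) (ten3 X D Z) := by
  ext a b c
  have : ten3 D X Z a b c = ten2 D X a b * Z c := rfl
  rw [this, h]
  simp [on12_rinv_ten3, add_mul, cupL, cup, smul_mul_assoc]

theorem cross_right {X D : Fin m → A} (h : ten2 D X = cup q m 1 + q • rinv q m (ten2 X D))
    (Z : Fin m → A) : ten3 Z D X = cupR q m Z + q • on23 m (rinv q m) (ten3 Z X D) := by
  ext a b c
  have : ten3 Z D X a b c = Z a * ten2 D X b c := mul_assoc _ _ _
  rw [this, h]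
  simp [on23_rinv_ten3, mul_add, cupR, cup, mul_smul_comm]

/-- The relations between the coordinates `X` and the partial derivatives `D`. -/
structure IsWeyl (q : ℝ) (X D : Fin m → A) : Prop where
  coord : IsVector q X
  cross : ten2 D X = cup q m 1 + q • rinv q m (ten2 X D)

namespace IsWeyl
variable {X D : Fin m → A}

theorem deriv_mul_normSq (hq : 0 < q) (h : IsWeyl q X D) (a : Fin m) :
    D a * dot q X X = mu q m • X a + q ^ 2 • (dot q X X * D a) := by
  rw [← capR_ten3, cross_left h.cross, cross_right h.cross, map_add, map_smul, map_add, map_smul, rinv_cupR hq,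
    map_add, map_smul, capR_cupL hq, capR_on23_rop hq, capR_cupL hq, capR_rinv_rinv hq, mu,
    mul_zpow_two_sub hq]
  simp only [Pi.add_apply, Pi.smul_apply, capL_ten3]
  module

theorem laplace_mul_coord (hq : 0 < q) (h : IsWeyl q X D) (c : Fin m) :
    dot q D D * X c = mu q m • D c + q ^ 2 • (X c * dot q D D) := by
  rw [← capL_ten3, cross_right h.cross, cross_left h.cross, map_add, map_smul, map_add, map_smul, rinv_cupL hq,
    map_add, map_smul, capL_cupR hq, capL_on12_rop hq, capL_cupR hq, capL_rinv_rinv hq, mu,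
    mul_zpow_two_sub hq]
  simp only [Pi.add_apply, Pi.smul_apply, capR_ten3]
  module

theorem euler_mul_coord (hq : 0 < q) (h : IsWeyl q X D) (c : Fin m) :
    dot q X D * X c = X c + q ^ 2 • (X c * dot q X D)
      - (q * kappa q m) • (dot q X X * D c) := by
  rw [← capL_ten3, cross_right h.cross, map_add, map_smul, capL_cupR hq, capL_rinv hq, h.coord.on12 hq,
    map_sub, map_smul, map_smul, capR_cupL hq]
  simp only [Pi.add_apply, Pi.smul_apply, Pi.sub_apply, capR_ten3]
  module

theorem laplace_mul_normSq (hq : 0 < q) (hq1 : q < 1) (hm : 1 ≤ m) (h : IsWeyl q X D) :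
    dot q D D * dot q X X = (mu q m ^ 2 * ((q ^ m - 1) / (q ^ 2 - 1))) • (1 : A)
      + (mu q m ^ 2 * q ^ m) • dot q X D + q ^ 4 • (dot q X X * dot q D D) := by
  have hz : q - q⁻¹ ≠ 0 := by
    rw [sub_ne_zero]; exact (hq1.trans (one_lt_inv_iff₀.2 ⟨hq, hq1⟩)).ne
  have h1 : dot q D D * dot q X X = cap q m fun a b => D a * (D b * dot q X X) := by
    have := map_cap (q := q) (LinearMap.mulRight ℝ (dot q X X)) (ten2 D D)
    simp only [LinearMap.mulRight_apply, ten2, mul_assoc] at this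
    exact this
  have h2 : (fun a b => D a * (D b * dot q X X)) = mu q m • ten2 D X
      + (q ^ 2 * mu q m) • ten2 X D + q ^ 4 • fun a b => dot q X X * ten2 D D a b := by
    ext a b
    rw [h.deriv_mul_normSq hq, mul_add, mul_smul_comm, mul_smul_comm, ← mul_assoc,
      h.deriv_mul_normSq hq]
    simp only [Pi.add_apply, Pi.smul_apply, ten2, add_mul, smul_mul_assoc, smul_add, smul_smul,
      mul_assoc]
    ring_nf
    abel
  have h3 := cap_cup hq hm (1 : A)
  have h4 := map_cap (q := q) (LinearMap.mulLeft ℝ (dot q X X)) (ten2 D D)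
  simp only [LinearMap.mulLeft_apply] at h4
  rw [h1, h2, map_add, map_add, map_smul, map_smul, map_smul, ← h4, h.cross, map_add, map_smul,
    cap_rinv hq]
  have h5 : cap q m (cup q m (1 : A))
      = (mu q m * ((q ^ m - 1) / (q ^ 2 - 1))) • (1 : A) := by
    refine smul_right_injective A hz ?_
    simp only
    rw [h3, smul_smul]
    congr 1
    have h1 : q ^ (1 - (m : ℤ)) * q ^ m = q := by
      rw [← zpow_natCast, ← zpow_add₀ hq.ne']; simp
    have h2 : q ^ ((m : ℤ) - 1) = q ^ m / q := by
      rw [zpow_sub₀ hq.ne', zpow_natCast, zpow_one]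
    have h5 : mu q m = 1 + q * q ^ (1 - (m : ℤ)) := by rw [mu, mul_zpow_two_sub hq]
    have h6 : q ^ 2 - 1 ≠ 0 := by
      have : q ^ 2 < 1 := pow_lt_one₀ hq.le hq1 two_ne_zero
      linarith
    rw [h5, h2]
    field_simp
    linear_combination (-q) * h1
  rw [h5]
  have h6 : q * q ^ ((m : ℤ) - 1) = q ^ m := by
    rw [← zpow_one_add₀ hq.ne', ← zpow_natCast]; congr 1; ring
  have h7 : q ^ 2 * mu q m + mu q m * q ^ m = mu q m ^ 2 * q ^ m := by
    have h1 : q ^ (1 - (m : ℤ)) * q ^ m = q := by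
      rw [← zpow_natCast, ← zpow_add₀ hq.ne']; simp
    have h5 : mu q m = 1 + q * q ^ (1 - (m : ℤ)) := by rw [mu, mul_zpow_two_sub hq]
    linear_combination (-mu q m * q ^ m) * h5 - mu q m * q * h1
  rw [smul_smul q, h6, ← h7, smul_add, smul_smul, smul_smul, pow_two (mu q m), mul_assoc,
    add_smul]
  change _ + _ • dot q X D + _ • dot q X D + _ • (_ * dot q D D) = _
  abel

end IsWeyl
end Weyl

/-! ### Naturality of the antisymmetrizer -/

section Naturality
variable {q : ℝ} {m : ℕ} {M N : Type*} [AddCommGroup M] [Module ℝ M] [AddCommGroup N] [Module ℝ N]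

theorem map_asym (φ : M →ₗ[ℝ] N) (f : Fin m → Fin m → M) (a b : Fin m) :
    φ (asym q m f a b) = asym q m (fun a b => φ (f a b)) a b := by
  change φ (rop q m (rop q m f) a b - (q + q ^ (1 - (m : ℤ))) • rop q m f a b
    + (q * q ^ (1 - (m : ℤ))) • f a b) = rop q m (rop q m _) a b
      - (q + q ^ (1 - (m : ℤ))) • rop q m _ a b + (q * q ^ (1 - (m : ℤ))) • φ (f a b)
  simp only [map_add, map_sub, map_smul, map_rop]

theorem on23_asym_rinv_rinv (hq : 0 < q) (f : Fin m → Fin m → Fin m → M) :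
    on23 m (asym q m) (on12 m (rinv q m) (on23 m (rinv q m) f))
      = on12 m (rinv q m) (on23 m (rinv q m) (on12 m (asym q m) f)) := by
  have h23 (g : Fin m → Fin m → Fin m → M) : on23 m (asym q m) g
      = on23 m (rop q m) (on23 m (rop q m) g) - (q + q ^ (1 - (m : ℤ))) • on23 m (rop q m) g
        + (q * q ^ (1 - (m : ℤ))) • g := rfl
  have h12 (g : Fin m → Fin m → Fin m → M) : on12 m (asym q m) g
      = on12 m (rop q m) (on12 m (rop q m) g) - (q + q ^ (1 - (m : ℤ))) • on12 m (rop q m) g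
        + (q * q ^ (1 - (m : ℤ))) • g := rfl
  rw [h23, h12, rop_rinv_rinv hq, rop_rinv_rinv hq]
  simp only [map_add, map_sub, map_smul]

theorem on12_asym_rinv_rinv (hq : 0 < q) (f : Fin m → Fin m → Fin m → M) :
    on12 m (asym q m) (on23 m (rinv q m) (on12 m (rinv q m) f))
      = on23 m (rinv q m) (on12 m (rinv q m) (on23 m (asym q m) f)) := by
  have h23 (g : Fin m → Fin m → Fin m → M) : on23 m (asym q m) g
      = on23 m (rop q m) (on23 m (rop q m) g) - (q + q ^ (1 - (m : ℤ))) • on23 m (rop q m) g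
        + (q * q ^ (1 - (m : ℤ))) • g := rfl
  have h12 (g : Fin m → Fin m → Fin m → M) : on12 m (asym q m) g
      = on12 m (rop q m) (on12 m (rop q m) g) - (q + q ^ (1 - (m : ℤ))) • on12 m (rop q m) g
        + (q * q ^ (1 - (m : ℤ))) • g := rfl
  rw [h23, h12, rop_rinv_rinv' hq, rop_rinv_rinv' hq]
  simp only [map_add, map_sub, map_smul]

end Naturality

/-! ### Images of vectors -/

section Map
variable {q : ℝ} {m : ℕ} {B C : Type*} [Ring B] [Module ℝ B]
  [IsScalarTower ℝ B B] [SMulCommClass ℝ B B] [Ring C] [Module ℝ C]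
  [IsScalarTower ℝ C C] [SMulCommClass ℝ C C]

theorem IsVector.map (φ : B →ₗ[ℝ] C) (hφ : ∀ a b, φ (a * b) = φ a * φ b) {y : Fin m → B}
    (h : IsVector q y) : IsVector q fun i => φ (y i) := by
  ext a b
  have := map_asym (q := q) φ (ten2 y y) a b
  rw [h] at this
  simp only [ten2, hφ, Pi.zero_apply, map_zero] at this
  exact this.symm

end Map

/-! ### The relations of the partial derivatives -/

section DerivRelations
variable {q : ℝ} {m : ℕ} {A M : Type*} [Ring A] [Module ℝ A]
  [IsScalarTower ℝ A A] [SMulCommClass ℝ A A] [AddCommGroup M] [Module ℝ M]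

theorem on12_asym_ten3 (hq : 0 < q) {X D : Fin m → A}
    (h : ten2 D X = cup q m 1 + q • rinv q m (ten2 X D)) :
    on12 m (asym q m) (ten3 D D X)
      = (q * q) • on23 m (rinv q m) (on12 m (rinv q m) (on23 m (asym q m) (ten3 X D D))) := by
  have h2 : on12 m (asym q m) (cupR q m D + q • on12 m (rop q m) (cupR q m D)) = 0 := by
    ext a b c
    exact congrFun (congrFun (asym_add_rop hq fun a b => cupR q m D a b c) a) b
  rw [cross_right h, cross_left h, map_add (on23 m (rinv q m)), rinv_cupL hq, smul_add,
    ← add_assoc, map_add, h2, map_smul, map_smul, map_smul, on12_asym_rinv_rinv hq, smul_smul,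
    zero_add]

/-- The relations of the partial derivatives, by induction on the degree of the polynomial to which
they are applied: `φ` is the evaluation at a polynomial and `ψ` the multiplication by coordinates. -/
theorem map_asym_deriv_mul_coord (hq : 0 < q) {X D : Fin m → A}
    (h : ten2 D X = cup q m 1 + q • rinv q m (ten2 X D)) (φ : A →ₗ[ℝ] M)
    (ψ : Fin m → M →ₗ[ℝ] M) (hφ : ∀ i t, φ (X i * t) = ψ i (φ t))
    (h0 : ∀ a b, φ (asym q m (ten2 D D) a b) = 0) (a b c : Fin m) :
    φ (asym q m (ten2 D D) a b * X c) = 0 := by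
  have h1 := congrFun (congrFun (congrFun (on12_asym_ten3 hq h) a) b) c
  have h2 : on12 m (asym q m) (ten3 D D X) a b c = asym q m (ten2 D D) a b * X c :=
    (map_asym (LinearMap.mulRight ℝ (X c)) (ten2 D D) a b).symm
  rw [← h2, h1]
  simp only [Pi.smul_apply]
  rw [map_smul, on23_apply, map_rinv]
  have h3 : (fun b c => φ (on12 m (rinv q m) (on23 m (asym q m) (ten3 X D D)) a b c)) = 0 := by
    funext b c
    rw [on12_apply, map_rinv]
    have h4 : (fun a b => φ (on23 m (asym q m) (ten3 X D D) a b c)) = 0 := by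
      funext a b
      have h5 : ten3 X D D a = fun b c => LinearMap.mulLeft ℝ (X a) (ten2 D D b c) := by
        funext b c; exact mul_assoc _ _ _
      rw [on23_apply, h5, ← map_asym, LinearMap.mulLeft_apply, hφ, h0, map_zero]; rfl
    rw [h4, map_zero]; rfl
  rw [h3, map_zero]
  exact smul_zero _

end DerivRelations

/-! ### Homomorphisms and induction on polynomials -/

section Lift
variable {q : ℝ} {m : ℕ} {B : Type*} [Ring B] [Algebra ℂ B]

theorem isVector_iff_sum (hq : 0 < q) {y : Fin m → B} : IsVector q y ↔
    ∀ a : Fin m × Fin m,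
      ∑ b : Fin m × Fin m, ((projA q m a b : ℝ) : ℂ) • (y b.1 * y b.2) = 0 := by
  have h (a : Fin m × Fin m) :
      ∑ b : Fin m × Fin m, ((projA q m a b : ℝ) : ℂ) • (y b.1 * y b.2)
        = ((-q⁻¹ - q) * (-q⁻¹ - q ^ (1 - (m : ℤ))))⁻¹ • asym q m (ten2 y y) a.1 a.2 := by
    rw [← sum_projA_smul]
    refine Finset.sum_congr rfl fun b _ => ?_
    rw [Complex.coe_smul]; rfl
  simp only [h, smul_eq_zero_iff_right (projA_const_ne_zero hq), IsVector]
  constructor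
  · intro h a; rw [h]; rfl
  · intro h; ext a b; exact h (a, b)

/-- The algebra homomorphism on `𝒫` with given values on the coordinates. -/
noncomputable def polyLift (hq : 0 < q) (y : Fin m → B) (h : IsVector q y) : Poly q m →ₐ[ℂ] B :=
  RingQuot.liftAlgHom ℂ ⟨FreeAlgebra.lift ℂ y, by
    rintro _ _ ⟨a⟩
    simpa only [map_sum, map_smul, map_mul, FreeAlgebra.lift_ι_apply, map_zero]
      using (isVector_iff_sum hq).1 h a⟩

@[simp]
theorem polyLift_coord (hq : 0 < q) (y : Fin m → B) (h : IsVector q y) (i : Fin m) :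
    polyLift hq y h (coord q m i) = y i := by
  simp [polyLift, coord]

theorem isVector_coord (hq : 0 < q) : IsVector q (coord q m) :=
  (isVector_iff_sum hq).2 (coord_rel q m)

theorem poly_induction {C : Poly q m → Prop} (one : C 1) (add : ∀ f g, C f → C g → C (f + g))
    (smul : ∀ (r : ℂ) f, C f → C (r • f)) (coord_mul : ∀ i f, C f → C (coord q m i * f))
    (p : Poly q m) : C p := by
  obtain ⟨a, rfl⟩ := RingQuot.mkAlgHom_surjective ℂ (Rel q m) p
  have key : ∀ f, C f → C (RingQuot.mkAlgHom ℂ (Rel q m) a * f) := by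
    induction a using FreeAlgebra.induction with
    | grade0 r =>
      intro f hf
      rw [AlgHom.commutes, ← Algebra.smul_def]; exact smul r f hf
    | grade1 i => exact fun f hf => coord_mul i f hf
    | mul a b ha hb => intro f hf; rw [map_mul, mul_assoc]; exact ha _ (hb _ hf)
    | add a b ha hb => intro f hf; rw [map_add, add_mul]; exact add _ _ (ha _ hf) (hb _ hf)
  simpa using key 1 one

theorem homog_zero : homog q m 0 = 1 := pow_zero _

theorem homog_succ_induction {k : ℕ} {C : Poly q m → Prop} (zero : C 0)
    (add : ∀ f g, C f → C g → C (f + g)) (smul : ∀ (r : ℂ) f, C f → C (r • f))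
    (coord_mul : ∀ i, ∀ f ∈ homog q m k, C (coord q m i * f)) {p : Poly q m}
    (hp : p ∈ homog q m (k + 1)) : C p := by
  rw [homog, pow_succ'] at hp
  refine Submodule.mul_induction_on hp ?_ add
  intro a ha f hf
  induction ha using Submodule.span_induction with
  | mem a ha => obtain ⟨i, rfl⟩ := ha; exact coord_mul i f hf
  | zero => rw [zero_mul]; exact zero
  | add a b _ _ ha hb => rw [add_mul]; exact add _ _ ha hb
  | smul r a _ ha => rw [smul_mul_assoc]; exact smul r _ ha

end Lift

/-! ### Existence and uniqueness of the partial derivatives -/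

section Partials
variable (q : ℝ) (m : ℕ)

/-- The action of the coordinate `x^j` on the pairs of the gradient and the value of a function. -/
noncomputable def jetCoord (j : Fin m) : Module.End ℂ ((Fin m → Poly q m) × Poly q m) where
  toFun w := (fun i => ((metric q m i j : ℝ) : ℂ) • w.2 + (q : ℂ) • ∑ b : Fin m × Fin m,
    (((braid q m)⁻¹ (i, j) b : ℝ) : ℂ) • (coord q m b.1 * w.1 b.2), coord q m j * w.2)
  map_add' v w := by
    ext i
    · simp only [Prod.snd_add, Prod.fst_add, Pi.add_apply, smul_add, mul_add,
        Finset.sum_add_distrib]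
      abel
    · simp [mul_add]
  map_smul' r w := by
    ext i
    · simp only [Prod.smul_snd, Prod.smul_fst, Pi.smul_apply, smul_add, mul_smul_comm,
        Finset.smul_sum, RingHom.id_apply, smul_comm r]
    · simp

variable {q m}

theorem jetCoord_apply (hq : 0 < q) (j : Fin m) (w : (Fin m → Poly q m) × Poly q m) :
    jetCoord q m j w = (fun i => cup q m w.2 i j + q • rinv q m (ten2 (coord q m) w.1) i j,
      coord q m j * w.2) := by
  refine Prod.ext (funext fun i => ?_) ?_
  · simp only [jetCoord, LinearMap.coe_mk, AddHom.coe_mk, rinv_eq_sum hq]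
    rfl
  · rfl

/-- The operators `jetCoord` satisfy the relations of the coordinates. Their gradient part is the sum of
a multiple of `1 + q R̂`, which `P_A` kills, and of a term through which `P_A` passes by the braid
relation. -/
theorem isVector_jetCoord (hq : 0 < q) : IsVector q (jetCoord q m) := by
  have key (w : (Fin m → Poly q m) × Poly q m) (i a b : Fin m) :
      (jetCoord q m a (jetCoord q m b w)).1 i
        = ((cupL q m (fun b => coord q m b * w.2)
            + q • on23 m (rop q m) (cupL q m fun b => coord q m b * w.2))
          + (q * q) • on12 m (rinv q m) (on23 m (rinv q m)
            (ten3 (coord q m) (coord q m) w.1))) i a b := by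
    rw [← rinv_cupR hq, mul_smul, add_assoc, ← smul_add, ← map_smul, ← map_add,
      jetCoord_apply hq, jetCoord_apply hq]
    simp only [Pi.add_apply, Pi.smul_apply]
    congr 2
    rw [on12_apply]
    refine congrFun (congrFun (congrArg _ (funext fun k => funext fun l => ?_)) i) a
    simp only [ten2, Pi.add_apply, Pi.smul_apply, on23_rinv_ten3, mul_add, cupR, cup]
    simp [mul_smul_comm]
  have h0 (w : (Fin m → Poly q m) × Poly q m) (a b : Fin m) :
      asym q m (ten2 (jetCoord q m) (jetCoord q m)) a b w
        = asym q m (fun a b => jetCoord q m a (jetCoord q m b w)) a b :=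
    map_asym (M := Module.End ℂ ((Fin m → Poly q m) × Poly q m))
      { toFun := fun f => f w, map_add' := fun _ _ => rfl, map_smul' := fun _ _ => rfl } _ a b
  funext a b
  refine LinearMap.ext fun w => Prod.ext (funext fun i => ?_) ?_
  · rw [h0]
    have h1 := map_asym (q := q) (LinearMap.proj (R := ℝ) (φ := fun _ : Fin m => Poly q m) i ∘ₗ
      LinearMap.fst ℝ (Fin m → Poly q m) (Poly q m))
      (fun a b => jetCoord q m a (jetCoord q m b w)) a b
    simp only [LinearMap.comp_apply, LinearMap.fst_apply, LinearMap.proj_apply, key] at h1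
    rw [h1]
    change on23 m (asym q m) ((cupL q m (fun b => coord q m b * w.2)
            + q • on23 m (rop q m) (cupL q m fun b => coord q m b * w.2))
          + (q * q) • on12 m (rinv q m) (on23 m (rinv q m)
            (ten3 (coord q m) (coord q m) w.1))) i a b = 0
    have h2 : on23 m (asym q m) (cupL q m (fun b => coord q m b * w.2)
            + q • on23 m (rop q m) (cupL q m fun b => coord q m b * w.2)) = 0 :=
      funext fun i => asym_add_rop hq (cupL q m (fun b => coord q m b * w.2) i)
    have h3 : on12 m (asym q m) (ten3 (coord q m) (coord q m) w.1) = 0 := by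
      ext a b c
      have := map_asym (q := q) (LinearMap.mulRight ℝ (w.1 c)) (ten2 (coord q m) (coord q m)) a b
      rw [isVector_coord (m := m) hq] at this
      simp only [Pi.zero_apply, map_zero] at this
      exact this.symm
    rw [map_add, h2, map_smul, on23_asym_rinv_rinv hq, h3]
    simp
  · rw [h0]
    have h1 := map_asym (q := q) (LinearMap.snd ℝ (Fin m → Poly q m) (Poly q m))
      (fun a b => jetCoord q m a (jetCoord q m b w)) a b
    simp only [LinearMap.snd_apply] at h1
    rw [h1]
    have h2 := map_asym (q := q) (LinearMap.mulRight ℝ w.2) (ten2 (coord q m) (coord q m)) a b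
    rw [isVector_coord (m := m) hq] at h2
    simp only [LinearMap.mulRight_apply, ten2, mul_assoc, Pi.zero_apply, zero_mul] at h2
    exact h2.symm

/-- The representation of the polynomials by `jetCoord` sends `f` to an operator that maps the jet
`(0, 1)` of the constant `1` to the jet of `f`. The gradient part of this jet defines the partial
derivatives. -/
theorem exists_isPartials (hq : 0 < q) : ∃ D, IsPartials q m D := by
  let J := polyLift hq (jetCoord q m) (isVector_jetCoord hq)
  -- The second component of the jet of `p` is `p`.
  have hJ (p : Poly q m) : (J p (0, 1)).2 = p := by
    induction p using poly_induction with
    | one => simp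
    | add f g hf hg => simp [hf, hg]
    | smul r f hf => simp [hf]
    | coord_mul i f hf => simp [J, jetCoord, hf]
  refine ⟨fun i => LinearMap.proj i ∘ₗ LinearMap.fst ℂ _ _ ∘ₗ LinearMap.applyₗ (0, 1) ∘ₗ
    J.toLinearMap, fun i => ?_, fun i j f => ?_⟩
  · simp
  · have : J (coord q m j * f) = jetCoord q m j * J f := by
      rw [map_mul, polyLift_coord]
    simp only [LinearMap.comp_apply, AlgHom.toLinearMap_apply, this, LinearMap.applyₗ_apply_apply,
      LinearMap.fst_apply, LinearMap.proj_apply, Module.End.mul_apply]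
    simp only [jetCoord, LinearMap.coe_mk, AddHom.coe_mk, hJ]

theorem IsPartials.unique {D E : Fin m → Module.End ℂ (Poly q m)} (hD : IsPartials q m D)
    (hE : IsPartials q m E) : D = E := by
  suffices ∀ p i, D i p = E i p from funext fun i => LinearMap.ext fun p => this p i
  intro p
  induction p using poly_induction with
  | one => intro i; rw [hD.1, hE.1]
  | add f g hf hg => intro i; simp [hf, hg]
  | smul r f hf => intro i; simp [hf]
  | coord_mul j f hf => intro i; rw [hD.2, hE.2]; simp only [hf]

theorem existsUnique_isPartials (hq : 0 < q) : ∃! D, IsPartials q m D :=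
  let ⟨D, hD⟩ := exists_isPartials hq
  ⟨D, hD, fun _ hE => hE.unique hD⟩

theorem isPartials_pderiv (hq : 0 < q) : IsPartials q m (pderiv q m) :=
  Classical.epsilon_spec (exists_isPartials hq)

/-- The algebra of the linear operators on `𝒫`. -/
def Op (q : ℝ) (m : ℕ) : Type := Module.End ℂ (Poly q m)

noncomputable instance : Ring (Op q m) := inferInstanceAs (Ring (Module.End ℂ (Poly q m)))

noncomputable instance : Algebra ℂ (Op q m) :=
  inferInstanceAs (Algebra ℂ (Module.End ℂ (Poly q m)))

/-- A linear operator as an element of the algebra of operators. -/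
def toOp (f : Module.End ℂ (Poly q m)) : Op q m := f

/-- The value of operators at a polynomial. -/
noncomputable def evalOp (p : Poly q m) : Op q m →ₗ[ℝ] Poly q m where
  toFun f := DFunLike.coe (F := Module.End ℂ (Poly q m)) f p
  map_add' _ _ := rfl
  map_smul' _ _ := rfl

theorem op_ext {f g : Op q m} (h : ∀ p, evalOp p f = evalOp p g) : f = g :=
  LinearMap.ext (f := (f : Module.End ℂ (Poly q m))) (g := g) h

@[simp] theorem evalOp_toOp (p : Poly q m) (f : Module.End ℂ (Poly q m)) :
    evalOp p (toOp f) = f p := rfl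

@[simp] theorem evalOp_mul (p : Poly q m) (f g : Op q m) :
    evalOp p (f * g) = evalOp (evalOp p g) f := rfl

@[simp] theorem evalOp_one (p : Poly q m) : evalOp p 1 = p := rfl

theorem evalOp_smul (p : Poly q m) (r : ℂ) (f : Op q m) : evalOp p (r • f) = r • evalOp p f := rfl

theorem evalOp_add_left (p r : Poly q m) (f : Op q m) :
    evalOp (p + r) f = evalOp p f + evalOp r f :=
  LinearMap.map_add (f : Module.End ℂ (Poly q m)) p r

theorem evalOp_smul_left (r : ℂ) (p : Poly q m) (f : Op q m) :
    evalOp (r • p) f = r • evalOp p f :=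
  LinearMap.map_smul (f : Module.End ℂ (Poly q m)) r p

/-- The representation of polynomials by multiplication operators. -/
noncomputable def mulOp (q : ℝ) (m : ℕ) : Poly q m →ₗ[ℝ] Op q m where
  toFun p := toOp (LinearMap.mulLeft ℂ p)
  map_add' _ _ := LinearMap.ext fun _ => add_mul _ _ _
  map_smul' _ _ := LinearMap.ext fun _ => smul_mul_assoc _ _ _

theorem mulOp_mul (f g : Poly q m) : mulOp q m (f * g) = mulOp q m f * mulOp q m g :=
  op_ext fun p => mul_assoc f g p

/-- The operators of multiplication by the coordinates. -/
noncomputable def coordOp (q : ℝ) (m : ℕ) (i : Fin m) : Op q m := mulOp q m (coord q m i)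

/-- The partial derivatives as elements of the algebra of operators. -/
noncomputable def derivOp (q : ℝ) (m : ℕ) (i : Fin m) : Op q m := toOp (pderiv q m i)

theorem isVector_coordOp (hq : 0 < q) : IsVector q (coordOp q m) :=
  (isVector_coord hq).map (mulOp q m) mulOp_mul

theorem ofReal_smul (r : ℝ) (p : Poly q m) : (r : ℂ) • p = r • p := Complex.coe_smul r p

theorem pderiv_one (hq : 0 < q) (i : Fin m) : pderiv q m i 1 = 0 := (isPartials_pderiv hq).1 i

theorem cross_derivOp (hq : 0 < q) : ten2 (derivOp q m) (coordOp q m)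
    = cup q m 1 + q • rinv q m (ten2 (coordOp q m) (derivOp q m)) := by
  funext i j
  refine op_ext fun f => ?_
  have h1 := (isPartials_pderiv (m := m) hq).2 i j f
  simp only [ofReal_smul] at h1
  change pderiv q m i (coord q m j * f) = _
  rw [h1, Pi.add_apply, Pi.add_apply, map_add, map_cup, Pi.smul_apply, Pi.smul_apply, map_smul,
    map_rinv, rinv_eq_sum hq]
  rfl

/-- The partial derivatives satisfy the relations of the coordinates, hence `x^i ↦ ∂^i` extends to the
homomorphism `diffOp`. -/
theorem isVector_derivOp (hq : 0 < q) : IsVector q (derivOp q m) := by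
  suffices ∀ p, ∀ a b, evalOp p (asym q m (ten2 (derivOp q m) (derivOp q m)) a b) = 0 from
    funext fun a => funext fun b => op_ext fun p => this p a b
  intro p
  induction p using poly_induction with
  | one =>
    intro a b
    rw [map_asym]
    have h0 : (fun a b => evalOp 1 (ten2 (derivOp q m) (derivOp q m) a b)) = 0 := by
      funext a b
      change pderiv q m a (pderiv q m b 1) = 0
      rw [pderiv_one hq, map_zero]
    rw [h0, map_zero]; rfl
  | add f g hf hg => intro a b; rw [evalOp_add_left, hf, hg, add_zero]
  | smul r f hf => intro a b; rw [evalOp_smul_left, hf, smul_zero]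
  | coord_mul c f hf =>
    intro a b
    exact map_asym_deriv_mul_coord hq (cross_derivOp hq) (evalOp f)
      (fun i => LinearMap.mulLeft ℝ (coord q m i)) (fun _ _ => rfl) hf a b c

theorem isWeyl (hq : 0 < q) : IsWeyl q (coordOp q m) (derivOp q m) :=
  ⟨isVector_coordOp hq, cross_derivOp hq⟩

/-- The action of polynomials as differential operators, `x^i ↦ ∂^i`. -/
noncomputable def diffOp (hq : 0 < q) : Poly q m →ₐ[ℂ] Op q m :=
  polyLift hq (derivOp q m) (isVector_derivOp hq)

theorem normSq_eq_dot : normSq q m = dot q (coord q m) (coord q m) := by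
  simp only [dot_eq, normSq, ofReal_smul]
  rfl

theorem mulOp_normSq : mulOp q m (normSq q m) = dot q (coordOp q m) (coordOp q m) := by
  rw [normSq_eq_dot, dot, map_cap]
  simp only [ten2, mulOp_mul]
  rfl

theorem laplace_eq_dot : toOp (laplace q m) = dot q (derivOp q m) (derivOp q m) := by
  refine op_ext fun p => ?_
  simp only [dot_eq, map_sum, derivOp, evalOp_toOp]
  simp [laplace]

/-- The Euler operator `x^i C_{ij} ∂^j`. -/
noncomputable def euler (p : Poly q m) : Poly q m :=
  evalOp p (dot q (coordOp q m) (derivOp q m))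

theorem euler_eq (p : Poly q m) :
    euler p = ∑ i, ∑ j, metric q m i j • (coord q m i * pderiv q m j p) := by
  simp only [euler, dot_eq, map_sum]
  rfl

theorem coord_mul_normSq (hq : 0 < q) (i : Fin m) :
    coord q m i * normSq q m = normSq q m * coord q m i := by
  rw [normSq_eq_dot]; exact (isVector_coord hq).commute hq i

theorem normSq_comm (hq : 0 < q) (p : Poly q m) : p * normSq q m = normSq q m * p := by
  induction p using poly_induction with
  | one => simp
  | add f g hf hg => rw [add_mul, mul_add, hf, hg]
  | smul r f hf => rw [smul_mul_assoc, mul_smul_comm, hf]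
  | coord_mul i f hf => rw [mul_assoc, hf, ← mul_assoc, coord_mul_normSq hq, mul_assoc]

theorem pderiv_laplace (hq : 0 < q) (i : Fin m) (p : Poly q m) :
    pderiv q m i (laplace q m p) = laplace q m (pderiv q m i p) := by
  have := congrArg (evalOp p) ((isVector_derivOp (m := m) hq).commute hq i)
  rw [← laplace_eq_dot] at this
  exact this

theorem laplace_coord_mul (hq : 0 < q) (i : Fin m) (p : Poly q m) :
    laplace q m (coord q m i * p)
      = mu q m • pderiv q m i p + q ^ 2 • (coord q m i * laplace q m p) := by
  have := congrArg (evalOp p) ((isWeyl (m := m) hq).laplace_mul_coord hq i)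
  rw [← laplace_eq_dot, map_add, map_smul, map_smul] at this
  exact this

theorem euler_coord_mul (hq : 0 < q) (i : Fin m) (p : Poly q m) :
    euler (coord q m i * p) = coord q m i * p + q ^ 2 • (coord q m i * euler p)
      - (q * kappa q m) • (normSq q m * pderiv q m i p) := by
  have := congrArg (evalOp p) ((isWeyl (m := m) hq).euler_mul_coord hq i)
  rw [← mulOp_normSq, map_sub, map_add, map_smul, map_smul] at this
  exact this

theorem laplace_normSq_mul (hq : 0 < q) (hq1 : q < 1) (hm : 1 ≤ m) (p : Poly q m) :
    laplace q m (normSq q m * p) = (mu q m ^ 2 * ((q ^ m - 1) / (q ^ 2 - 1))) • p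
      + (mu q m ^ 2 * q ^ m) • euler p + q ^ 4 • (normSq q m * laplace q m p) := by
  have := congrArg (evalOp p) ((isWeyl (m := m) hq).laplace_mul_normSq hq hq1 hm)
  rw [← mulOp_normSq, ← laplace_eq_dot, map_add, map_add, map_smul, map_smul, map_smul] at this
  exact this

end Partials

/-! ### Homogeneous polynomials and spherical harmonics -/

section Homogeneous
variable {q : ℝ} {m : ℕ}

theorem pderiv_coord_mul (hq : 0 < q) (i j : Fin m) (f : Poly q m) :
    pderiv q m i (coord q m j * f) = ((metric q m i j : ℝ) : ℂ) • f +
      (q : ℂ) • ∑ b : Fin m × Fin m,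
        (((braid q m)⁻¹ (i, j) b : ℝ) : ℂ) • (coord q m b.1 * pderiv q m b.2 f) :=
  (isPartials_pderiv hq).2 i j f

theorem laplace_coord_mul' (hq : 0 < q) (i : Fin m) (p : Poly q m) :
    laplace q m (coord q m i * p)
      = (mu q m : ℂ) • pderiv q m i p + ((q ^ 2 : ℝ) : ℂ) • (coord q m i * laplace q m p) := by
  simp only [ofReal_smul]; exact laplace_coord_mul hq i p

theorem euler_coord_mul' (hq : 0 < q) (i : Fin m) (p : Poly q m) :
    euler (coord q m i * p) = coord q m i * p + ((q ^ 2 : ℝ) : ℂ) • (coord q m i * euler p)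
      - ((q * kappa q m : ℝ) : ℂ) • (normSq q m * pderiv q m i p) := by
  simp only [ofReal_smul]; exact euler_coord_mul hq i p

theorem laplace_normSq_mul' (hq : 0 < q) (hq1 : q < 1) (hm : 1 ≤ m) (p : Poly q m) :
    laplace q m (normSq q m * p) = ((mu q m ^ 2 * ((q ^ m - 1) / (q ^ 2 - 1)) : ℝ) : ℂ) • p
      + ((mu q m ^ 2 * q ^ m : ℝ) : ℂ) • euler p
      + ((q ^ 4 : ℝ) : ℂ) • (normSq q m * laplace q m p) := by
  simp only [ofReal_smul]; exact laplace_normSq_mul hq hq1 hm p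

theorem euler_eq' (p : Poly q m) :
    euler p = ∑ i, ∑ j, ((metric q m i j : ℝ) : ℂ) • (coord q m i * pderiv q m j p) := by
  simp only [ofReal_smul]; exact euler_eq p

theorem laplace_apply (p : Poly q m) : laplace q m p =
    ∑ i, ∑ j, ((metric q m i j : ℝ) : ℂ) • pderiv q m i (pderiv q m j p) := by
  simp only [laplace, LinearMap.sum_apply, LinearMap.smul_apply, Module.End.mul_apply]

theorem euler_add (p r : Poly q m) : euler (p + r) = euler p + euler r := evalOp_add_left _ _ _

theorem euler_smul (c : ℂ) (p : Poly q m) : euler (c • p) = c • euler p := evalOp_smul_left _ _ _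

theorem one_mem_homog : (1 : Poly q m) ∈ homog q m 0 := by
  rw [homog_zero]; exact Submodule.one_le.1 le_rfl

theorem coord_mem_homog (i : Fin m) : coord q m i ∈ homog q m 1 := by
  rw [homog, pow_one]; exact Submodule.subset_span ⟨i, rfl⟩

theorem mul_mem_homog {a b : ℕ} {p r : Poly q m} (hp : p ∈ homog q m a) (hr : r ∈ homog q m b) :
    p * r ∈ homog q m (a + b) := by
  rw [homog, pow_add]; exact Submodule.mul_mem_mul hp hr

theorem coord_mul_mem_homog (i : Fin m) {k : ℕ} {p : Poly q m} (hp : p ∈ homog q m k) :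
    coord q m i * p ∈ homog q m (k + 1) := by
  rw [add_comm]; exact mul_mem_homog (coord_mem_homog i) hp

theorem normSq_mem_homog : normSq q m ∈ homog q m 2 :=
  Submodule.sum_mem _ fun i _ => Submodule.sum_mem _ fun j _ => Submodule.smul_mem _ _
    (mul_mem_homog (coord_mem_homog i) (coord_mem_homog j))

theorem normSq_pow_mul_mem_homog (j : ℕ) {k : ℕ} {p : Poly q m} (hp : p ∈ homog q m k) :
    normSq q m ^ j * p ∈ homog q m (k + 2 * j) := by
  induction j with
  | zero => simpa using hp
  | succ j ih =>
    rw [pow_succ', mul_assoc, show k + 2 * (j + 1) = 2 + (k + 2 * j) by ring]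
    exact mul_mem_homog normSq_mem_homog ih

theorem exists_smul_one {p : Poly q m} (hp : p ∈ homog q m 0) : ∃ c : ℂ, p = c • 1 := by
  rw [homog_zero, Submodule.mem_one] at hp
  obtain ⟨c, rfl⟩ := hp
  exact ⟨c, Algebra.algebraMap_eq_smul_one c⟩

theorem homog_induction {C : Poly q m → Prop} (add : ∀ f g, C f → C g → C (f + g))
    (homog : ∀ k, ∀ f ∈ homog q m k, C f) (p : Poly q m) : C p := by
  have h : p ∈ ⨆ k, QEuclid.homog q m k := by
    induction p using poly_induction with
    | one => exact Submodule.mem_iSup_of_mem 0 one_mem_homog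
    | add f g hf hg => exact Submodule.add_mem _ hf hg
    | smul r f hf => exact Submodule.smul_mem _ _ hf
    | coord_mul i f hf =>
      induction hf using Submodule.iSup_induction' with
      | mem k f hf => exact Submodule.mem_iSup_of_mem (k + 1) (coord_mul_mem_homog i hf)
      | zero => rw [mul_zero]; exact Submodule.zero_mem _
      | add f g _ _ hf hg => rw [mul_add]; exact Submodule.add_mem _ hf hg
  induction h using Submodule.iSup_induction' with
  | mem k f hf => exact homog k f hf
  | zero => exact homog 0 0 (Submodule.zero_mem _)
  | add f g _ _ hf hg => exact add _ _ hf hg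

theorem pderiv_of_mem_zero (hq : 0 < q) (i : Fin m) {p : Poly q m} (hp : p ∈ homog q m 0) :
    pderiv q m i p = 0 := by
  obtain ⟨c, rfl⟩ := exists_smul_one hp
  rw [map_smul, pderiv_one hq, smul_zero]

theorem pderiv_mem_homog (hq : 0 < q) {k : ℕ} {p : Poly q m} (hp : p ∈ homog q m (k + 1))
    (i : Fin m) : pderiv q m i p ∈ homog q m k := by
  induction k generalizing p i with
  | zero =>
    refine homog_succ_induction ?_ ?_ ?_ ?_ hp (C := fun p => pderiv q m i p ∈ homog q m 0)
    · simp
    · intro f g hf hg; rw [map_add]; exact Submodule.add_mem _ hf hg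
    · intro r f hf; rw [map_smul]; exact Submodule.smul_mem _ _ hf
    · intro j f hf
      rw [pderiv_coord_mul hq]
      refine Submodule.add_mem _ (Submodule.smul_mem _ _ hf) (Submodule.smul_mem _ _
        (Submodule.sum_mem _ fun b _ => Submodule.smul_mem _ _ ?_))
      rw [pderiv_of_mem_zero hq _ hf, mul_zero]; exact Submodule.zero_mem _
  | succ k ih =>
    refine homog_succ_induction ?_ ?_ ?_ ?_ hp (C := fun p => pderiv q m i p ∈ homog q m (k + 1))
    · simp
    · intro f g hf hg; rw [map_add]; exact Submodule.add_mem _ hf hg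
    · intro r f hf; rw [map_smul]; exact Submodule.smul_mem _ _ hf
    · intro j f hf
      rw [pderiv_coord_mul hq]
      exact Submodule.add_mem _ (Submodule.smul_mem _ _ hf) (Submodule.smul_mem _ _
        (Submodule.sum_mem _ fun b _ => Submodule.smul_mem _ _
          (coord_mul_mem_homog _ (ih hf _))))

theorem laplace_mem_homog (hq : 0 < q) {k : ℕ} {p : Poly q m} (hp : p ∈ homog q m (k + 2)) :
    laplace q m p ∈ homog q m k := by
  rw [laplace_apply]
  exact Submodule.sum_mem _ fun i _ => Submodule.sum_mem _ fun j _ => Submodule.smul_mem _ _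
    (pderiv_mem_homog hq (pderiv_mem_homog hq hp j) i)

theorem laplace_of_mem_one (hq : 0 < q) {k : ℕ} (hk : k ≤ 1) {p : Poly q m}
    (hp : p ∈ homog q m k) : laplace q m p = 0 := by
  rw [laplace_apply]
  refine Finset.sum_eq_zero fun i _ => Finset.sum_eq_zero fun j _ => ?_
  have : pderiv q m i (pderiv q m j p) = 0 := by
    interval_cases k
    · rw [pderiv_of_mem_zero hq j hp, map_zero]
    · exact pderiv_of_mem_zero hq i (pderiv_mem_homog hq hp j)
  rw [this, smul_zero]

/-- The `q²`-number `[k]_{q²}`. -/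
noncomputable def brk (q : ℝ) (k : ℕ) : ℝ := (q ^ (2 * k) - 1) / (q ^ 2 - 1)

/-- The `q²`-number `[m/2 + k]_{q²}`. -/
noncomputable def brkHalf (q : ℝ) (m k : ℕ) : ℝ := (q ^ (m + 2 * k) - 1) / (q ^ 2 - 1)

theorem sq_sub_one_ne_zero (hq : 0 < q) (hq1 : q < 1) : q ^ 2 - 1 ≠ 0 := by
  have : q ^ 2 < 1 := pow_lt_one₀ hq.le hq1 two_ne_zero
  linarith

theorem brk_succ_pos (hq : 0 < q) (hq1 : q < 1) (k : ℕ) : 0 < brk q (k + 1) := by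
  have h1 : q ^ 2 < 1 := pow_lt_one₀ hq.le hq1 two_ne_zero
  have h2 : q ^ (2 * (k + 1)) < 1 := pow_lt_one₀ hq.le hq1 (by omega)
  exact div_pos_of_neg_of_neg (by linarith) (by linarith)

theorem brkHalf_pos (hq : 0 < q) (hq1 : q < 1) (hm : 1 ≤ m) (k : ℕ) : 0 < brkHalf q m k := by
  have h1 : q ^ 2 < 1 := pow_lt_one₀ hq.le hq1 two_ne_zero
  have h2 : q ^ (m + 2 * k) < 1 := pow_lt_one₀ hq.le hq1 (by omega)
  exact div_pos_of_neg_of_neg (by linarith) (by linarith)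

theorem brk_succ (hq : 0 < q) (hq1 : q < 1) (k : ℕ) : brk q (k + 1) = 1 + q ^ 2 * brk q k := by
  have := sq_sub_one_ne_zero hq hq1
  unfold brk; field_simp; ring

theorem qFactorial_succ (k : ℕ) :
    qFactorial (q ^ 2) (k + 1) = qFactorial (q ^ 2) k * brk q (k + 1) := by
  rw [qFactorial, Finset.prod_range_succ, ← pow_mul]; rfl

theorem qFactorial_pos (hq : 0 < q) (hq1 : q < 1) (k : ℕ) : 0 < qFactorial (q ^ 2) k := by
  induction k with
  | zero => simp [qFactorial]
  | succ k ih => rw [qFactorial_succ]; exact mul_pos ih (brk_succ_pos hq hq1 k)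

/-- The Euler operator on the homogeneous polynomials of degree `k`. -/
theorem euler_homog (hq : 0 < q) (hq1 : q < 1) {k : ℕ} {p : Poly q m} (hp : p ∈ homog q m k) :
    euler p = (brk q k : ℂ) • p
      - ((q * kappa q m / mu q m : ℝ) : ℂ) • (normSq q m * laplace q m p) := by
  have hmu := (mu_pos (m := m) hq).ne'
  induction k generalizing p with
  | zero =>
    rw [laplace_of_mem_one hq zero_le_one hp, euler_eq']
    simp [pderiv_of_mem_zero hq _ hp, brk]
  | succ k ih =>
    refine homog_succ_induction ?_ ?_ ?_ ?_ hp (C := fun p => euler p = (brk q (k + 1) : ℂ) • p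
      - ((q * kappa q m / mu q m : ℝ) : ℂ) • (normSq q m * laplace q m p))
    · have := euler_smul (0 : ℂ) (0 : Poly q m); simp at this; simp [this]
    · intro f g hf hg
      rw [euler_add, hf, hg, map_add, smul_add, mul_add, smul_add]; abel
    · intro r f hf
      rw [euler_smul, hf, map_smul, mul_smul_comm, smul_sub, smul_comm r, smul_comm r]
    · intro j f hf
      rw [euler_coord_mul' hq, ih hf, laplace_coord_mul' hq, brk_succ hq hq1]
      simp only [mul_add, mul_sub, mul_smul_comm, smul_add, smul_sub, smul_smul]
      rw [← mul_assoc (coord q m j) (normSq q m), coord_mul_normSq hq, mul_assoc]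
      have h1 : ((q * kappa q m / mu q m : ℝ) : ℂ) * (mu q m : ℂ) = ((q * kappa q m : ℝ) : ℂ) := by
        rw [← Complex.ofReal_mul]; congr 1; field_simp
      rw [h1]
      push_cast
      module

theorem laplace_normSq_homog (hq : 0 < q) (hq1 : q < 1) (hm : 1 ≤ m) {k : ℕ} {p : Poly q m}
    (hp : p ∈ homog q m k) : laplace q m (normSq q m * p)
      = ((mu q m ^ 2 * brkHalf q m k : ℝ) : ℂ) • p
        + ((q ^ 2 : ℝ) : ℂ) • (normSq q m * laplace q m p) := by
  have hmu := (mu_pos (m := m) hq).ne'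
  have h1 := sq_sub_one_ne_zero hq hq1
  rw [laplace_normSq_mul' hq hq1 hm, euler_homog hq hq1 hp, smul_sub, smul_smul, smul_smul,
    ← Complex.ofReal_mul, ← Complex.ofReal_mul]
  have h2 : mu q m ^ 2 * q ^ m * (q * kappa q m / mu q m) = q ^ 4 - q ^ 2 := by
    have h3 := kappa_mul_mu (m := m) hq
    have h4 : q ^ (1 - (m : ℤ)) * q ^ m = q := by
      rw [← zpow_natCast, ← zpow_add₀ hq.ne']; simp
    have h6 : q * q⁻¹ = 1 := mul_inv_cancel₀ hq.ne'
    have h5 : mu q m ^ 2 * q ^ m * (q * kappa q m / mu q m) = q ^ m * q * (kappa q m * mu q m) := by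
      field_simp
    rw [h5, h3]
    linear_combination (q - q⁻¹) * q ^ 2 * h4 - q ^ 2 * h6
  have h3 : mu q m ^ 2 * brkHalf q m k
      = mu q m ^ 2 * ((q ^ m - 1) / (q ^ 2 - 1)) + mu q m ^ 2 * q ^ m * brk q k := by
    unfold brkHalf brk
    field_simp
    ring
  rw [h2, h3]
  push_cast
  module

/-- The Laplace operator on `x^{2(j+1)} S` for a spherical harmonic `S`. That the factor does not vanish
is what makes the decomposition into spherical harmonics work. -/
theorem laplace_normSq_pow_mul (hq : 0 < q) (hq1 : q < 1) (hm : 1 ≤ m) {k : ℕ} {S : Poly q m}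
    (hS : S ∈ harmonics q m k) (j : ℕ) : laplace q m (normSq q m ^ (j + 1) * S)
      = ((mu q m ^ 2 * brk q (j + 1) * brkHalf q m (k + j) : ℝ) : ℂ) • (normSq q m ^ j * S) := by
  have h1 := sq_sub_one_ne_zero hq hq1
  induction j with
  | zero =>
    rw [zero_add, pow_one, laplace_normSq_homog hq hq1 hm hS.1, LinearMap.mem_ker.1 hS.2]
    simp [brk, div_self h1]
  | succ j ih =>
    rw [pow_succ', mul_assoc, laplace_normSq_homog hq hq1 hm (normSq_pow_mul_mem_homog _ hS.1), ih,
      mul_smul_comm, ← mul_assoc, ← pow_succ', smul_smul, ← Complex.ofReal_mul, ← add_smul,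
      ← Complex.ofReal_add]
    congr 2
    unfold brkHalf brk
    field_simp
    ring

/-- The decomposition of the homogeneous polynomials into spherical harmonics. -/
theorem mem_span_harmonics (hq : 0 < q) (hq1 : q < 1) (hm : 1 ≤ m) {n : ℕ} {p : Poly q m}
    (hp : p ∈ homog q m n) : p ∈ Submodule.span ℂ {r | ∃ k j S, k + 2 * j = n ∧
      S ∈ harmonics q m k ∧ r = normSq q m ^ j * S} := by
  induction n using Nat.strong_induction_on generalizing p with
  | _ n ih =>
  rcases Nat.lt_or_ge n 2 with hn | hn
  · exact Submodule.subset_span ⟨n, 0, p, by simp, ⟨hp, laplace_of_mem_one hq (by omega) hp⟩,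
      by simp⟩
  · obtain ⟨n, rfl⟩ := Nat.exists_eq_add_of_le' hn
    have h1 := ih n (by omega) (laplace_mem_homog hq hp)
    -- The Laplace operator maps the span onto the one in degree `n`, so a preimage `r` of `Δ p` exists
    -- there, and `p - r` is harmonic.
    have h2 : ∃ r ∈ Submodule.span ℂ {r | ∃ k j S, k + 2 * j = n + 2 ∧
        S ∈ harmonics q m k ∧ r = normSq q m ^ j * S}, r ∈ homog q m (n + 2) ∧
        laplace q m r = laplace q m p := by
      generalize laplace q m p = g at h1
      induction h1 using Submodule.span_induction with
      | mem x hx =>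
        obtain ⟨k, j, S, hk, hS, rfl⟩ := hx
        have hc : ((mu q m ^ 2 * brk q (j + 1) * brkHalf q m (k + j) : ℝ) : ℂ) ≠ 0 := by
          have h1 := mu_pos (m := m) hq
          have h2 := brk_succ_pos hq hq1 j
          have h3 := brkHalf_pos hq hq1 hm (k + j)
          exact_mod_cast (by positivity)
        refine ⟨(((mu q m ^ 2 * brk q (j + 1) * brkHalf q m (k + j) : ℝ) : ℂ))⁻¹ •
          (normSq q m ^ (j + 1) * S), Submodule.smul_mem _ _ (Submodule.subset_span
            ⟨k, j + 1, S, by omega, hS, rfl⟩), Submodule.smul_mem _ _ ?_, ?_⟩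
        · have := normSq_pow_mul_mem_homog (j + 1) hS.1
          rwa [show k + 2 * (j + 1) = n + 2 by omega] at this
        · rw [map_smul, laplace_normSq_pow_mul hq hq1 hm hS, smul_smul, inv_mul_cancel₀ hc,
            one_smul]
      | zero => exact ⟨0, Submodule.zero_mem _, Submodule.zero_mem _, map_zero _⟩
      | add x y _ _ hx hy =>
        obtain ⟨r, hr, hr', hrx⟩ := hx
        obtain ⟨s, hs, hs', hsy⟩ := hy
        exact ⟨r + s, Submodule.add_mem _ hr hs, Submodule.add_mem _ hr' hs', by
          rw [map_add, hrx, hsy]⟩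
      | smul c x _ hx =>
        obtain ⟨r, hr, hr', hrx⟩ := hx
        exact ⟨c • r, Submodule.smul_mem _ _ hr, Submodule.smul_mem _ _ hr', by
          rw [map_smul, hrx]⟩
    obtain ⟨r, hr, hr', hrp⟩ := h2
    have h3 : p - r ∈ Submodule.span ℂ {r | ∃ k j S, k + 2 * j = n + 2 ∧
        S ∈ harmonics q m k ∧ r = normSq q m ^ j * S} :=
      Submodule.subset_span ⟨n + 2, 0, p - r, by simp, ⟨Submodule.sub_mem _ hp hr', by
        change laplace q m (p - r) = 0
        rw [map_sub, hrp, sub_self]⟩, by simp⟩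
    have := Submodule.add_mem _ h3 hr
    rwa [sub_add_cancel] at this

/-- The Euler operator multiplies harmonic homogeneous polynomials by a nonzero number, so a
homogeneous polynomial of positive degree vanishes if all its partial derivatives do. -/
theorem eq_zero_of_pderiv_eq_zero (hq : 0 < q) (hq1 : q < 1) {k : ℕ} {p : Poly q m}
    (hp : p ∈ homog q m (k + 1)) (h : ∀ i, pderiv q m i p = 0) : p = 0 := by
  have h1 := euler_homog hq hq1 hp
  have h2 : laplace q m p = 0 := by simp [laplace_apply, h]
  have h3 : euler p = 0 := by simp [euler_eq', h]
  rw [h2, h3, mul_zero, smul_zero, sub_zero, eq_comm, smul_eq_zero] at h1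
  exact h1.resolve_left (by exact_mod_cast (brk_succ_pos hq hq1 k).ne')

end Homogeneous

/-! ### The Fourier kernel -/

section Pairing
variable {q : ℝ} {m : ℕ}

theorem evalZero_coord_mul (i : Fin m) (p : Poly q m) : evalZero q m (coord q m i * p) = 0 := by
  have : evalZero q m (coord q m i) = 0 := by simp [evalZero, coord]
  rw [map_mul, this, zero_mul]

theorem evalZero_homog_succ {k : ℕ} {p : Poly q m} (hp : p ∈ homog q m (k + 1)) :
    evalZero q m p = 0 := by
  refine homog_succ_induction ?_ ?_ ?_ ?_ hp (C := fun p => evalZero q m p = 0)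
  · simp
  · intro f g hf hg; rw [map_add, hf, hg, add_zero]
  · intro r f hf; rw [map_smul, hf, smul_zero]
  · intro i f _; exact evalZero_coord_mul i f

/-- The component of degree `k` of a polynomial. -/
noncomputable def component (k : ℕ) : Poly q m →ₗ[ℂ] Poly q m :=
  (PowerSeries.coeff (R := Poly q m) k).restrictScalars ℂ ∘ₗ (toSeries q m).toLinearMap

theorem toSeries_homog {k : ℕ} {p : Poly q m} (hp : p ∈ homog q m k) :
    toSeries q m p = PowerSeries.monomial k p := by
  induction k generalizing p with
  | zero =>
    obtain ⟨c, rfl⟩ := exists_smul_one hp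
    rw [map_smul, map_one]
    ext n
    rw [PowerSeries.coeff_smul, PowerSeries.coeff_one, PowerSeries.coeff_monomial]
    split_ifs
    · rfl
    · exact smul_zero c
  | succ k ih =>
    refine homog_succ_induction ?_ ?_ ?_ ?_ hp
      (C := fun p => toSeries q m p = PowerSeries.monomial (k + 1) p)
    · simp
    · intro f g hf hg; rw [map_add, map_add, hf, hg]
    · intro r f hf
      rw [map_smul, hf]
      ext n
      rw [PowerSeries.coeff_smul, PowerSeries.coeff_monomial, PowerSeries.coeff_monomial]
      split_ifs
      · rfl
      · exact smul_zero r
    · intro i f hf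
      rw [map_mul, ih hf]
      have : toSeries q m (coord q m i) = PowerSeries.monomial 1 (coord q m i) := by
        simp [toSeries, coord]
      rw [this, PowerSeries.monomial_mul_monomial, add_comm]

theorem component_homog {k : ℕ} {p : Poly q m} (hp : p ∈ homog q m k) (n : ℕ) :
    component n p = if n = k then p else 0 := by
  change PowerSeries.coeff n (toSeries q m p) = _
  rw [toSeries_homog hp, PowerSeries.coeff_monomial]

theorem component_mem (k : ℕ) (p : Poly q m) : component k p ∈ homog q m k := by
  induction p using homog_induction with
  | add f g hf hg => rw [map_add]; exact Submodule.add_mem _ hf hg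
  | homog n f hf =>
    rw [component_homog hf]
    split_ifs with h
    · rwa [h]
    · exact Submodule.zero_mem _

theorem exists_sum_component (p : Poly q m) :
    ∃ N, ∀ n, N ≤ n → p = ∑ k ∈ Finset.range n, component k p := by
  induction p using homog_induction with
  | add f g hf hg =>
    obtain ⟨N, hN⟩ := hf
    obtain ⟨N', hN'⟩ := hg
    refine ⟨max N N', fun n hn => ?_⟩
    simp only [map_add, Finset.sum_add_distrib]
    rw [← hN n (le_of_max_le_left hn), ← hN' n (le_of_max_le_right hn)]
  | homog k f hf =>
    refine ⟨k + 1, fun n hn => ?_⟩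
    simp only [component_homog hf]
    rw [Finset.sum_ite_eq' (Finset.range n) k, if_pos (Finset.mem_range.2 hn)]

theorem pderiv_component (hq : 0 < q) (i : Fin m) (k : ℕ) (p : Poly q m) :
    pderiv q m i (component (k + 1) p) = component k (pderiv q m i p) := by
  induction p using homog_induction with
  | add f g hf hg => simp only [map_add, hf, hg]
  | homog n f hf =>
    rw [component_homog hf]
    cases n with
    | zero => rw [pderiv_of_mem_zero hq i hf]; simp
    | succ n =>
      rw [component_homog (pderiv_mem_homog hq hf i)]
      by_cases h : k = n
      · simp [h]
      · simp [h]

theorem evalZero_component (p : Poly q m) : evalZero q m (component 0 p) = evalZero q m p := by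
  induction p using homog_induction with
  | add f g hf hg => simp only [map_add, hf, hg]
  | homog n f hf =>
    rw [component_homog hf]
    cases n with
    | zero => simp
    | succ n => rw [evalZero_homog_succ hf]; simp

theorem eq_zero_of_evalZero_of_pderiv (hq : 0 < q) (hq1 : q < 1) {p : Poly q m}
    (h0 : evalZero q m p = 0) (h : ∀ i, pderiv q m i p = 0) : p = 0 := by
  obtain ⟨N, hN⟩ := exists_sum_component p
  rw [hN N le_rfl]
  refine Finset.sum_eq_zero fun k _ => ?_
  cases k with
  | zero =>
    obtain ⟨c, hc⟩ := exists_smul_one (component_mem 0 p)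
    have := evalZero_component p
    rw [h0, hc, map_smul, map_one, smul_eq_mul, mul_one] at this
    rw [hc, this, zero_smul]
  | succ k =>
    exact eq_zero_of_pderiv_eq_zero hq hq1 (component_mem _ p) fun i => by
      rw [pderiv_component hq, h, map_zero]

theorem eq_zero_of_map_evalZero_of_map_pderiv (hq : 0 < q) (hq1 : q < 1)
    {d : Poly q m ⊗[ℂ] Poly q m}
    (h0 : TensorProduct.map (evalZero q m).toLinearMap LinearMap.id d = 0)
    (h : ∀ i, TensorProduct.map (pderiv q m i) LinearMap.id d = 0) : d = 0 := by
  let F : Poly q m →ₗ[ℂ] ℂ × (Fin m → Poly q m) :=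
    (evalZero q m).toLinearMap.prod (LinearMap.pi (pderiv q m))
  have hF : LinearMap.ker F = ⊥ := by
    rw [LinearMap.ker_eq_bot']
    intro p hp
    rw [Prod.ext_iff] at hp
    exact eq_zero_of_evalZero_of_pderiv hq hq1 hp.1 fun i => congrFun hp.2 i
  obtain ⟨G, hG⟩ := LinearMap.exists_leftInverse_of_injective F hF
  have h1 : (LinearMap.id : Poly q m →ₗ[ℂ] Poly q m)
      = (G ∘ₗ LinearMap.inl ℂ ℂ (Fin m → Poly q m)) ∘ₗ (evalZero q m).toLinearMap
        + ∑ i, (G ∘ₗ LinearMap.inr ℂ ℂ (Fin m → Poly q m) ∘ₗ LinearMap.single ℂ _ i) ∘ₗ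
            pderiv q m i := by
    rw [← hG]
    ext1 p
    have h2 : F p = LinearMap.inl ℂ ℂ (Fin m → Poly q m) (evalZero q m p)
        + LinearMap.inr ℂ ℂ (Fin m → Poly q m) (∑ i, LinearMap.single ℂ (fun _ => Poly q m) i
          (pderiv q m i p)) := by
      refine Prod.ext ?_ (funext fun i => ?_)
      · change evalZero q m p = evalZero q m p + 0
        rw [add_zero]
      · change pderiv q m i p
          = 0 + (∑ j, LinearMap.single ℂ (fun _ => Poly q m) j (pderiv q m j p)) i
        rw [zero_add, Finset.sum_apply]
        simp [Pi.single_apply]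
    rw [LinearMap.comp_apply, h2, map_add, map_sum, map_sum]
    simp
  have h2 : TensorProduct.map (LinearMap.id : Poly q m →ₗ[ℂ] Poly q m)
      (LinearMap.id : Poly q m →ₗ[ℂ] Poly q m) d = d := by
    rw [TensorProduct.map_id]; rfl
  have h3 (f : ℂ →ₗ[ℂ] Poly q m) : TensorProduct.map (f ∘ₗ (evalZero q m).toLinearMap)
      (LinearMap.id : Poly q m →ₗ[ℂ] Poly q m) d = 0 := by
    rw [← LinearMap.id_comp (LinearMap.id : Poly q m →ₗ[ℂ] Poly q m), TensorProduct.map_comp,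
      LinearMap.comp_apply, h0, map_zero]
  have h4 (i) (f : Poly q m →ₗ[ℂ] Poly q m) : TensorProduct.map (f ∘ₗ pderiv q m i)
      (LinearMap.id : Poly q m →ₗ[ℂ] Poly q m) d = 0 := by
    rw [← LinearMap.id_comp (LinearMap.id : Poly q m →ₗ[ℂ] Poly q m), TensorProduct.map_comp,
      LinearMap.comp_apply, h, map_zero]
  have h5 (f : Fin m → (Poly q m →ₗ[ℂ] Poly q m)) (hf : ∀ i, TensorProduct.map (f i)
      (LinearMap.id : Poly q m →ₗ[ℂ] Poly q m) d = 0) (s : Finset (Fin m)) :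
      TensorProduct.map (∑ i ∈ s, f i) (LinearMap.id : Poly q m →ₗ[ℂ] Poly q m) d = 0 := by
    classical
    induction s using Finset.induction_on with
    | empty => simp
    | insert a s ha ih =>
      rw [Finset.sum_insert ha, TensorProduct.map_add_left, LinearMap.add_apply, hf, ih, add_zero]
  rw [← h2]
  conv_lhs => enter [1, 1]; rw [h1]
  rw [TensorProduct.map_add_left, LinearMap.add_apply, h3, h5 _ fun i => h4 i _,
    add_zero]

theorem IsKernel.unique (hq : 0 < q) (hq1 : q < 1) {e e' : ℕ → Poly q m ⊗[ℂ] Poly q m}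
    (h : IsKernel q m e) (h' : IsKernel q m e') : e = e' := by
  funext l
  induction l with
  | zero =>
    rw [← sub_eq_zero]
    refine eq_zero_of_map_evalZero_of_map_pderiv hq hq1 ?_ fun i => ?_
    · rw [map_sub, h.2.2, h'.2.2, sub_self]
    · rw [map_sub, h.1, h'.1, sub_self]
  | succ l ih =>
    rw [← sub_eq_zero]
    refine eq_zero_of_map_evalZero_of_map_pderiv hq hq1 ?_ fun i => ?_
    · rw [map_sub, h.2.2, h'.2.2, sub_self]
    · rw [map_sub, h.2.1, h'.2.1, ih, sub_self]

/-- The pairing `⟨p, r⟩ = (p(∂) r)(0)` of polynomials. -/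
noncomputable def pairing (hq : 0 < q) : Poly q m →ₗ[ℂ] Poly q m →ₗ[ℂ] ℂ :=
  LinearMap.mk₂ ℂ (fun p r => evalZero q m (evalOp r (diffOp hq p)))
    (fun p p' r => by rw [map_add, map_add, map_add])
    (fun c p r => by rw [map_smul, evalOp_smul, map_smul])
    (fun p r r' => by rw [evalOp_add_left, map_add])
    (fun c p r => by rw [evalOp_smul_left, map_smul])

theorem pairing_apply (hq : 0 < q) (p r : Poly q m) :
    pairing hq p r = evalZero q m (evalOp r (diffOp hq p)) := rfl

theorem pairing_one (hq : 0 < q) (r : Poly q m) : pairing hq 1 r = evalZero q m r := by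
  rw [pairing_apply, map_one, evalOp_one]

theorem diffOp_coord (hq : 0 < q) (i : Fin m) : diffOp hq (coord q m i) = derivOp q m i :=
  polyLift_coord _ _ _ _

theorem pairing_mul_coord (hq : 0 < q) (p r : Poly q m) (i : Fin m) :
    pairing hq (p * coord q m i) r = pairing hq p (pderiv q m i r) := by
  rw [pairing_apply, map_mul, diffOp_coord]; rfl

/-- The pairing is nondegenerate in each degree. -/
theorem eq_zero_of_pairing (hq : 0 < q) (hq1 : q < 1) {k : ℕ} {r : Poly q m}
    (hr : r ∈ homog q m k) (h : ∀ p ∈ homog q m k, pairing hq p r = 0) : r = 0 := by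
  induction k generalizing r with
  | zero =>
    obtain ⟨c, rfl⟩ := exists_smul_one hr
    have := h 1 one_mem_homog
    rw [pairing_one, map_smul, map_one, smul_eq_mul, mul_one] at this
    rw [this, zero_smul]
  | succ k ih =>
    refine eq_zero_of_pderiv_eq_zero hq hq1 hr fun i => ih (pderiv_mem_homog hq hr i) fun p hp => ?_
    rw [← pairing_mul_coord]
    exact h _ (mul_mem_homog hp (coord_mem_homog i))

instance (k : ℕ) : FiniteDimensional ℂ (homog q m k) :=
  Module.Finite.iff_fg.2 ((Submodule.fg_span (Set.finite_range _)).pow k)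

theorem exists_dual_bases_of_nondegenerate {V : Type*} [AddCommGroup V] [Module ℂ V]
    [FiniteDimensional ℂ V] (B : V →ₗ[ℂ] V →ₗ[ℂ] ℂ) (hB : ∀ r, (∀ p, B p r = 0) → r = 0) :
    ∃ (n : ℕ) (p r : Fin n → V), (∀ f, f = ∑ c, B f (r c) • p c) ∧
      ∀ f, f = ∑ c, B (p c) f • r c := by
  have hB' : Function.Injective B.flip := by
    rw [← LinearMap.ker_eq_bot, LinearMap.ker_eq_bot']
    exact fun r hr => hB r fun p => LinearMap.congr_fun hr p
  let Φ := LinearMap.linearEquivOfInjective B.flip hB' Subspace.dual_finrank_eq.symm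
  have hΦ (r p : V) : Φ r p = B p r := rfl
  let b := Module.finBasis ℂ V
  refine ⟨_, b, fun c => Φ.symm (b.coord c), fun f => ?_, fun f => Φ.injective ?_⟩
  · have h1 (c) : B f (Φ.symm (b.coord c)) = b.repr f c := by
      rw [← hΦ, LinearEquiv.apply_symm_apply]; rfl
    simp only [h1]
    exact (b.sum_repr f).symm
  · ext p
    simp only [map_sum, map_smul, LinearEquiv.apply_symm_apply, LinearMap.sum_apply,
      LinearMap.smul_apply, smul_eq_mul, hΦ]
    conv_lhs => rw [← b.sum_repr p]
    simp only [map_sum, map_smul, LinearMap.sum_apply, LinearMap.smul_apply, smul_eq_mul]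
    exact Finset.sum_congr rfl fun c _ => mul_comm _ _

/-- Dual bases of the homogeneous polynomials for the pairing. -/
theorem exists_dual_bases (hq : 0 < q) (hq1 : q < 1) (k : ℕ) :
    ∃ (n : ℕ) (p r : Fin n → Poly q m), (∀ c, p c ∈ homog q m k) ∧ (∀ c, r c ∈ homog q m k) ∧
      (∀ f ∈ homog q m k, f = ∑ c, pairing hq f (r c) • p c) ∧
      ∀ f ∈ homog q m k, f = ∑ c, pairing hq (p c) f • r c := by
  obtain ⟨n, p, r, h1, h2⟩ := exists_dual_bases_of_nondegenerate
    (V := homog q m k) ((pairing hq).domRestrict₁₂ (homog q m k) (homog q m k))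
    fun r hr => Subtype.ext (eq_zero_of_pairing hq hq1 r.2 fun p hp => hr ⟨p, hp⟩)
  refine ⟨n, fun c => p c, fun c => r c, fun c => (p c).2, fun c => (r c).2,
    fun f hf => ?_, fun f hf => ?_⟩
  · have := congrArg Subtype.val (h1 ⟨f, hf⟩)
    simp only [Submodule.coe_sum, Submodule.coe_smul] at this
    exact this
  · have := congrArg Subtype.val (h2 ⟨f, hf⟩)
    simp only [Submodule.coe_sum, Submodule.coe_smul] at this
    exact this

/-- The components of the Fourier kernel are the canonical elements of the pairing. -/
theorem isKernel_of_dual_bases (hq : 0 < q) {n : ℕ → ℕ} {p r : ∀ k, Fin (n k) → Poly q m}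
    (hp : ∀ k c, p k c ∈ homog q m k) (hr : ∀ k c, r k c ∈ homog q m k)
    (h1 : ∀ k, ∀ f ∈ homog q m k, f = ∑ c, pairing hq f (r k c) • p k c)
    (h2 : ∀ k, ∀ f ∈ homog q m k, f = ∑ c, pairing hq (p k c) f • r k c) :
    IsKernel q m fun k => ∑ c, r k c ⊗ₜ[ℂ] p k c := by
  refine ⟨fun j => ?_, fun l j => ?_, fun l => ?_⟩
  · rw [map_sum]
    refine Finset.sum_eq_zero fun c _ => ?_
    rw [TensorProduct.map_tmul, pderiv_of_mem_zero hq j (hr 0 c), TensorProduct.zero_tmul]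
  · rw [map_sum, Finset.sum_mul]
    simp only [TensorProduct.map_tmul, LinearMap.id_apply, Algebra.TensorProduct.tmul_mul_tmul,
      mul_one]
    -- The partial derivatives are adjoint to the multiplication by the coordinates from the right.
    have h3 (c) : pderiv q m j (r (l + 1) c)
        = ∑ d, pairing hq (p l d * coord q m j) (r (l + 1) c) • r l d := by
      simp only [pairing_mul_coord]
      exact h2 l _ (pderiv_mem_homog hq (hr _ c) j)
    have h4 (d) : p l d * coord q m j
        = ∑ c, pairing hq (p l d * coord q m j) (r (l + 1) c) • p (l + 1) c :=
      h1 (l + 1) _ (mul_mem_homog (hp l d) (coord_mem_homog j))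
    calc _ = ∑ c, ∑ d, pairing hq (p l d * coord q m j) (r (l + 1) c) •
          (r l d ⊗ₜ[ℂ] p (l + 1) c) := Finset.sum_congr rfl fun c _ => by
            rw [h3, TensorProduct.sum_tmul]
            simp only [TensorProduct.smul_tmul']
      _ = _ := by
        rw [Finset.sum_comm]
        refine Finset.sum_congr rfl fun d _ => ?_
        conv_rhs => rw [h4, TensorProduct.tmul_sum]
        simp only [TensorProduct.tmul_smul]
  · rw [map_sum]
    simp only [TensorProduct.map_tmul, LinearMap.id_apply, AlgHom.toLinearMap_apply]
    split_ifs with h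
    · subst h
      conv_rhs => rw [h1 0 1 one_mem_homog, TensorProduct.tmul_sum]
      refine Finset.sum_congr rfl fun c _ => ?_
      rw [pairing_one, ← TensorProduct.smul_tmul, smul_eq_mul, mul_one]
    · obtain ⟨l, rfl⟩ := Nat.exists_eq_succ_of_ne_zero h
      refine Finset.sum_eq_zero fun c _ => ?_
      rw [evalZero_homog_succ (hr _ c), TensorProduct.zero_tmul]

theorem exists_isKernel (hq : 0 < q) (hq1 : q < 1) : ∃ e, IsKernel q m e := by
  choose n p r hp hr h1 h2 using exists_dual_bases (q := q) (m := m) hq hq1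
  exact ⟨_, isKernel_of_dual_bases hq hp hr h1 h2⟩

theorem existsUnique_isKernel (hq : 0 < q) (hq1 : q < 1) : ∃! e, IsKernel q m e :=
  let ⟨e, he⟩ := exists_isKernel hq hq1
  ⟨e, he, fun _ h => h.unique hq hq1 he⟩

/-- The application of the linear functionals `⟨p, ·⟩` to the first factor of the kernel
reproduces `p`. -/
theorem contract_kernel (hq : 0 < q) (hq1 : q < 1) (k : ℕ) {φ : Poly q m → ℂ}
    (hφ : IsLinearMap ℂ φ) {p : Poly q m} (hp : p ∈ homog q m k)
    (h : ∀ r ∈ homog q m k, φ r = pairing hq p r) : contract q m φ (kernel q m k) = p := by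
  choose n b r hb hr h1 h2 using exists_dual_bases (q := q) (m := m) hq hq1
  have h3 : kernel q m = fun k => ∑ c, r k c ⊗ₜ[ℂ] b k c :=
    (Classical.epsilon_spec (exists_isKernel hq hq1)).unique hq hq1
      (isKernel_of_dual_bases hq hb hr h1 h2)
  rw [h3, contract, dif_pos hφ]
  simp only [map_sum, LinearMap.comp_apply, TensorProduct.map_tmul, LinearEquiv.coe_coe,
    TensorProduct.lid_tmul, LinearMap.id_apply, IsLinearMap.mk'_apply]
  conv_rhs => rw [h1 k p hp]
  exact Finset.sum_congr rfl fun c _ => by rw [h _ (hr k c)]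

end Pairing

/-! ### Traceless symmetric tensors -/

section Swap
variable {q : ℝ} {m : ℕ}

/-- The braid matrix preserves the weight `ρ_a + ρ_b` of a pair of indices. -/
theorem rho_add_eq_or_braid_eq_zero (p r : Fin m × Fin m) :
    rho m p.1 + rho m p.2 = rho m r.1 + rho m r.2 ∨ braid q m p r = 0 := by
  obtain ⟨a, b⟩ := p
  obtain ⟨c, d⟩ := r
  by_cases h1 : a = d ∧ b = c
  · obtain ⟨rfl, rfl⟩ := h1; exact Or.inl (add_comm _ _)
  by_cases h2 : a < b ∧ (a, b) = (c, d)
  · rw [h2.2]; exact Or.inl rfl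
  by_cases h3 : a < d ∧ a = b.rev ∧ c = d.rev
  · obtain ⟨-, rfl, rfl⟩ := h3
    left; simp [rho_rev]
  · right
    simp only [braid, if_neg h1, if_neg h2, if_neg h3]; ring

variable {A : Type*} [Ring A] [Module ℝ A] [IsScalarTower ℝ A A] [SMulCommClass ℝ A A]

/-- Both indices lowered with the metric. -/
noncomputable def lower (q : ℝ) (B : Fin m → Fin m → A) : Fin m → Fin m → A :=
  fun i k => (q ^ (-rho m i) * q ^ (-rho m k)) • B k.rev i.rev

theorem rop_lower (hq : 0 < q) (B : Fin m → Fin m → A) :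
    rop q m (lower q B) = lower q (rop q m B) := by
  ext a b
  have h1 : rop q m (lower q B) a b
      = (q ^ (-rho m a) * q ^ (-rho m b)) • rop q m (fun a b => B b.rev a.rev) a b := by
    simp only [rop, LinearMap.coe_mk, AddHom.coe_mk, Finset.smul_sum]
    refine Finset.sum_congr rfl fun p _ => ?_
    rcases rho_add_eq_or_braid_eq_zero (q := q) (a, b) p with h | h
    · simp only at h
      rw [lower, ← Real.rpow_add hq, ← Real.rpow_add hq, ← neg_add, ← neg_add, h,
        smul_comm]
    · rw [h, zero_smul, zero_smul, smul_zero]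
  rw [h1, rop_flip]
  rfl

theorem cap_lower (hq : 0 < q) (B : Fin m → Fin m → A) : cap q m (lower q B) = cap q m B := by
  rw [cap_apply, cap_apply]
  refine Finset.sum_congr rfl fun a _ => ?_
  rw [lower, Fin.rev_rev, rho_rev, ← Real.rpow_add hq]
  simp

theorem sum_rop_mul_eq (f g : Fin m → Fin m → A) :
    ∑ a, ∑ b, rop q m f a b * g a b = ∑ a, ∑ b, f a b * rop q m g a b := by
  have h (f g : Fin m → Fin m → A) : ∑ a, ∑ b, rop q m f a b * g a b =
      ∑ p : Fin m × Fin m, ∑ r : Fin m × Fin m, braid q m p r • (f r.1 r.2 * g p.1 p.2) := by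
    rw [Fintype.sum_prod_type]
    simp only [rop, LinearMap.coe_mk, AddHom.coe_mk, Finset.sum_mul, smul_mul_assoc]
  have h' (f g : Fin m → Fin m → A) : ∑ a, ∑ b, f a b * rop q m g a b =
      ∑ p : Fin m × Fin m, ∑ r : Fin m × Fin m, braid q m p r • (f p.1 p.2 * g r.1 r.2) := by
    rw [Fintype.sum_prod_type]
    simp only [rop, LinearMap.coe_mk, AddHom.coe_mk, Finset.mul_sum, mul_smul_comm]
  rw [h, h', Finset.sum_comm]
  refine Finset.sum_congr rfl fun p _ => Finset.sum_congr rfl fun r _ => ?_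
  rw [braid_symm]

theorem sum_cup_mul (x : A) (g : Fin m → Fin m → A) :
    ∑ a, ∑ b, cup q m x a b * g a b = x * cap q m g := by
  simp only [cap, cup, LinearMap.coe_mk, AddHom.coe_mk, Fintype.sum_prod_type, Finset.mul_sum,
    smul_mul_assoc, mul_smul_comm]

/-- Coordinates and partial derivatives commute when they are contracted with a traceless
symmetric tensor. -/
theorem sum_deriv_mul_coord_mul (hq : 0 < q) {X D : Fin m → A}
    (h : ten2 D X = cup q m 1 + q • rinv q m (ten2 X D)) {B : Fin m → Fin m → A}
    (hB : rop q m B = q • B) (hB0 : cap q m B = 0) :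
    ∑ i, ∑ k, D i * X k * lower q B i k = ∑ i, ∑ k, X i * D k * lower q B i k := by
  have h1 : ∑ i, ∑ k, D i * X k * lower q B i k
      = ∑ i, ∑ k, (cup q m 1 i k * lower q B i k
        + q • (rop q m (ten2 X D) i k * lower q B i k
          - (q - q⁻¹) • (ten2 X D i k * lower q B i k
            - cup q m (cap q m (ten2 X D)) i k * lower q B i k))) := by
    refine Finset.sum_congr rfl fun i _ => Finset.sum_congr rfl fun k _ => ?_
    have := congrFun (congrFun h i) k
    simp only [rinv_apply', Pi.add_apply, Pi.smul_apply, Pi.sub_apply] at this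
    change ten2 D X i k * _ = _
    rw [this, add_mul, smul_mul_assoc, sub_mul, smul_mul_assoc, sub_mul]
  rw [h1]
  simp only [Finset.sum_add_distrib, ← Finset.smul_sum, Finset.sum_sub_distrib, sum_cup_mul,
    sum_rop_mul_eq, rop_lower hq, hB, cap_lower hq, hB0]
  have h2 : lower q (q • B) = q • lower q B := by
    ext i k; simp [lower, smul_comm q]
  simp only [h2, Pi.smul_apply, mul_smul_comm, ← Finset.smul_sum]
  have h3 : q * (q - (q - q⁻¹)) = 1 := by field_simp; ring
  rw [mul_zero, mul_zero, sub_zero, zero_add, ← sub_smul, smul_smul, h3, one_smul]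
  rfl

end Swap

/-! ### Powers of the Laplace operator at the origin -/

section Polar
variable {q : ℝ} {m : ℕ}

/-- The operator `S ↦ C_{ij} Y^i L(∂^j S)`. -/
noncomputable def polar (q : ℝ) {m : ℕ} (Y : Fin m → Op q m) (L : Poly q m →ₗ[ℂ] Op q m) :
    Poly q m →ₗ[ℂ] Op q m :=
  ∑ i, ((q ^ (-rho m i) : ℝ) : ℂ) • (LinearMap.mulLeft ℂ (Y i) ∘ₗ L ∘ₗ pderiv q m i.rev)

theorem polar_apply (Y : Fin m → Op q m) (L : Poly q m →ₗ[ℂ] Op q m) (S : Poly q m) :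
    polar q Y L S = ∑ i, ((q ^ (-rho m i) : ℝ) : ℂ) • (Y i * L (pderiv q m i.rev S)) := by
  simp only [polar, LinearMap.sum_apply, LinearMap.smul_apply, LinearMap.comp_apply,
    LinearMap.mulLeft_apply]

/-- On harmonic polynomials the polarizations with respect to the coordinates and to the partial
derivatives commute, since the Hessian of a harmonic polynomial is symmetric and traceless. -/
theorem polar_deriv_polar_coord (hq : 0 < q) (L : Poly q m →ₗ[ℂ] Op q m) {S : Poly q m}
    (hS : laplace q m S = 0) :
    polar q (derivOp q m) (polar q (coordOp q m) L) S
      = polar q (coordOp q m) (polar q (derivOp q m) L) S := by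
  let B : Fin m → Fin m → Op q m := fun a b => L (pderiv q m a (pderiv q m b S))
  have key (Y Z : Fin m → Op q m) :
      polar q Y (polar q Z L) S = ∑ i, ∑ k, Y i * Z k * lower q B i k := by
    simp only [polar_apply, Finset.mul_sum, Finset.smul_sum, lower]
    refine Finset.sum_congr rfl fun i _ => Finset.sum_congr rfl fun k _ => ?_
    rw [mul_smul_comm, smul_smul, ← Complex.ofReal_mul, Complex.coe_smul, mul_smul_comm, mul_assoc]
  have h1 : (fun a b => evalOp S (ten2 (derivOp q m) (derivOp q m) a b))
      = fun a b => pderiv q m a (pderiv q m b S) := rfl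
  have h2 : rop q m (fun a b => pderiv q m a (pderiv q m b S))
      = q • fun a b => pderiv q m a (pderiv q m b S) := by
    ext1 a
    ext1 b
    have h3 := congrArg (evalOp S) (congrFun (congrFun
      ((isVector_iff hq).1 (isVector_derivOp (m := m) hq)) a) b)
    rw [map_rop, h1] at h3
    rw [h3, ← laplace_eq_dot]
    rw [Pi.sub_apply, Pi.sub_apply, map_sub, Pi.smul_apply, Pi.smul_apply, Pi.smul_apply,
      Pi.smul_apply, map_smul, map_smul, map_cup, evalOp_toOp, hS, map_zero, Pi.zero_apply,
      Pi.zero_apply, smul_zero, sub_zero]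
    rfl
  have h4 : cap q m (fun a b => pderiv q m a (pderiv q m b S)) = 0 := by
    rw [← h1, ← map_cap, ← hS, ← evalOp_toOp, laplace_eq_dot]; rfl
  rw [key, key]
  refine sum_deriv_mul_coord_mul hq (cross_derivOp hq) ?_ ?_
  · ext1 a
    ext1 b
    have := map_rop (q := q) (L.restrictScalars ℝ)
      (fun a b => pderiv q m a (pderiv q m b S)) a b
    rw [h2] at this
    exact this.symm.trans ((L.restrictScalars ℝ).map_smul q _)
  · have := map_cap (q := q) (L.restrictScalars ℝ) (fun a b => pderiv q m a (pderiv q m b S))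
    rw [h4, map_zero] at this
    exact this.symm

theorem pderiv_mem_harmonics (hq : 0 < q) {k : ℕ} {S : Poly q m}
    (hS : S ∈ harmonics q m (k + 1)) (i : Fin m) : pderiv q m i S ∈ harmonics q m k := by
  refine ⟨pderiv_mem_homog hq hS.1 i, ?_⟩
  change laplace q m _ = 0
  rw [← pderiv_laplace hq, show laplace q m S = 0 from hS.2, map_zero]

theorem laplace_pderiv_eq_zero (hq : 0 < q) {S : Poly q m} (hS : laplace q m S = 0) (i : Fin m) :
    laplace q m (pderiv q m i S) = 0 := by
  rw [← pderiv_laplace hq, hS, map_zero]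

theorem polar_deriv_iterate (hq : 0 < q) (L : Poly q m →ₗ[ℂ] Op q m) (a : ℕ) {S : Poly q m}
    (hS : laplace q m S = 0) :
    polar q (derivOp q m) ((polar q (coordOp q m))^[a] L) S
      = (polar q (coordOp q m))^[a] (polar q (derivOp q m) L) S := by
  induction a generalizing S with
  | zero => rfl
  | succ a ih =>
    rw [Function.iterate_succ_apply', Function.iterate_succ_apply',
      polar_deriv_polar_coord hq _ hS, polar_apply, polar_apply]
    refine Finset.sum_congr rfl fun i _ => ?_
    rw [ih (laplace_pderiv_eq_zero hq hS _)]

/-- The value at the origin, as a multiple of the identity operator. -/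
noncomputable def constOp (q : ℝ) (m : ℕ) : Poly q m →ₗ[ℂ] Op q m :=
  (evalZero q m).toLinearMap.smulRight 1

theorem euler_eq_sum_rev (p : Poly q m) :
    euler p = ∑ i, ((q ^ (-rho m i) : ℝ) : ℂ) • (coord q m i * pderiv q m i.rev p) := by
  rw [euler_eq']
  refine Finset.sum_congr rfl fun i _ => ?_
  rw [Finset.sum_eq_single i.rev]
  · simp [metric]
  · intro j _ hj; simp [metric, hj]
  · simp

/-- The `k`-fold polarization of a spherical harmonic `S` of degree `k` is `[k]_{q²}!` times the
value at `S` of the representation that sends `x^i` to `Y^i`. For the coordinates this is the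
multiplication by `S`, and for the partial derivatives the differential operator `S(∂)`. -/
theorem polar_iterate_constOp (hq : 0 < q) (hq1 : q < 1) {Y : Fin m → Op q m}
    (θ : Poly q m →ₗ[ℂ] Op q m) (h1 : θ 1 = 1) (hY : ∀ i f, θ (coord q m i * f) = Y i * θ f)
    {k : ℕ} {S : Poly q m} (hS : S ∈ harmonics q m k) :
    (polar q Y)^[k] (constOp q m) S = (qFactorial (q ^ 2) k : ℂ) • θ S := by
  induction k generalizing S with
  | zero =>
    obtain ⟨c, rfl⟩ := exists_smul_one hS.1
    simp [constOp, qFactorial, h1]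
  | succ k ih =>
    have h2 := euler_homog hq hq1 hS.1
    rw [show laplace q m S = 0 from hS.2, mul_zero, smul_zero, sub_zero, euler_eq_sum_rev] at h2
    rw [Function.iterate_succ_apply', polar_apply, qFactorial_succ, Complex.ofReal_mul, mul_smul,
      ← map_smul, ← h2, map_sum, Finset.smul_sum]
    refine Finset.sum_congr rfl fun i _ => ?_
    rw [ih (pderiv_mem_harmonics hq hS _), map_smul, hY, mul_smul_comm, smul_comm]

/-- The functionals `R ↦ (Δ^t R)(0)`. -/
noncomputable def laplaceEval (q : ℝ) (m t : ℕ) : Poly q m →ₗ[ℂ] ℂ :=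
  (evalZero q m).toLinearMap ∘ₗ (laplace q m ^ t)

theorem laplaceEval_zero_coord_mul (i : Fin m) (p : Poly q m) :
    laplaceEval q m 0 (coord q m i * p) = 0 := evalZero_coord_mul i p

theorem laplace_pow_coord_mul (hq : 0 < q) (hq1 : q < 1) (t : ℕ) (i : Fin m) (p : Poly q m) :
    (laplace q m ^ (t + 1)) (coord q m i * p)
      = ((q ^ (2 * (t + 1)) : ℝ) : ℂ) • (coord q m i * (laplace q m ^ (t + 1)) p)
        + ((mu q m * brk q (t + 1) : ℝ) : ℂ) • (laplace q m ^ t) (pderiv q m i p) := by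
  induction t generalizing p with
  | zero =>
    have := sq_sub_one_ne_zero hq hq1
    rw [zero_add, pow_one, laplace_coord_mul' hq]
    simp only [mul_one, brk, pow_zero, Module.End.one_apply]
    rw [div_self this, mul_one, add_comm]
  | succ t ih =>
    rw [pow_succ, Module.End.mul_apply, laplace_coord_mul' hq, map_add, map_smul, map_smul, ih,
      brk_succ hq hq1 (t + 1)]
    have h1 : (laplace q m ^ t) (laplace q m (pderiv q m i p))
        = (laplace q m ^ (t + 1)) (pderiv q m i p) := by rw [pow_succ]; rfl
    rw [pderiv_laplace hq, h1, Module.End.mul_apply]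
    push_cast
    module

theorem laplaceEval_succ_coord_mul (hq : 0 < q) (hq1 : q < 1) (t : ℕ) (i : Fin m) (p : Poly q m) :
    laplaceEval q m (t + 1) (coord q m i * p)
      = ((mu q m * brk q (t + 1) : ℝ) : ℂ) * laplaceEval q m t (pderiv q m i p) := by
  change evalZero q m _ = _
  rw [laplace_pow_coord_mul hq hq1, map_add, map_smul, map_smul, evalZero_coord_mul, smul_zero,
    zero_add]
  rfl

theorem laplaceEval_zero_polar (L : Poly q m →ₗ[ℂ] Op q m) (S p : Poly q m) :
    laplaceEval q m 0 (evalOp p (polar q (coordOp q m) L S)) = 0 := by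
  rw [polar_apply, map_sum, map_sum]
  refine Finset.sum_eq_zero fun i _ => ?_
  rw [evalOp_smul, map_smul]
  change _ • laplaceEval q m 0 (coord q m i * _) = 0
  rw [laplaceEval_zero_coord_mul, smul_zero]

theorem laplaceEval_succ_polar (hq : 0 < q) (hq1 : q < 1) (t : ℕ) (L : Poly q m →ₗ[ℂ] Op q m)
    (S p : Poly q m) : laplaceEval q m (t + 1) (evalOp p (polar q (coordOp q m) L S))
      = ((mu q m * brk q (t + 1) : ℝ) : ℂ)
        * laplaceEval q m t (evalOp p (polar q (derivOp q m) L S)) := by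
  rw [polar_apply, polar_apply, map_sum, map_sum, map_sum, map_sum, Finset.mul_sum]
  refine Finset.sum_congr rfl fun i _ => ?_
  rw [evalOp_smul, map_smul, evalOp_smul, map_smul, smul_eq_mul, smul_eq_mul, mul_left_comm]
  congr 1
  exact laplaceEval_succ_coord_mul hq hq1 t i _

/-- Under `R ↦ (Δ^t R)(0)` each polarization with respect to the coordinates on the left turns into one
with respect to the partial derivatives, at the expense of a power of `Δ`. -/
theorem laplaceEval_polar_iterate (hq : 0 < q) (hq1 : q < 1) (t a : ℕ)
    (L : Poly q m →ₗ[ℂ] Op q m) {S : Poly q m} (hS : laplace q m S = 0) (p : Poly q m) :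
    laplaceEval q m (t + a) (evalOp p ((polar q (coordOp q m))^[a] L S))
      = ((mu q m ^ a * (qFactorial (q ^ 2) (t + a) / qFactorial (q ^ 2) t) : ℝ) : ℂ)
        * laplaceEval q m t (evalOp p ((polar q (derivOp q m))^[a] L S)) := by
  induction a generalizing L with
  | zero =>
    simp [(qFactorial_pos hq hq1 t).ne']
  | succ a ih =>
    rw [Function.iterate_succ_apply', ← add_assoc, laplaceEval_succ_polar hq hq1,
      polar_deriv_iterate hq _ _ hS, ih, ← Function.iterate_succ_apply, ← mul_assoc,
      ← Complex.ofReal_mul, qFactorial_succ]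
    congr 2
    ring

theorem laplaceEval_polar_iterate_of_lt (hq : 0 < q) (hq1 : q < 1) {t a : ℕ} (ha : t < a)
    (L : Poly q m →ₗ[ℂ] Op q m) {S : Poly q m} (hS : laplace q m S = 0) (p : Poly q m) :
    laplaceEval q m t (evalOp p ((polar q (coordOp q m))^[a] L S)) = 0 := by
  induction t generalizing a L with
  | zero =>
    obtain ⟨b, rfl⟩ := Nat.exists_eq_add_of_lt ha
    rw [Function.iterate_succ_apply', laplaceEval_zero_polar]
  | succ t ih =>
    obtain ⟨b, rfl⟩ := Nat.exists_eq_add_of_lt ha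
    rw [Function.iterate_succ_apply', laplaceEval_succ_polar hq hq1, polar_deriv_iterate hq _ _ hS,
      ih (by omega), mul_zero]

/-- The multiplication operators as a complex linear map. -/
noncomputable def mulOpC (q : ℝ) (m : ℕ) : Poly q m →ₗ[ℂ] Op q m where
  toFun p := mulOp q m p
  map_add' := map_add _
  map_smul' c f := op_ext fun p => by
    change (c • f) * p = c • (f * p)
    exact smul_mul_assoc _ _ _

theorem mulOpC_one : mulOpC q m 1 = 1 := op_ext fun p => by
  change (1 : Poly q m) * p = p
  exact one_mul p

/-- The functional `R ↦ (Δ^{j+k} R)(0)` on the products `S r` with a spherical harmonic `S` of degree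
`k` is a multiple of the pairing with `x^{2j} S`. -/
theorem laplaceEval_harmonic_mul (hq : 0 < q) (hq1 : q < 1) {k : ℕ} {S : Poly q m}
    (hS : S ∈ harmonics q m k) (j : ℕ) (r : Poly q m) : laplaceEval q m (j + k) (S * r)
      = ((mu q m ^ k * (qFactorial (q ^ 2) (j + k) / qFactorial (q ^ 2) j) : ℝ) : ℂ)
        * pairing hq (normSq q m ^ j * S) r := by
  have h1 := laplaceEval_polar_iterate hq hq1 j k (constOp q m) (S := S) hS.2 r
  rw [polar_iterate_constOp hq hq1 (Y := coordOp q m) (mulOpC q m) mulOpC_one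
    (fun i f => mulOp_mul _ _) hS,
    polar_iterate_constOp hq hq1 (diffOp hq).toLinearMap (map_one (diffOp hq))
    (fun i f => by rw [AlgHom.toLinearMap_apply, map_mul, diffOp_coord]; rfl) hS, evalOp_smul,
    map_smul, evalOp_smul, map_smul, smul_eq_mul, smul_eq_mul, mul_left_comm] at h1
  have h2 : (qFactorial (q ^ 2) k : ℂ) ≠ 0 := by exact_mod_cast (qFactorial_pos hq hq1 k).ne'
  have h3 := mul_left_cancel₀ h2 h1
  have h4 : diffOp hq (normSq q m) = toOp (laplace q m) := by
    rw [laplace_eq_dot, dot_eq, normSq, map_sum]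
    refine Finset.sum_congr rfl fun a _ => ?_
    rw [map_sum]
    refine Finset.sum_congr rfl fun b _ => ?_
    rw [map_smul, map_mul, diffOp_coord, diffOp_coord, Complex.coe_smul]
  have h5 (p : Poly q m) (n : ℕ) : evalOp p (toOp (laplace q m) ^ n) = (laplace q m ^ n) p := by
    induction n generalizing p with
    | zero => rfl
    | succ n ih => rw [pow_succ, pow_succ, evalOp_mul, ih]; rfl
  rw [pairing_apply, map_mul (diffOp hq), map_pow, h4, evalOp_mul, h5]
  exact h3

theorem laplaceEval_harmonic_mul_of_lt (hq : 0 < q) (hq1 : q < 1) {k t : ℕ} (ht : t < k)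
    {S : Poly q m} (hS : S ∈ harmonics q m k) (r : Poly q m) :
    laplaceEval q m t (S * r) = 0 := by
  have h1 := laplaceEval_polar_iterate_of_lt hq hq1 ht (constOp q m) (S := S) hS.2 r
  rw [polar_iterate_constOp hq hq1 (Y := coordOp q m) (mulOpC q m) mulOpC_one
    (fun i f => mulOp_mul _ _) hS, evalOp_smul, map_smul, smul_eq_mul] at h1
  have h2 : (qFactorial (q ^ 2) k : ℂ) ≠ 0 := by exact_mod_cast (qFactorial_pos hq hq1 k).ne'
  exact (mul_eq_zero.1 h1).resolve_left h2

theorem laplaceEval_homog (hq : 0 < q) {n t : ℕ} (hn : n ≠ 2 * t) {p : Poly q m}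
    (hp : p ∈ homog q m n) : laplaceEval q m t p = 0 := by
  induction t generalizing n p with
  | zero =>
    obtain ⟨n, rfl⟩ := Nat.exists_eq_succ_of_ne_zero hn
    exact evalZero_homog_succ hp
  | succ t ih =>
    have h1 : laplaceEval q m (t + 1) p = laplaceEval q m t (laplace q m p) := by
      simp only [laplaceEval, pow_succ]; rfl
    rw [h1]
    rcases Nat.lt_or_ge n 2 with h | h
    · rw [laplace_of_mem_one hq (by omega) hp, map_zero]
    · obtain ⟨n, rfl⟩ := Nat.exists_eq_add_of_le' h
      exact ih (by omega) (laplace_mem_homog hq hp)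

end Polar
end QEuclid

namespace QCalc
open Filter

/-! ### The `q`-Gamma function -/

section Gamma
variable {p : ℝ}

theorem summable_mul_pow_of_lt_one (hp : 0 < p) (hp1 : p < 1) (u : ℝ) :
    Summable fun k : ℕ => u * p ^ k :=
  (summable_geometric_of_lt_one hp.le hp1).mul_left u

theorem multipliable_qPochInf (hp : 0 < p) (hp1 : p < 1) (u : ℝ) :
    Multipliable fun k : ℕ => 1 - u * p ^ k := by
  have h := Real.multipliable_one_add_of_summable (summable_mul_pow_of_lt_one hp hp1 u).neg
  simpa [sub_eq_add_neg] using h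

theorem qPochInf_eq_mul (hp : 0 < p) (hp1 : p < 1) (u : ℝ) :
    qPochInf p u = (1 - u) * qPochInf p (u * p) := by
  have h := multipliable_qPochInf hp hp1 (u * p)
  rw [qPochInf, tprod_eq_zero_mul', qPochInf]
  · simp only [pow_zero, mul_one, pow_succ']
    congr 1
    refine tprod_congr fun k => ?_
    ring
  · refine h.congr fun k => ?_
    rw [pow_succ']; ring

theorem qPochInf_pos (hp : 0 < p) (hp1 : p < 1) {u : ℝ} (hu : u < 1) (hu0 : 0 ≤ u) :
    0 < qPochInf p u := by
  have h1 : ∀ k : ℕ, 0 < 1 - u * p ^ k := fun k => by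
    have : u * p ^ k ≤ u * 1 := mul_le_mul_of_nonneg_left (pow_le_one₀ hp.le hp1.le) hu0
    linarith
  have h2 := Real.summable_log_one_add_of_summable (summable_mul_pow_of_lt_one hp hp1 u).neg
  rw [qPochInf, ← Real.rexp_tsum_eq_tprod h1 (by simpa [sub_eq_add_neg] using h2)]
  exact Real.exp_pos _

theorem tendsto_prod_qPochInf (hp : 0 < p) (hp1 : p < 1) (u : ℝ) :
    Tendsto (fun n => ∏ k ∈ Finset.range n, (1 - u * p ^ k)) atTop (𝓝 (qPochInf p u)) :=
  (multipliable_qPochInf hp hp1 u).tendsto_prod_tprod_nat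

theorem qGamma_pos (hp : 0 < p) (hp1 : p < 1) {t : ℝ} (ht : 0 < t) : 0 < qGamma p t := by
  have h1 := qPochInf_pos hp hp1 hp1 hp.le
  have h2 := qPochInf_pos hp hp1 (Real.rpow_lt_one hp.le hp1 ht) (Real.rpow_pos_of_pos hp t).le
  have h3 : 0 < 1 - p := by linarith
  unfold qGamma
  positivity

theorem qGamma_add_one (hp : 0 < p) (hp1 : p < 1) {t : ℝ} (ht : 0 < t) :
    qGamma p (t + 1) = (p ^ t - 1) / (p - 1) * qGamma p t := by
  have h2 := qPochInf_pos hp hp1 (Real.rpow_lt_one hp.le hp1 ht) (Real.rpow_pos_of_pos hp t).le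
  have h3 : 0 < 1 - p := by linarith
  have h4 := Real.rpow_lt_one hp.le hp1 ht
  have h5 := qPochInf_eq_mul hp hp1 (p ^ t)
  have h6 : qPochInf p (p ^ t * p) ≠ 0 := by
    rintro h; rw [h, mul_zero] at h5; exact h2.ne' h5
  rw [qGamma, qGamma, Real.rpow_add hp, Real.rpow_one, h5, show 1 - (t + 1) = (1 - t) - 1 by ring,
    Real.rpow_sub_one h3.ne']
  have h7 : 1 - p ^ t ≠ 0 := by linarith
  have h8 : p - 1 ≠ 0 := by linarith
  have h9 := h3.ne'
  field_simp
  ring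

/-- The infinite product in terms of the `q`-Gamma function. -/
theorem qPochInf_div_qPochInf (hp1 : p < 1) (a : ℝ) :
    qPochInf p p / qPochInf p (p ^ a) = qGamma p a * (1 - p) ^ (a - 1) := by
  have h3 : 0 < 1 - p := by linarith
  rw [qGamma, mul_assoc, ← Real.rpow_add h3]
  simp

end Gamma

/-! ### The `q`-exponential `E_p` and its moments -/

section Exponentials
variable {p : ℝ}

theorem qFactorial_succ' (n : ℕ) :
    qFactorial p (n + 1) = (p ^ (n + 1) - 1) / (p - 1) * qFactorial p n := by
  rw [qFactorial, Finset.prod_range_succ, mul_comm, qFactorial]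

theorem qNumber_succ_pos (hp : 0 < p) (hp1 : p < 1) (n : ℕ) : 0 < (p ^ (n + 1) - 1) / (p - 1) :=
  div_pos_of_neg_of_neg (by have := pow_lt_one₀ hp.le hp1 n.succ_ne_zero; simp only [Nat.succ_eq_add_one] at this; linarith)
    (by linarith)

theorem qFactorial_pos' (hp : 0 < p) (hp1 : p < 1) (n : ℕ) : 0 < qFactorial p n :=
  Finset.prod_pos fun i _ => qNumber_succ_pos hp hp1 i

theorem bigExpCoeff_pos (hp : 0 < p) (hp1 : p < 1) (n : ℕ) : 0 < bigExpCoeff p n :=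
  div_pos (pow_pos hp _) (qFactorial_pos' hp hp1 n)

theorem bigExpCoeff_zero : bigExpCoeff p 0 = 1 := by simp [bigExpCoeff, qFactorial]

theorem bigExpCoeff_succ (n : ℕ) :
    bigExpCoeff p (n + 1) = bigExpCoeff p n * (p ^ n * ((p ^ (n + 1) - 1) / (p - 1))⁻¹) := by
  have h : (n + 1) * (n + 1 - 1) / 2 = n * (n - 1) / 2 + n := by
    rw [← Nat.choose_two_right, ← Nat.choose_two_right, Nat.choose_succ_succ' n 1]
    simp [add_comm]
  rw [bigExpCoeff, bigExpCoeff, h, pow_add, qFactorial_succ']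
  simp only [div_eq_mul_inv, mul_inv, inv_inv]
  ring

theorem qNumber_ge_one (hp : 0 < p) (hp1 : p < 1) (n : ℕ) : 1 ≤ (p ^ (n + 1) - 1) / (p - 1) := by
  rw [le_div_iff_of_neg (by linarith)]
  have := pow_le_of_le_one hp.le hp1.le n.succ_ne_zero
  simp only [Nat.succ_eq_add_one] at this
  linarith

theorem summable_bigExp (hp : 0 < p) (hp1 : p < 1) (t : ℝ) :
    Summable fun j => bigExpCoeff p j * t ^ j := by
  have h1 : Tendsto (fun n : ℕ => p ^ n * |t|) atTop (𝓝 0) := by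
    simpa using (tendsto_pow_atTop_nhds_zero_of_lt_one hp.le hp1).mul_const |t|
  refine summable_of_ratio_norm_eventually_le (r := 1 / 2) (by norm_num) ?_
  filter_upwards [h1.eventually (gt_mem_nhds (show (0 : ℝ) < 1 / 2 by norm_num))] with n hn
  rw [bigExpCoeff_succ, pow_succ t]
  have h2 := bigExpCoeff_pos hp hp1 n
  have h3 := inv_le_one_of_one_le₀ (qNumber_ge_one hp hp1 n)
  have h4 := inv_pos.2 (qNumber_succ_pos hp hp1 n)
  simp only [norm_mul, Real.norm_eq_abs]
  rw [abs_of_pos h2, abs_of_pos h4, abs_of_pos (pow_pos hp n)]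
  set b := bigExpCoeff p n
  set c := ((p ^ (n + 1) - 1) / (p - 1))⁻¹
  have h5 : 0 ≤ b * |t ^ n| := by positivity
  calc b * (p ^ n * c) * (|t ^ n| * |t|) = b * |t ^ n| * (c * (p ^ n * |t|)) := by ring
    _ ≤ b * |t ^ n| * (1 * (1 / 2)) := by
      refine mul_le_mul_of_nonneg_left ?_ h5
      exact mul_le_mul h3 hn.le (by positivity) zero_le_one
    _ = 1 / 2 * (b * |t ^ n|) := by ring

/-- The functional equation `E_p(t) = (1 + (1 - p) t) E_p(p t)`. -/
theorem bigExp_eq_mul (hp : 0 < p) (hp1 : p < 1) (t : ℝ) :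
    bigExp p t = (1 + (1 - p) * t) * bigExp p (p * t) := by
  have h1 := summable_bigExp hp hp1 t
  have h2 := summable_bigExp hp hp1 (p * t)
  have h0 : bigExp p (p * t) = bigExpCoeff p 0 * (p * t) ^ 0
      + ∑' n, bigExpCoeff p (n + 1) * (p * t) ^ (n + 1) := h2.tsum_eq_zero_add
  rw [add_mul, one_mul]
  nth_rw 1 [h0]
  rw [bigExp, bigExp, h1.tsum_eq_zero_add, add_assoc, ← tsum_mul_left]
  congr 1
  rw [← ((summable_nat_add_iff 1).2 h2).tsum_add (h2.mul_left _)]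
  refine tsum_congr fun n => ?_
  rw [bigExpCoeff_succ]
  have h3 := qNumber_succ_pos hp hp1 n
  have h4 : p - 1 ≠ 0 := by linarith
  have h5 : p ^ (n + 1) - 1 ≠ 0 := by
    intro h; rw [h] at h3; simp at h3
  field_simp
  ring

theorem one_le_bigExp (hp : 0 < p) (hp1 : p < 1) {t : ℝ} (ht : 0 ≤ t) : 1 ≤ bigExp p t := by
  have h := (summable_bigExp hp hp1 t).le_tsum 0
    (fun j _ => mul_nonneg (bigExpCoeff_pos hp hp1 j).le (pow_nonneg ht j))
  simpa [bigExpCoeff_zero, bigExp] using h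

theorem bigExpCoeff_mul_pow_le_bigExp (hp : 0 < p) (hp1 : p < 1) {t : ℝ} (ht : 0 ≤ t) (n : ℕ) :
    bigExpCoeff p n * t ^ n ≤ bigExp p t :=
  (summable_bigExp hp hp1 t).le_tsum n
    (fun j _ => mul_nonneg (bigExpCoeff_pos hp hp1 j).le (pow_nonneg ht j))

theorem tendsto_bigExp_mul_pow (hp : 0 < p) (hp1 : p < 1) (t : ℝ) :
    Tendsto (fun n : ℕ => bigExp p (t * p ^ n)) atTop (𝓝 1) := by
  have h0 : (1 : ℝ) = ∑' j : ℕ, if j = 0 then 1 else 0 := by simp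
  rw [h0]
  refine tendsto_tsum_of_dominated_convergence (bound := fun j => bigExpCoeff p j * |t| ^ j)
    (summable_bigExp hp hp1 |t|) (fun j => ?_) (Eventually.of_forall fun n j => ?_)
  · rcases j with _ | j
    · simp [bigExpCoeff_zero]
    · have h1 : Tendsto (fun n : ℕ => t * p ^ n) atTop (𝓝 0) := by
        simpa using (tendsto_pow_atTop_nhds_zero_of_lt_one hp.le hp1).const_mul t
      simpa using (h1.pow (j + 1)).const_mul (bigExpCoeff p (j + 1))
  · rw [norm_mul, norm_pow, norm_mul, Real.norm_eq_abs, Real.norm_eq_abs, Real.norm_eq_abs,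
      abs_of_pos (bigExpCoeff_pos hp hp1 j), abs_of_pos (pow_pos hp n)]
    refine mul_le_mul_of_nonneg_left (pow_le_pow_left₀ (by positivity) ?_ _)
      (bigExpCoeff_pos hp hp1 j).le
    exact mul_le_of_le_one_right (abs_nonneg t) (pow_le_one₀ hp.le hp1.le)

/-- Euler's product `E_p(-u / (1 - p)) = (u; p)_∞`. -/
theorem bigExp_neg_div (hp : 0 < p) (hp1 : p < 1) (u : ℝ) :
    bigExp p (-(u / (1 - p))) = qPochInf p u := by
  have h3 : 1 - p ≠ 0 := by linarith
  have h1 (n : ℕ) : bigExp p (-(u / (1 - p)))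
      = (∏ k ∈ Finset.range n, (1 - u * p ^ k)) * bigExp p (-(u / (1 - p)) * p ^ n) := by
    induction n with
    | zero => simp
    | succ n ih =>
      rw [ih, bigExp_eq_mul hp hp1 (_ * p ^ n), Finset.prod_range_succ, mul_assoc]
      congr 2
      · field_simp
        ring
      · congr 1; ring
  have h2 := (tendsto_prod_qPochInf hp hp1 u).mul (tendsto_bigExp_mul_pow hp hp1 (-(u / (1 - p))))
  simp only [← h1, mul_one] at h2
  exact tendsto_nhds_unique tendsto_const_nhds h2

theorem qPochInf_le_one (hp : 0 < p) (hp1 : p < 1) {u : ℝ} (hu : u < 1) (hu0 : 0 ≤ u) :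
    qPochInf p u ≤ 1 := by
  refine le_of_tendsto (tendsto_prod_qPochInf hp hp1 u) (Eventually.of_forall fun n => ?_)
  refine Finset.prod_le_one (fun k _ => ?_) (fun k _ => ?_)
  · have : u * p ^ k ≤ u * 1 := mul_le_mul_of_nonneg_left (pow_le_one₀ hp.le hp1.le) hu0
    linarith
  · have := mul_nonneg hu0 (pow_nonneg hp.le k); linarith

/-- The zeros of `(u; p)_∞`. They make the bilateral moment series of `E_p` terminate on one side. -/
theorem qPochInf_neg_zpow (hp : 0 < p) (hp1 : p < 1) (n : ℕ) :
    qPochInf p (p ^ (-(n : ℤ))) = 0 := by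
  induction n with
  | zero => rw [qPochInf_eq_mul hp hp1]; simp
  | succ n ih =>
    rw [qPochInf_eq_mul hp hp1, ← zpow_add_one₀ hp.ne']
    push_cast
    rw [show -((n : ℤ) + 1) + 1 = -n by ring, ih, mul_zero]

/-- The moments of `E_p`: `∑_N p^{Na} E_p(-p^N / (1 - p)) = p^a Γ_p(a) (1 - p)^{a - 1}`. -/
theorem hasSum_bigExp_moment (hp : 0 < p) (hp1 : p < 1) {a : ℝ} (ha : 0 < a) :
    HasSum (fun N : ℤ => (p ^ a) ^ N * bigExp p (-(p ^ N / (1 - p))))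
      (p ^ a * (qGamma p a * (1 - p) ^ (a - 1))) := by
  simp only [bigExp_neg_div hp hp1]
  have hpa (a : ℝ) : 0 < p ^ a := Real.rpow_pos_of_pos hp a
  let u : ℝ → ℝ := fun a => ∑' n : ℕ, (p ^ a) ^ n * qPochInf p (p ^ (n + 1))
  have hb (n : ℕ) : 0 ≤ qPochInf p (p ^ (n + 1)) ∧ qPochInf p (p ^ (n + 1)) ≤ 1 :=
    ⟨(qPochInf_pos hp hp1 (pow_lt_one₀ hp.le hp1 n.succ_ne_zero) (pow_pos hp _).le).le,
      qPochInf_le_one hp hp1 (pow_lt_one₀ hp.le hp1 n.succ_ne_zero) (pow_pos hp _).le⟩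
  have hs (a : ℝ) (ha : 0 < a) : Summable fun n : ℕ => (p ^ a) ^ n * qPochInf p (p ^ (n + 1)) := by
    refine Summable.of_nonneg_of_le (fun n => mul_nonneg (pow_nonneg (hpa a).le n) (hb n).1)
      (fun n => mul_le_of_le_one_right (pow_nonneg (hpa a).le n) (hb n).2)
      (summable_geometric_of_lt_one (hpa a).le (Real.rpow_lt_one hp.le hp1 ha))
  -- Raising `a` by one multiplies `u` by `1 - p^a`, so `u a` is the limit of `u (a + n)`, which is
  -- `(p; p)_∞`, divided by `(p^a; p)_∞`.
  have hrec (a : ℝ) (ha : 0 < a) : u (a + 1) = (1 - p ^ a) * u a := by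
    have h1 : u a = qPochInf p p + ∑' n : ℕ, (p ^ a) ^ (n + 1) * qPochInf p (p ^ (n + 1 + 1)) := by
      refine (hs a ha).tsum_eq_zero_add.trans ?_
      simp
    have h2 := (summable_nat_add_iff 1).2 (hs a ha)
    have h3 : u (a + 1) = qPochInf p p
        + ∑' n : ℕ, (p ^ (a + 1)) ^ (n + 1) * qPochInf p (p ^ (n + 1 + 1)) := by
      refine (hs (a + 1) (by linarith)).tsum_eq_zero_add.trans ?_
      simp
    rw [sub_mul, one_mul, h3]
    nth_rw 1 [h1]
    rw [add_sub_assoc, ← tsum_mul_left, ← h2.tsum_sub ((hs a ha).mul_left _)]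
    congr 1
    refine tsum_congr fun n => ?_
    rw [qPochInf_eq_mul hp hp1 (p ^ (n + 1)), ← pow_succ, Real.rpow_add hp, Real.rpow_one]
    ring
  have hinv (n : ℕ) : u a * ∏ k ∈ Finset.range n, (1 - p ^ a * p ^ k) = u (a + n) := by
    induction n with
    | zero => simp
    | succ n ih =>
      rw [Finset.prod_range_succ, ← mul_assoc, ih, Nat.cast_succ, ← add_assoc,
        hrec _ (by positivity), Real.rpow_add hp, Real.rpow_natCast, mul_comm]
  have hlim : Tendsto (fun n : ℕ => u (a + n)) atTop (𝓝 (qPochInf p p)) := by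
    have h0 : qPochInf p p = ∑' j : ℕ, if j = 0 then qPochInf p p else 0 := by simp
    rw [h0]
    refine tendsto_tsum_of_dominated_convergence (bound := fun j => (p ^ a) ^ j)
      (summable_geometric_of_lt_one (hpa a).le (Real.rpow_lt_one hp.le hp1 ha)) (fun j => ?_)
      (Eventually.of_forall fun n j => ?_)
    · rcases j with _ | j
      · simp
      · have h1 : Tendsto (fun n : ℕ => p ^ (a + n)) atTop (𝓝 0) := by
          simp only [Real.rpow_add hp, Real.rpow_natCast]
          simpa using (tendsto_pow_atTop_nhds_zero_of_lt_one hp.le hp1).const_mul (p ^ a)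
        simpa using (h1.pow (j + 1)).mul_const (qPochInf p (p ^ (j + 1 + 1)))
    · rw [Real.norm_of_nonneg (mul_nonneg (pow_nonneg (hpa _).le _) (hb j).1)]
      refine (mul_le_of_le_one_right (pow_nonneg (hpa _).le _) (hb j).2).trans ?_
      refine pow_le_pow_left₀ (hpa _).le ?_ _
      exact Real.rpow_le_rpow_of_exponent_ge hp hp1.le (by simp)
  have hu : u a * qPochInf p (p ^ a) = qPochInf p p := by
    have h1 := (tendsto_prod_qPochInf hp hp1 (p ^ a)).const_mul (u a)
    simp only [hinv] at h1
    exact tendsto_nhds_unique h1 hlim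
  have hu' : u a = qGamma p a * (1 - p) ^ (a - 1) := by
    rw [← qPochInf_div_qPochInf hp1, ← hu, mul_div_cancel_right₀]
    exact (qPochInf_pos hp hp1 (Real.rpow_lt_one hp.le hp1 ha) (hpa a).le).ne'
  have hu1 : HasSum (fun n : ℕ => (p ^ a) ^ (n : ℤ) * qPochInf p (p ^ (n : ℤ)))
      (p ^ a * (qGamma p a * (1 - p) ^ (a - 1))) := by
    rw [← hu']
    have h1 : HasSum (fun n : ℕ => (p ^ a) ^ (n + 1) * qPochInf p (p ^ (n + 1))) (p ^ a * u a) := by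
      refine ((hs a ha).hasSum.mul_left (p ^ a)).congr_fun fun n => ?_
      rw [pow_succ' (p ^ a)]; ring
    rw [← hasSum_nat_add_iff' 1]
    have h2 := qPochInf_neg_zpow hp hp1 0
    simp only [Nat.cast_zero, neg_zero, zpow_zero] at h2
    simpa [h2, ← zpow_natCast] using h1
  refine (Function.Injective.hasSum_iff (g := ((↑) : ℕ → ℤ)) Nat.cast_injective ?_).1 hu1
  intro N hN
  obtain ⟨n, rfl | rfl⟩ := N.eq_nat_or_neg
  · exact absurd ⟨n, rfl⟩ hN
  · rw [qPochInf_neg_zpow hp hp1, mul_zero]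

end Exponentials

/-! ### The `q`-exponential `e_p` and its moments -/

section SmallExp
variable {p : ℝ}

theorem smallExp_neg_mul (hp : 0 < p) (hp1 : p < 1) {x : ℝ} (hx : 0 ≤ x) :
    smallExp p (-(p * x)) = (1 + (1 - p) * x) * smallExp p (-x) := by
  have h1 : 0 < 1 + (1 - p) * x := by nlinarith
  have h2 := one_le_bigExp hp hp1 (mul_nonneg hp.le hx)
  rw [smallExp, smallExp, neg_neg, neg_neg, bigExp_eq_mul hp hp1 x, mul_inv, mul_inv_cancel_left₀ h1.ne']

theorem smallExp_neg_pos (hp : 0 < p) (hp1 : p < 1) {x : ℝ} (hx : 0 ≤ x) : 0 < smallExp p (-x) := by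
  rw [smallExp, neg_neg]
  exact inv_pos.2 (zero_lt_one.trans_le (one_le_bigExp hp hp1 hx))

theorem smallExp_neg_le_one (hp : 0 < p) (hp1 : p < 1) {x : ℝ} (hx : 0 ≤ x) :
    smallExp p (-x) ≤ 1 := by
  rw [smallExp, neg_neg]
  exact inv_le_one_of_one_le₀ (one_le_bigExp hp hp1 hx)

theorem smallExp_neg_le (hp : 0 < p) (hp1 : p < 1) {x : ℝ} (hx : 0 < x) (n : ℕ) :
    smallExp p (-x) ≤ (bigExpCoeff p n * x ^ n)⁻¹ := by
  rw [smallExp, neg_neg]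
  exact inv_anti₀ (mul_pos (bigExpCoeff_pos hp hp1 n) (pow_pos hx n))
    (bigExpCoeff_mul_pow_le_bigExp hp hp1 hx.le n)

/-- The moments `∑_{l ∈ ℤ} p^{la} e_p(-w p^l)` of the `q`-exponential `e_p`. -/
noncomputable def gaussMoment (p w a : ℝ) : ℝ := ∑' l : ℤ, (p ^ a) ^ l * smallExp p (-(w * p ^ l))

theorem summable_gaussMoment (hp : 0 < p) (hp1 : p < 1) {w a : ℝ} (hw : 0 < w) (ha : 0 < a) :
    Summable fun l : ℤ => (p ^ a) ^ l * smallExp p (-(w * p ^ l)) := by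
  have hpa : 0 < p ^ a := Real.rpow_pos_of_pos hp a
  have hx (l : ℤ) : 0 < w * p ^ l := mul_pos hw (zpow_pos hp l)
  refine Summable.of_nat_of_neg ?_ ?_
  · refine Summable.of_nonneg_of_le
      (fun n => mul_nonneg (zpow_pos hpa _).le (smallExp_neg_pos hp hp1 (hx _).le).le)
      (fun n => mul_le_of_le_one_right (zpow_pos hpa _).le (smallExp_neg_le_one hp hp1 (hx _).le)) ?_
    simp only [zpow_natCast]
    exact summable_geometric_of_lt_one hpa.le (Real.rpow_lt_one hp.le hp1 ha)
  · -- for negative `l` the factor `e_p` beats every power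
    obtain ⟨N, hN⟩ := exists_nat_gt a
    have h1 : p ^ ((N : ℝ) - a) < 1 := Real.rpow_lt_one hp.le hp1 (by linarith)
    have h2 : 0 < p ^ ((N : ℝ) - a) := Real.rpow_pos_of_pos hp _
    refine Summable.of_nonneg_of_le
      (fun n => mul_nonneg (zpow_pos hpa _).le (smallExp_neg_pos hp hp1 (hx _).le).le)
      (fun n => mul_le_mul_of_nonneg_left (smallExp_neg_le hp hp1 (hx _) N) (zpow_pos hpa _).le) ?_
    refine ((summable_geometric_of_lt_one h2.le h1).mul_left (bigExpCoeff p N * w ^ N)⁻¹).congr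
      fun n => ?_
    rw [Real.rpow_sub hp, Real.rpow_natCast, zpow_neg, zpow_neg, zpow_natCast, zpow_natCast,
      div_pow, mul_pow, inv_pow, ← pow_mul, ← pow_mul]
    have h3 := (bigExpCoeff_pos hp hp1 N).ne'
    field_simp
    rw [mul_comm]

theorem gaussMoment_pos (hp : 0 < p) (hp1 : p < 1) {w a : ℝ} (hw : 0 < w) (ha : 0 < a) :
    0 < gaussMoment p w a := by
  have hpa : 0 < p ^ a := Real.rpow_pos_of_pos hp a
  have h (l : ℤ) : 0 < (p ^ a) ^ l * smallExp p (-(w * p ^ l)) :=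
    mul_pos (zpow_pos hpa l) (smallExp_neg_pos hp hp1 (mul_pos hw (zpow_pos hp l)).le)
  exact (summable_gaussMoment hp hp1 hw ha).tsum_pos (fun l => (h l).le) 0 (h 0)

/-- The scaling of the moments, by a shift of the bilateral series. -/
theorem gaussMoment_zpow_mul (hp : 0 < p) (w a : ℝ) (n : ℤ) :
    gaussMoment p (p ^ n * w) a = ((p ^ a) ^ n)⁻¹ * gaussMoment p w a := by
  have hpa : 0 < p ^ a := Real.rpow_pos_of_pos hp a
  rw [gaussMoment, gaussMoment, ← (Equiv.addRight n).tsum_eq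
    (fun l : ℤ => (p ^ a) ^ l * smallExp p (-(w * p ^ l))), ← tsum_mul_left]
  refine tsum_congr fun l => ?_
  rw [Equiv.coe_addRight, zpow_add₀ hpa.ne', zpow_add₀ hp.ne', ← mul_assoc,
    show p ^ n * w * p ^ l = w * (p ^ l * p ^ n) by ring]
  congr 1
  have := (zpow_pos hpa n).ne'
  field_simp

/-- The recursion of the moments, from the functional equation of `e_p` and the invariance of the
bilateral series under shifts. -/
theorem gaussMoment_add_one (hp : 0 < p) (hp1 : p < 1) {w a : ℝ} (hw : 0 < w) (ha : 0 < a) :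
    p ^ a * w * gaussMoment p w (a + 1) = (p ^ a - 1) / (p - 1) * gaussMoment p w a := by
  have hpa : 0 < p ^ a := Real.rpow_pos_of_pos hp a
  have h1 := gaussMoment_zpow_mul hp w a 1
  have h2 : gaussMoment p (p ^ (1 : ℤ) * w) a
      = gaussMoment p w a + (1 - p) * w * gaussMoment p w (a + 1) := by
    rw [gaussMoment, gaussMoment, gaussMoment, ← tsum_mul_left,
      ← (summable_gaussMoment hp hp1 hw ha).tsum_add
        ((summable_gaussMoment hp hp1 hw (by linarith)).mul_left _)]
    refine tsum_congr fun l => ?_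
    rw [zpow_one, mul_assoc p, smallExp_neg_mul hp hp1 (mul_pos hw (zpow_pos hp l)).le,
      Real.rpow_add hp, Real.rpow_one, mul_zpow]
    ring
  rw [h2, zpow_one] at h1
  have h3 : p - 1 ≠ 0 := by linarith
  have h4 : (1 - p) * w * gaussMoment p w (a + 1) * p ^ a = (1 - p ^ a) * gaussMoment p w a := by
    have h5 : ((p ^ a)⁻¹ * gaussMoment p w a) * p ^ a = gaussMoment p w a := by field_simp
    rw [← h1] at h5
    linear_combination h5
  rw [div_mul_eq_mul_div, eq_div_iff h3]
  linear_combination -h4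

theorem gaussMoment_add_nat (hp : 0 < p) (hp1 : p < 1) {w a : ℝ} (hw : 0 < w) (ha : 0 < a) (i : ℕ) :
    (p ^ a) ^ i * p ^ (i * (i - 1) / 2) * w ^ i * gaussMoment p w (a + i) * qGamma p a
      = qGamma p (a + i) * gaussMoment p w a := by
  induction i with
  | zero => simp [mul_comm]
  | succ i ih =>
    have h : (i + 1) * (i + 1 - 1) / 2 = i * (i - 1) / 2 + i := by
      rw [← Nat.choose_two_right, ← Nat.choose_two_right, Nat.choose_succ_succ' i 1]
      simp [add_comm]
    have hai : 0 < a + i := by positivity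
    have h1 := gaussMoment_add_one hp hp1 hw hai
    have h2 := qGamma_add_one hp hp1 hai
    rw [Real.rpow_add hp, Real.rpow_natCast] at h1 h2
    rw [Nat.cast_succ, ← add_assoc, h2, h, pow_add, pow_succ (p ^ a), pow_succ w]
    linear_combination (p ^ a) ^ i * p ^ (i * (i - 1) / 2) * w ^ i * qGamma p a * h1
      + (p ^ a * p ^ i - 1) / (p - 1) * ih

/-- Exchange of summations under absolute convergence. -/
theorem hasSum_tsum_of_summable_abs {F : ℤ → ℕ → ℝ} {A : ℕ → ℝ} {S : ℕ → ℝ}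
    (h1 : ∀ i, HasSum (fun l => |F l i|) (A i)) (h2 : Summable A)
    (h3 : ∀ i, HasSum (fun l => F l i) (S i)) :
    HasSum (fun l => ∑' i, F l i) (∑' i, S i) := by
  have h4 : Summable fun x : ℕ × ℤ => F x.2 x.1 := by
    refine Summable.of_norm ?_
    refine (summable_prod_of_nonneg fun x => norm_nonneg _).2
      ⟨fun i => (h1 i).summable, h2.congr fun i => ((h1 i).tsum_eq).symm⟩
  have h5 : HasSum (fun x : ℕ × ℤ => F x.2 x.1) (∑' i, S i) := by
    have := (h4.hasSum.prod_fiberwise fun i => h3 i)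
    rw [this.tsum_eq]
    exact h4.hasSum
  have h6 : HasSum (fun x : ℤ × ℕ => F x.1 x.2) (∑' i, S i) := (Equiv.prodComm ℤ ℕ).hasSum_iff.2 h5
  exact h6.prod_fiberwise fun l => (h6.summable.prod_factor l).hasSum

/-- The Hankel transform of the `q`-exponential `e_p`, up to normalization: the series of the second
`q`-Bessel function, integrated term by term against `e_p`, is the series of `E_p`. -/
theorem hasSum_bessel_smallExp (hp : 0 < p) (hp1 : p < 1) {w a : ℝ} (hw : 0 < w) (ha : 0 < a)
    (y : ℝ) :
    HasSum (fun l : ℤ => (p ^ a) ^ l * smallExp p (-(w * p ^ l))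
        * ∑' i : ℕ, (p ^ a) ^ i * p ^ (i * (i - 1)) * (-1) ^ i / (qFactorial p i * qGamma p (a + i))
          * (y * p ^ l) ^ i)
      (gaussMoment p w a / qGamma p a * bigExp p (-(y / w))) := by
  have hpa : 0 < p ^ a := Real.rpow_pos_of_pos hp a
  let F : ℤ → ℕ → ℝ := fun l i => (p ^ a) ^ l * smallExp p (-(w * p ^ l))
    * ((p ^ a) ^ i * p ^ (i * (i - 1)) * (-1) ^ i / (qFactorial p i * qGamma p (a + i))
          * (y * p ^ l) ^ i)
  let C : ℕ → ℝ := fun i => (p ^ a) ^ i * p ^ (i * (i - 1)) / (qFactorial p i * qGamma p (a + i))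
  have hG (i : ℕ) : 0 < qGamma p (a + i) := qGamma_pos hp hp1 (by positivity)
  have hC (i : ℕ) : 0 < C i := by
    have := hG i
    have := qFactorial_pos' hp hp1 i
    positivity
  have hF (l i) : F l i = C i * (-y) ^ i * ((p ^ (a + i)) ^ l * smallExp p (-(w * p ^ l))) := by
    have : (p ^ (a + i)) ^ l = (p ^ a) ^ l * (p ^ l) ^ i := by
      rw [Real.rpow_add hp, Real.rpow_natCast, mul_zpow, ← zpow_natCast, ← zpow_natCast, ← zpow_mul,
        ← zpow_mul, mul_comm l]
    rw [this, neg_pow y, mul_comm ((-1) ^ i) (y ^ i)]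
    simp only [F, C]
    rw [mul_pow y]
    ring
  have hs (i : ℕ) : HasSum (fun l : ℤ => (p ^ (a + i)) ^ l * smallExp p (-(w * p ^ l)))
      (gaussMoment p w (a + i)) := (summable_gaussMoment hp hp1 hw (by positivity)).hasSum
  -- The `q`-Gamma function in the denominator cancels the one of the moment, and one of the two factors
  -- `p ^ (i (i - 1) / 2)` remains.
  have hval (t : ℝ) (i : ℕ) : C i * t ^ i * gaussMoment p w (a + i)
      = gaussMoment p w a / qGamma p a * (bigExpCoeff p i * (t / w) ^ i) := by
    have h1 := gaussMoment_add_nat hp hp1 hw ha i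
    have h2 := (hG i).ne'
    have h3 := (qFactorial_pos' hp hp1 i).ne'
    have h4 := (qGamma_pos hp hp1 ha).ne'
    have h5 := pow_pos hpa i
    have h6 : p ^ (i * (i - 1)) = p ^ (i * (i - 1) / 2) * p ^ (i * (i - 1) / 2) := by
      rw [← pow_add, ← two_mul, Nat.two_mul_div_two_of_even (Nat.even_mul_pred_self i)]
    simp only [C]
    rw [bigExpCoeff, div_pow, h6]
    field_simp
    linear_combination t ^ i * h1
  -- The absolute values of the terms add up to the series of `E_p` at `|y| / w`.
  have h := hasSum_tsum_of_summable_abs (F := F)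
    (A := fun i => gaussMoment p w a / qGamma p a * (bigExpCoeff p i * (|y| / w) ^ i))
    (S := fun i => gaussMoment p w a / qGamma p a * (bigExpCoeff p i * (-y / w) ^ i))
    (fun i => ?_) ((summable_bigExp hp hp1 _).mul_left _) (fun i => ?_)
  · rw [tsum_mul_left] at h
    rw [← neg_div, bigExp]
    refine h.congr_fun fun l => ?_
    rw [tsum_mul_left]
  · simp only [hF]
    rw [← hval]
    refine ((hs i).mul_left (C i * |y| ^ i)).congr_fun fun l => ?_
    have h2 : 0 < (p ^ (a + i)) ^ l * smallExp p (-(w * p ^ l)) :=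
      mul_pos (zpow_pos (Real.rpow_pos_of_pos hp _) l)
        (smallExp_neg_pos hp hp1 (mul_pos hw (zpow_pos hp l)).le)
    rw [abs_mul, abs_of_pos h2, abs_mul, abs_of_pos (hC i), abs_pow, abs_neg]
  · simp only [hF]
    rw [← hval]
    exact (hs i).mul_left _

end SmallExp
end QCalc

namespace QEuclid
open QCalc Filter

/-! ### The integral over the sphere -/

section Sphere
variable {q : ℝ} {m : ℕ}

/-- The coefficients of the powers of the Laplace operator in the integral over the sphere. -/
noncomputable def sphereCoeff (q : ℝ) (m k : ℕ) : ℝ :=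
  2 * qGamma (q ^ 2) (1 / 2) ^ m /
    (mu q m ^ (2 * k) * qFactorial (q ^ 2) k * qGamma (q ^ 2) (k + m / 2))

theorem sphereInt_eq_tsum (R : Poly q m) :
    sphereInt q m R = ∑' k : ℕ, (sphereCoeff q m k : ℂ) * laplaceEval q m k R := rfl

theorem summable_sphereInt (hq : 0 < q) (R : Poly q m) :
    Summable fun k : ℕ => (sphereCoeff q m k : ℂ) * laplaceEval q m k R := by
  induction R using homog_induction with
  | add f g hf hg => simpa only [map_add, mul_add] using hf.add hg
  | homog n f hf =>
    refine summable_of_ne_finset_zero (s := {n / 2}) fun t ht => ?_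
    rw [laplaceEval_homog hq (n := n) (fun h => ht (by simp [h])) hf, mul_zero]

theorem sphereInt_add (hq : 0 < q) (R T : Poly q m) :
    sphereInt q m (R + T) = sphereInt q m R + sphereInt q m T := by
  simp only [sphereInt_eq_tsum, map_add, mul_add]
  exact (summable_sphereInt hq R).tsum_add (summable_sphereInt hq T)

theorem sphereInt_smul (c : ℂ) (R : Poly q m) : sphereInt q m (c • R) = c * sphereInt q m R := by
  simp only [sphereInt_eq_tsum, map_smul, smul_eq_mul, mul_left_comm _ c, tsum_mul_left]

theorem sphereInt_even (hq : 0 < q) {t : ℕ} {R : Poly q m} (hR : R ∈ homog q m (2 * t)) :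
    sphereInt q m R = (sphereCoeff q m t : ℂ) * laplaceEval q m t R := by
  rw [sphereInt_eq_tsum, tsum_eq_single t]
  intro k hk
  rw [laplaceEval_homog hq (by omega) hR, mul_zero]

theorem sphereInt_eq_zero (hq : 0 < q) {n : ℕ} {R : Poly q m} (hR : R ∈ homog q m n)
    (h : ∀ t, n = 2 * t → laplaceEval q m t R = 0) : sphereInt q m R = 0 := by
  rw [sphereInt_eq_tsum, ← tsum_zero]
  refine tsum_congr fun t => ?_
  by_cases hn : n = 2 * t
  · rw [h t hn, mul_zero]
  · rw [laplaceEval_homog hq hn hR, mul_zero]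

theorem laplaceEval_succ (t : ℕ) (p : Poly q m) :
    laplaceEval q m (t + 1) p = laplaceEval q m t (laplace q m p) := by
  simp only [laplaceEval, pow_succ]; rfl

theorem laplaceEval_normSq_pow_mul_of_lt (hq : 0 < q) (hq1 : q < 1) (hm : 1 ≤ m) {k j t : ℕ}
    (hjt : j < t) {S : Poly q m} (hS : S ∈ harmonics q m k) :
    laplaceEval q m t (normSq q m ^ j * S) = 0 := by
  induction t generalizing j with
  | zero => omega
  | succ t ih =>
    rw [laplaceEval_succ]
    rcases j with _ | j
    · rw [pow_zero, one_mul, show laplace q m S = 0 from hS.2, map_zero]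
    · rw [laplace_normSq_pow_mul hq hq1 hm hS, map_smul, ih (by omega), smul_zero]

theorem laplaceEval_succ_normSq_mul (hq : 0 < q) (hq1 : q < 1) (hm : 1 ≤ m) {t : ℕ} {R : Poly q m}
    (hR : R ∈ homog q m (2 * t)) : laplaceEval q m (t + 1) (normSq q m * R)
      = ((mu q m ^ 2 * brk q (t + 1) * brkHalf q m t : ℝ) : ℂ) * laplaceEval q m t R := by
  have h := mem_span_harmonics hq hq1 hm hR
  clear hR
  induction h using Submodule.span_induction with
  | zero => simp
  | add f g _ _ hf hg => simp only [mul_add, map_add, hf, hg]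
  | smul c f _ hf =>
    rw [mul_smul_comm, map_smul, hf, map_smul, smul_eq_mul, smul_eq_mul, mul_left_comm]
  | mem r hr =>
    obtain ⟨k, j, S, hkj, hS, rfl⟩ := hr
    rw [← mul_assoc, ← pow_succ']
    rcases k with _ | k
    · obtain rfl : j = t := by omega
      rw [laplaceEval_succ, laplace_normSq_pow_mul hq hq1 hm hS, map_smul, smul_eq_mul, zero_add]
    · rw [laplaceEval_normSq_pow_mul_of_lt hq hq1 hm (by omega) hS,
        laplaceEval_normSq_pow_mul_of_lt hq hq1 hm (by omega) hS, mul_zero]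

theorem sq_pos_lt_one (hq : 0 < q) (hq1 : q < 1) : 0 < q ^ 2 ∧ q ^ 2 < 1 :=
  ⟨pow_pos hq 2, pow_lt_one₀ hq.le hq1 two_ne_zero⟩

theorem sphereCoeff_succ (hq : 0 < q) (hq1 : q < 1) (hm : 1 ≤ m) (t : ℕ) :
    sphereCoeff q m (t + 1) * (mu q m ^ 2 * brk q (t + 1) * brkHalf q m t) = sphereCoeff q m t := by
  obtain ⟨hp, hp1⟩ := sq_pos_lt_one hq hq1
  have hm' : (0 : ℝ) < m := by exact_mod_cast hm
  have ht : (0 : ℝ) < t + m / 2 := by positivity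
  have h1 := qGamma_add_one hp hp1 ht
  have h2 : (q ^ 2) ^ ((t : ℝ) + m / 2) = q ^ (m + 2 * t) := by
    rw [← Real.rpow_natCast, ← Real.rpow_mul hq.le, ← Real.rpow_natCast]
    congr 1; push_cast; ring
  rw [h2] at h1
  have h3 := (qGamma_pos hp hp1 ht).ne'
  have h4 := (qFactorial_pos hq hq1 t).ne'
  have h5 := (mu_pos (m := m) hq).ne'
  have h6 := (brk_succ_pos hq hq1 t).ne'
  have h7 := (brkHalf_pos hq hq1 hm t).ne'
  have h8 : ((t + 1 : ℕ) : ℝ) + m / 2 = t + m / 2 + 1 := by push_cast; ring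
  rw [sphereCoeff, sphereCoeff, h8, h1, qFactorial_succ]
  change _ / (_ * _ * (brkHalf q m t * _)) * _ = _
  generalize qGamma (q ^ 2) ((t : ℝ) + m / 2) = g at h3 ⊢
  rw [mul_add, pow_add]
  field_simp

/-- The integral over the sphere only depends on the restriction to `x² = 1`. -/
theorem sphereInt_normSq_mul (hq : 0 < q) (hq1 : q < 1) (hm : 1 ≤ m) {n : ℕ} {R : Poly q m}
    (hR : R ∈ homog q m n) : sphereInt q m (normSq q m * R) = sphereInt q m R := by
  have h1 : normSq q m * R ∈ homog q m (n + 2) := by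
    simpa using normSq_pow_mul_mem_homog 1 hR
  rcases Nat.even_or_odd' n with ⟨t, rfl | rfl⟩
  · rw [sphereInt_even hq (t := t + 1) h1, sphereInt_even hq hR,
      laplaceEval_succ_normSq_mul hq hq1 hm hR, ← mul_assoc, ← Complex.ofReal_mul,
      sphereCoeff_succ hq hq1 hm]
  · rw [sphereInt_eq_zero hq h1 (fun t h => by omega), sphereInt_eq_zero hq hR (fun t h => by omega)]

theorem sphereInt_normSq_pow_mul (hq : 0 < q) (hq1 : q < 1) (hm : 1 ≤ m) {n : ℕ} {R : Poly q m}
    (hR : R ∈ homog q m n) (i : ℕ) : sphereInt q m (normSq q m ^ i * R) = sphereInt q m R := by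
  induction i with
  | zero => rw [pow_zero, one_mul]
  | succ i ih =>
    rw [pow_succ', mul_assoc, sphereInt_normSq_mul hq hq1 hm (normSq_pow_mul_mem_homog i hR), ih]

/-- The integral over the sphere of `S r` with a spherical harmonic `S` is a multiple of the pairing
of `r` with `x^{2j} S`. Hence the integral against the Fourier kernel reproduces `S`. -/
theorem sphereInt_harmonic_mul (hq : 0 < q) (hq1 : q < 1) {k j : ℕ} {S r : Poly q m}
    (hS : S ∈ harmonics q m k) (hr : r ∈ homog q m (k + 2 * j)) :
    sphereInt q m (S * r) = ((2 * qGamma (q ^ 2) (1 / 2) ^ m /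
      (mu q m ^ (k + 2 * j) * qFactorial (q ^ 2) j * qGamma (q ^ 2) (m / 2 + k + j)) : ℝ) : ℂ)
        * pairing hq (normSq q m ^ j * S) r := by
  have h1 : S * r ∈ homog q m (2 * (j + k)) := by
    have := mul_mem_homog hS.1 hr
    rwa [show k + (k + 2 * j) = 2 * (j + k) by ring] at this
  rw [sphereInt_even hq h1, laplaceEval_harmonic_mul hq hq1 hS, ← mul_assoc, ← Complex.ofReal_mul]
  congr 2
  have h4 := (qFactorial_pos hq hq1 j).ne'
  have h4' := (qFactorial_pos hq hq1 (j + k)).ne'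
  have h5 := (mu_pos (m := m) hq).ne'
  have h8 : ((j + k : ℕ) : ℝ) + m / 2 = m / 2 + k + j := by push_cast; ring
  rw [sphereCoeff, h8]
  field_simp
  ring

theorem sphereInt_harmonic_mul_of_ne (hq : 0 < q) (hq1 : q < 1) {k l : ℕ} {S r : Poly q m}
    (hS : S ∈ harmonics q m k) (hr : r ∈ homog q m l) (hl : ∀ j, l ≠ k + 2 * j) :
    sphereInt q m (S * r) = 0 := by
  refine sphereInt_eq_zero hq (mul_mem_homog hS.1 hr) fun t ht =>
    laplaceEval_harmonic_mul_of_lt hq hq1 ?_ hS r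
  by_contra! h
  exact hl (t - k) (by omega)

end Sphere

/-! ### Radial power series -/

section RadialSeries
variable {q : ℝ} {m : ℕ}
open PowerSeries

theorem radial_add (f g : PowerSeries ℂ) : radial q m (f + g) = radial q m f + radial q m g := by
  ext n
  simp only [radial, coeff_mk, map_add]
  split_ifs
  · rw [add_smul]
  · rw [add_zero]

theorem radial_smul (c : ℂ) (f : PowerSeries ℂ) : radial q m (c • f) = c • radial q m f := by
  ext n
  simp only [radial, coeff_mk, coeff_smul]
  split_ifs
  · rw [smul_assoc]
  · rw [smul_zero]

theorem coeff_radial_two_mul (f : PowerSeries ℂ) (i : ℕ) :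
    coeff (2 * i) (radial q m f) = coeff i f • normSq q m ^ i := by
  rw [radial, coeff_mk, if_pos (even_two_mul i), Nat.mul_div_cancel_left i two_pos]

theorem coeff_radial_of_ne (f : PowerSeries ℂ) {n : ℕ} (hn : ∀ i, n ≠ 2 * i) :
    coeff n (radial q m f) = 0 := by
  rw [radial, coeff_mk, if_neg]
  rintro ⟨i, hi⟩
  exact hn i (by omega)

theorem coeff_toSeries_mul_of_homog {d : ℕ} {R : Poly q m} (hR : R ∈ homog q m d)
    (g : Series q m) (n : ℕ) :
    coeff n (toSeries q m R * g) = if d ≤ n then R * coeff (n - d) g else 0 := by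
  rw [toSeries_homog hR, monomial_eq_C_mul_X_pow, mul_assoc, coeff_C_mul, coeff_X_pow_mul']
  split_ifs
  · rfl
  · rw [mul_zero]

theorem coeff_mul_toSeries_of_homog {d : ℕ} {R : Poly q m} (hR : R ∈ homog q m d)
    (g : Series q m) (n : ℕ) :
    coeff n (g * toSeries q m R) = if d ≤ n then coeff (n - d) g * R else 0 := by
  rw [toSeries_homog hR, monomial_eq_C_mul_X_pow, (commute_X_pow (C R) d).eq, ← mul_assoc,
    coeff_mul_C, coeff_mul_X_pow']
  split_ifs
  · rfl
  · rw [zero_mul]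

theorem normSq_pow_comm (hq : 0 < q) (i : ℕ) (p : Poly q m) :
    p * normSq q m ^ i = normSq q m ^ i * p :=
  (Commute.pow_right (normSq_comm hq p) i).eq

theorem coeff_toSeries_mul_radial (hq : 0 < q) {d : ℕ} {R : Poly q m} (hR : R ∈ homog q m d)
    (f : PowerSeries ℂ) (i : ℕ) : coeff (d + 2 * i) (toSeries q m R * radial q m f)
      = coeff i f • (normSq q m ^ i * R) := by
  rw [coeff_toSeries_mul_of_homog hR, if_pos (Nat.le_add_right _ _), Nat.add_sub_cancel_left,
    coeff_radial_two_mul, mul_smul_comm, normSq_pow_comm hq]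

theorem coeff_toSeries_mul_radial_of_ne {d n : ℕ} {R : Poly q m} (hR : R ∈ homog q m d)
    (f : PowerSeries ℂ) (hn : ∀ i, n ≠ d + 2 * i) :
    coeff n (toSeries q m R * radial q m f) = 0 := by
  rw [coeff_toSeries_mul_of_homog hR]
  split_ifs with h
  · rw [coeff_radial_of_ne _ (fun i hi => hn i (by omega)), mul_zero]
  · rfl

theorem radial_comm (hq : 0 < q) (f : PowerSeries ℂ) (p : Poly q m) :
    radial q m f * toSeries q m p = toSeries q m p * radial q m f := by
  induction p using homog_induction with
  | add p r hp hr => rw [map_add, mul_add, add_mul, hp, hr]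
  | homog d p hp =>
    ext n
    rw [coeff_mul_toSeries_of_homog hp, coeff_toSeries_mul_of_homog hp]
    split_ifs with h
    · by_cases hi : ∃ i, n - d = 2 * i
      · obtain ⟨i, hi⟩ := hi
        rw [hi, coeff_radial_two_mul, mul_smul_comm, smul_mul_assoc, normSq_pow_comm hq]
      · push Not at hi
        rw [coeff_radial_of_ne _ hi, mul_zero, zero_mul]
    · rfl

theorem toSeries_normSq_mul_radial (f : PowerSeries ℂ) :
    toSeries q m (normSq q m) * radial q m f = radial q m (X * f) := by
  have h1 : normSq q m ∈ homog q m 2 := by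
    simpa using normSq_pow_mul_mem_homog 1 one_mem_homog
  ext n
  rw [coeff_toSeries_mul_of_homog h1]
  by_cases hi : ∃ i, n = 2 * i
  · obtain ⟨i, rfl⟩ := hi
    rw [coeff_radial_two_mul]
    rcases i with _ | i
    · simp
    · rw [if_pos (by omega), show 2 * (i + 1) - 2 = 2 * i by omega, coeff_radial_two_mul,
        coeff_succ_X_mul, mul_smul_comm, pow_succ']
  · push Not at hi
    rw [coeff_radial_of_ne _ hi]
    split_ifs with h
    · rw [coeff_radial_of_ne _ (fun i hn => hi (i + 1) (by omega)), mul_zero]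
    · rfl

end RadialSeries

/-! ### Polynomials times `q`-Gaussians -/

section GaussChain
variable {q : ℝ} {m : ℕ}
open PowerSeries

/-- A sequence of power series with `G n = (1 + c_n X) G (n + 1)` for nonzero constants `c_n`. The two
families of `q`-Gaussians have this form. -/
def IsChain (G : ℤ → PowerSeries ℂ) : Prop :=
  ∀ n, ∃ c : ℂ, c ≠ 0 ∧ G n = G (n + 1) + c • (X * G (n + 1))

/-- The span of the products of spherical harmonics with the radial functions of a chain. -/
noncomputable def chainSpan (q : ℝ) (m : ℕ) (G : ℤ → PowerSeries ℂ) : Submodule ℂ (Series q m) :=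
  Submodule.span ℂ {f | ∃ (k : ℕ) (n : ℤ) (S : Poly q m), S ∈ harmonics q m k ∧
    f = toSeries q m S * radial q m (G n)}

theorem IsChain.X_mul_mem {G : ℤ → PowerSeries ℂ} (hG : IsChain G) {f : PowerSeries ℂ}
    (hf : f ∈ Submodule.span ℂ (Set.range G)) : X * f ∈ Submodule.span ℂ (Set.range G) := by
  induction hf using Submodule.span_induction with
  | zero => simp
  | add f g _ _ hf hg => rw [mul_add]; exact add_mem hf hg
  | smul c f _ hf => rw [mul_smul_comm]; exact Submodule.smul_mem _ _ hf
  | mem f hf =>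
    obtain ⟨n, rfl⟩ := hf
    obtain ⟨c, hc, h⟩ := hG (n - 1)
    rw [sub_add_cancel] at h
    have h1 : X * G n = c⁻¹ • (G (n - 1) - G n) := by
      rw [h, add_sub_cancel_left, smul_smul, inv_mul_cancel₀ hc, one_smul]
    rw [h1]
    exact Submodule.smul_mem _ _ (sub_mem (Submodule.subset_span ⟨_, rfl⟩)
      (Submodule.subset_span ⟨_, rfl⟩))

theorem IsChain.X_pow_mul_mem {G : ℤ → PowerSeries ℂ} (hG : IsChain G) {f : PowerSeries ℂ}
    (hf : f ∈ Submodule.span ℂ (Set.range G)) (i : ℕ) :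
    X ^ i * f ∈ Submodule.span ℂ (Set.range G) := by
  induction i with
  | zero => simpa
  | succ i ih => rw [pow_succ', mul_assoc]; exact hG.X_mul_mem ih

theorem toSeries_normSq_pow_mul_radial (f : PowerSeries ℂ) (i : ℕ) :
    toSeries q m (normSq q m ^ i) * radial q m f = radial q m (X ^ i * f) := by
  induction i generalizing f with
  | zero => simp
  | succ i ih =>
    rw [pow_succ, map_mul, mul_assoc, toSeries_normSq_mul_radial, ih, pow_succ, mul_assoc]

theorem toSeries_mul_radial_mem_chainSpan {G : ℤ → PowerSeries ℂ} {k : ℕ} {S : Poly q m}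
    (hS : S ∈ harmonics q m k) {f : PowerSeries ℂ} (hf : f ∈ Submodule.span ℂ (Set.range G)) :
    toSeries q m S * radial q m f ∈ chainSpan q m G := by
  induction hf using Submodule.span_induction with
  | zero =>
    have := radial_smul (q := q) (m := m) 0 0
    rw [zero_smul, zero_smul] at this
    rw [this, mul_zero]; exact zero_mem _
  | add f g _ _ hf hg => rw [radial_add, mul_add]; exact add_mem hf hg
  | smul c f _ hf => rw [radial_smul, mul_smul_comm]; exact Submodule.smul_mem _ _ hf
  | mem f hf =>
    obtain ⟨n, rfl⟩ := hf
    exact Submodule.subset_span ⟨k, n, S, hS, rfl⟩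

theorem IsChain.mem_chainSpan (hq : 0 < q) (hq1 : q < 1) (hm : 1 ≤ m) {G : ℤ → PowerSeries ℂ}
    (hG : IsChain G) (P : Poly q m) (n : ℤ) :
    toSeries q m P * radial q m (G n) ∈ chainSpan q m G := by
  induction P using homog_induction with
  | add p r hp hr => rw [map_add, add_mul]; exact add_mem hp hr
  | homog d p hp =>
    have h := mem_span_harmonics hq hq1 hm hp
    clear hp
    induction h using Submodule.span_induction with
    | zero => rw [map_zero, zero_mul]; exact zero_mem _
    | add p r _ _ hp hr => rw [map_add, add_mul]; exact add_mem hp hr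
    | smul c p _ hp => rw [map_smul, smul_mul_assoc]; exact Submodule.smul_mem _ _ hp
    | mem p hp =>
      obtain ⟨k, j, S, -, hS, rfl⟩ := hp
      rw [← normSq_pow_comm hq, map_mul, mul_assoc, toSeries_normSq_pow_mul_radial]
      exact toSeries_mul_radial_mem_chainSpan hS
        (hG.X_pow_mul_mem (Submodule.subset_span ⟨n, rfl⟩) j)

theorem IsChain.exists_toSeries_mul {G : ℤ → PowerSeries ℂ} (hG : IsChain G) (P : Poly q m) (n : ℤ)
    (i : ℕ) : ∃ P', toSeries q m P * radial q m (G n) = toSeries q m P' * radial q m (G (n + i)) := by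
  induction i with
  | zero => exact ⟨P, by simp⟩
  | succ i ih =>
    obtain ⟨P', h⟩ := ih
    obtain ⟨c, -, hc⟩ := hG (n + i)
    refine ⟨P' + c • (P' * normSq q m), ?_⟩
    rw [h, hc, radial_add, radial_smul, ← toSeries_normSq_mul_radial, map_add, map_smul, map_mul,
      mul_add, add_mul, mul_smul_comm, smul_mul_assoc, mul_assoc, Nat.cast_succ, add_assoc]

/-- For a chain `G`, the products of polynomials with one of the `G j`, `j ≥ 0`, are the linear
combinations of the products of spherical harmonics with any of the `G n`, `n ∈ ℤ`. -/
theorem IsChain.mem_chainSpan_iff (hq : 0 < q) (hq1 : q < 1) (hm : 1 ≤ m) {G : ℤ → PowerSeries ℂ}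
    (hG : IsChain G) (f : Series q m) :
    f ∈ chainSpan q m G ↔ ∃ (j : ℕ) (P : Poly q m), toSeries q m P * radial q m (G j) = f := by
  constructor
  · intro hf
    induction hf using Submodule.span_induction with
    | zero => exact ⟨0, 0, by simp⟩
    | add f g _ _ hf hg =>
      obtain ⟨j, P, rfl⟩ := hf
      obtain ⟨j', P', rfl⟩ := hg
      obtain ⟨P1, h1⟩ := hG.exists_toSeries_mul P j j'
      obtain ⟨P2, h2⟩ := hG.exists_toSeries_mul P' j' j
      refine ⟨j + j', P1 + P2, ?_⟩
      rw [map_add, add_mul, h1, h2, Nat.cast_add, add_comm (j' : ℤ)]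
    | smul c f _ hf =>
      obtain ⟨j, P, rfl⟩ := hf
      exact ⟨j, c • P, by rw [map_smul, smul_mul_assoc]⟩
    | mem f hf =>
      obtain ⟨k, n, S, -, rfl⟩ := hf
      -- A negative index is raised to a nonnegative one at the expense of a polynomial.
      obtain ⟨P, h⟩ := hG.exists_toSeries_mul S n (n.natAbs - n).toNat
      refine ⟨n.natAbs, P, ?_⟩
      rw [h]
      congr 3
      omega
  · rintro ⟨j, P, rfl⟩
    exact hG.mem_chainSpan hq hq1 hm P j

theorem isChain_bigGauss (hq : 0 < q) (hq1 : q < 1) {β : ℝ} (hβ : 0 < β) :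
    IsChain fun n => bigGauss q m ((q ^ 2) ^ n * β) := by
  obtain ⟨hp, hp1⟩ := sq_pos_lt_one hq hq1
  have hμ := mu_pos (m := m) hq
  intro n
  have h0 : 0 < (q ^ 2) ^ n * β := mul_pos (zpow_pos hp n) hβ
  refine ⟨((-((1 - q ^ 2) * ((q ^ 2) ^ n * β / mu q m)) : ℝ) : ℂ), ?_, ?_⟩
  · have h1 : 0 < 1 - q ^ 2 := by linarith
    exact_mod_cast (neg_lt_zero.2 (by positivity)).ne
  · have h6 : (q ^ 2) ^ (n + 1) * β = (q ^ 2) ^ n * β * q ^ 2 := by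
      rw [zpow_add_one₀ hp.ne']; ring
    simp only [h6]
    generalize (q ^ 2) ^ n * β = b at *
    ext j
    rw [map_add, coeff_smul]
    rcases j with _ | j
    · simp [bigGauss, bigExpCoeff_zero]
    · rw [coeff_succ_X_mul]
      simp only [bigGauss, coeff_mk, smul_eq_mul]
      rw [← Complex.ofReal_mul, ← Complex.ofReal_add]
      congr 1
      have h3 := qNumber_succ_pos hp hp1 j
      rw [bigExpCoeff_succ]
      have h4 : q ^ 2 - 1 ≠ 0 := by linarith
      have h5 : (q ^ 2) ^ (j + 1) - 1 ≠ 0 := by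
        intro h; rw [h] at h3; simp at h3
      generalize q ^ 2 = p at *
      rw [show b * p / mu q m = b / mu q m * p by ring]
      generalize b / mu q m = d
      field_simp
      ring

theorem smallExpCoeff_succ {p : ℝ} (j : ℕ) :
    smallExpCoeff p (j + 1) = ((p ^ (j + 1) - 1) / (p - 1))⁻¹ * smallExpCoeff p j := by
  rw [smallExpCoeff, qFactorial_succ', mul_inv, smallExpCoeff]

theorem smallGauss_mul_sq (hq : 0 < q) (hq1 : q < 1) (b : ℝ) :
    smallGauss q m (b * q ^ 2) = smallGauss q m b
      + (((1 - q ^ 2) * (b * q ^ 2 / mu q m) : ℝ) : ℂ) • (X * smallGauss q m b) := by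
  obtain ⟨hp, hp1⟩ := sq_pos_lt_one hq hq1
  ext j
  rw [map_add, coeff_smul]
  rcases j with _ | j
  · simp [smallGauss]
  · rw [coeff_succ_X_mul]
    simp only [smallGauss, coeff_mk, smul_eq_mul]
    rw [← Complex.ofReal_mul, ← Complex.ofReal_add]
    congr 1
    have h3 := qNumber_succ_pos hp hp1 j
    rw [smallExpCoeff_succ]
    have h4 : q ^ 2 - 1 ≠ 0 := by linarith
    have h5 : (q ^ 2) ^ (j + 1) - 1 ≠ 0 := by
      intro h; rw [h] at h3; simp at h3
    generalize q ^ 2 = p at *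
    rw [show b * p * p / mu q m = b * p / mu q m * p by ring]
    generalize b * p / mu q m = d
    field_simp
    ring

theorem zpow_neg_succ_mul_sq (hq : 0 < q) (α : ℝ) (n : ℤ) :
    (q ^ 2) ^ (-n) * α = (q ^ 2) ^ (-(n + 1)) * α * q ^ 2 := by
  rw [mul_right_comm, ← zpow_add_one₀ (pow_pos hq 2).ne']; congr 2; ring

theorem isChain_smallGauss (hq : 0 < q) (hq1 : q < 1) {α : ℝ} (hα : 0 < α) :
    IsChain fun n => smallGauss q m ((q ^ 2) ^ (-n) * α) := by
  obtain ⟨hp, hp1⟩ := sq_pos_lt_one hq hq1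
  have hμ := mu_pos (m := m) hq
  intro n
  have h0 : 0 < (q ^ 2) ^ (-(n + 1)) * α := mul_pos (zpow_pos hp _) hα
  have h1 : 0 < 1 - q ^ 2 := by linarith
  have h2 : 0 < (1 - q ^ 2) * ((q ^ 2) ^ (-(n + 1)) * α * q ^ 2 / mu q m) := by positivity
  refine ⟨_, Complex.ofReal_ne_zero.2 h2.ne', ?_⟩
  simp only [zpow_neg_succ_mul_sq hq α n]
  exact smallGauss_mul_sq hq hq1 _

theorem mem_VBarClass_iff (hq : 0 < q) (hq1 : q < 1) (hm : 1 ≤ m) {β : ℝ} (hβ : 0 < β)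
    (f : Series q m) :
    f ∈ VBarClass q m β ↔ f ∈ chainSpan q m fun n => bigGauss q m ((q ^ 2) ^ n * β) := by
  rw [(isChain_bigGauss hq hq1 hβ).mem_chainSpan_iff hq hq1 hm]
  simp only [VBarClass, VBar, Set.mem_iUnion, Set.mem_range, zpow_natCast, pow_mul]

theorem mem_VClass_iff (hq : 0 < q) (hq1 : q < 1) (hm : 1 ≤ m) {α : ℝ} (hα : 0 < α)
    (f : Series q m) :
    f ∈ VClass q m α ↔ f ∈ chainSpan q m fun n => smallGauss q m ((q ^ 2) ^ (-n) * α) := by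
  rw [(isChain_smallGauss hq hq1 hα).mem_chainSpan_iff hq hq1 hm]
  simp only [VClass, V, Set.mem_iUnion, Set.mem_range, zpow_neg, zpow_natCast, pow_mul]

end GaussChain

/-! ### Integrals of polynomials times `q`-Gaussians -/

section Integral
variable {q : ℝ} {m : ℕ}
open PowerSeries

theorem sphereMean_add (hq : 0 < q) {g h : Series q m} {r : ℝ}
    (hg : Summable fun n : ℕ => (r : ℂ) ^ n * sphereInt q m (coeff n g))
    (hh : Summable fun n : ℕ => (r : ℂ) ^ n * sphereInt q m (coeff n h)) :
    sphereMean q m (g + h) r = sphereMean q m g r + sphereMean q m h r := by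
  simp only [sphereMean, map_add, sphereInt_add hq, mul_add]
  exact hg.tsum_add hh

theorem sphereMean_smul (c : ℂ) (g : Series q m) (r : ℝ) :
    sphereMean q m (c • g) r = c * sphereMean q m g r := by
  simp only [sphereMean, coeff_smul, sphereInt_smul, mul_left_comm _ c, tsum_mul_left]

theorem Converges.add (hq : 0 < q) {γ : ℝ} {g h : Series q m} (hg : Converges q m γ g)
    (hh : Converges q m γ h) : Converges q m γ (g + h) := by
  constructor
  · intro r
    simpa only [map_add, sphereInt_add hq, mul_add] using (hg.1 r).add (hh.1 r)
  · refine (hg.2.add hh.2).congr fun k => ?_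
    rw [sphereMean_add hq (hg.1 _) (hh.1 _)]
    ring

theorem Converges.smul {γ : ℝ} {g : Series q m} (c : ℂ) (hg : Converges q m γ g) :
    Converges q m γ (c • g) := by
  constructor
  · intro r
    simpa only [coeff_smul, sphereInt_smul, mul_left_comm _ c] using (hg.1 r).mul_left c
  · refine (hg.2.mul_left c).congr fun k => ?_
    rw [sphereMean_smul]
    ring

theorem integral_add (hq : 0 < q) {γ : ℝ} {g h : Series q m} (hg : Converges q m γ g)
    (hh : Converges q m γ h) :
    integral q m γ (g + h) = integral q m γ g + integral q m γ h := by
  rw [integral, integral, integral, jackson, jackson, jackson, ← mul_add, ← hg.2.tsum_add hh.2]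
  congr 1
  refine tsum_congr fun k => ?_
  rw [sphereMean_add hq (hg.1 _) (hh.1 _)]
  ring

theorem integral_smul {γ : ℝ} (c : ℂ) (g : Series q m) :
    integral q m γ (c • g) = c * integral q m γ g := by
  rw [integral, integral, jackson, jackson, mul_left_comm c]
  refine congrArg _ ?_
  rw [← tsum_mul_left]
  refine tsum_congr fun k => ?_
  rw [sphereMean_smul]
  ring

theorem hasSum_sphereMean (hq : 0 < q) (hq1 : q < 1) (hm : 1 ≤ m) {d : ℕ} {R : Poly q m}
    (hR : R ∈ homog q m d) {f : PowerSeries ℂ} {r : ℝ} {v : ℂ}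
    (hf : HasSum (fun i => coeff i f * (r : ℂ) ^ (2 * i)) v) :
    HasSum (fun n : ℕ => (r : ℂ) ^ n * sphereInt q m (coeff n (toSeries q m R * radial q m f)))
      ((r : ℂ) ^ d * v * sphereInt q m R) := by
  have hinj : Function.Injective fun i : ℕ => d + 2 * i := fun i j h => by simpa using h
  refine (hinj.hasSum_iff ?_).1 ?_
  · intro n hn
    rw [coeff_toSeries_mul_radial_of_ne hR _ fun i hi => hn ⟨i, hi.symm⟩]
    have := sphereInt_smul (q := q) (m := m) 0 0
    rw [zero_smul, zero_mul] at this
    rw [this, mul_zero]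
  · refine ((hf.mul_left ((r : ℂ) ^ d)).mul_right (sphereInt q m R)).congr_fun fun i => ?_
    simp only [Function.comp]
    rw [coeff_toSeries_mul_radial hq hR, sphereInt_smul, sphereInt_normSq_pow_mul hq hq1 hm hR,
      pow_add]
    ring

theorem hasSum_bigGauss (hq : 0 < q) (hq1 : q < 1) (β r : ℝ) :
    HasSum (fun i => coeff i (bigGauss q m β) * (r : ℂ) ^ (2 * i))
      ((bigExp (q ^ 2) (-(β / mu q m * r ^ 2)) : ℝ) : ℂ) := by
  obtain ⟨hp, hp1⟩ := sq_pos_lt_one hq hq1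
  have h := (summable_bigExp hp hp1 (-(β / mu q m * r ^ 2))).hasSum
  refine (Complex.hasSum_ofReal.2 h).congr_fun fun i => ?_
  rw [bigGauss, coeff_mk, ← Complex.ofReal_pow, ← Complex.ofReal_mul]
  congr 1
  rw [pow_mul, mul_assoc, ← mul_pow, neg_mul]

theorem sq_rpow_half (hq : 0 < q) (n : ℕ) : (q ^ 2) ^ ((n : ℝ) / 2) = q ^ n := by
  rw [← Real.rpow_natCast, ← Real.rpow_mul hq.le, ← Real.rpow_natCast]
  congr 1; push_cast; ring

theorem scale_pos (hq : 0 < q) (hq1 : q < 1) {β : ℝ} (hβ : 0 < β) : 0 < scale q m β := by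
  obtain ⟨hp, hp1⟩ := sq_pos_lt_one hq hq1
  have hμ := mu_pos (m := m) hq
  have : 0 < 1 - q ^ 2 := by linarith
  exact Real.sqrt_pos.2 (by positivity)

theorem scale_sq (hq : 0 < q) (hq1 : q < 1) {β : ℝ} (hβ : 0 < β) :
    scale q m β ^ 2 = mu q m / ((1 - q ^ 2) * β) := by
  obtain ⟨hp, hp1⟩ := sq_pos_lt_one hq hq1
  have hμ := mu_pos (m := m) hq
  have : 0 < 1 - q ^ 2 := by linarith
  exact Real.sq_sqrt (by positivity)

/-- The Jackson integral of a homogeneous polynomial times a `q`-Gaussian is a moment of `E_{q²}`: at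
the scale `√(μ / ((1 - q²) β))` the `q`-Gaussian is evaluated at the points `-q^{2N} / (1 - q²)`. -/
theorem hasSum_integral_bigGauss (hq : 0 < q) (hq1 : q < 1) (hm : 1 ≤ m) {d : ℕ} {R : Poly q m}
    (hR : R ∈ homog q m d) {β : ℝ} (hβ : 0 < β) (n : ℤ) {a : ℝ} (ha : a = ((m + d : ℕ) : ℝ) / 2) :
    HasSum (fun k : ℤ => (((q ^ k * scale q m β : ℝ) : ℂ) ^ (m - 1) *
        sphereMean q m (toSeries q m R * radial q m (bigGauss q m ((q ^ 2) ^ n * β)))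
          (q ^ k * scale q m β)) * ((q ^ k : ℝ) : ℂ))
      (((scale q m β ^ (m + d - 1) * ((((q ^ 2) ^ a) ^ n)⁻¹ *
        ((q ^ 2) ^ a * (qGamma (q ^ 2) a * (1 - q ^ 2) ^ (a - 1)))) : ℝ) : ℂ) *
          sphereInt q m R) := by
  obtain ⟨hp, hp1⟩ := sq_pos_lt_one hq hq1
  have hμ := mu_pos (m := m) hq
  have h1 : 0 < 1 - q ^ 2 := by linarith
  have ha0 : 0 < a := by rw [ha]; have : 0 < m + d := by omega
                         positivity
  have hpa : 0 < (q ^ 2) ^ a := Real.rpow_pos_of_pos hp a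
  have hpa' : (q ^ 2) ^ a = q ^ (m + d) := by rw [ha, sq_rpow_half hq]
  have h := (Equiv.addRight n).hasSum_iff.2 (hasSum_bigExp_moment hp hp1 ha0)
  have h2 := (h.mul_left ((((q ^ 2) ^ a) ^ n)⁻¹)).mul_left (scale q m β ^ (m + d - 1))
  refine ((Complex.hasSum_ofReal.2 h2).mul_right (sphereInt q m R)).congr_fun fun k => ?_
  rw [sphereMean, (hasSum_sphereMean hq hq1 hm hR (hasSum_bigGauss hq hq1 _ _)).tsum_eq]
  simp only [Function.comp, Equiv.coe_addRight]
  have h3 : (q ^ 2) ^ n * β / mu q m * (q ^ k * scale q m β) ^ 2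
      = (q ^ 2) ^ (k + n) / (1 - q ^ 2) := by
    rw [mul_pow, scale_sq hq hq1 hβ, zpow_add₀ hp.ne', show (q ^ k) ^ 2 = (q ^ 2) ^ k by
      rw [← zpow_natCast, ← zpow_natCast, ← zpow_mul, ← zpow_mul, mul_comm]]
    field_simp
  rw [h3, zpow_add₀ hpa.ne', hpa']
  have h4 : (q ^ k) ^ (m + d) = (q ^ (m + d)) ^ k := by
    rw [← zpow_natCast, ← zpow_natCast, ← zpow_mul, ← zpow_mul, mul_comm]
  have h5 : (q ^ k * scale q m β) ^ (m - 1) * (q ^ k * scale q m β) ^ d * q ^ k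
      = scale q m β ^ (m + d - 1) * (q ^ (m + d)) ^ k := by
    rw [← pow_add, show m - 1 + d = m + d - 1 by omega, mul_pow, ← h4]
    obtain ⟨e, he⟩ : ∃ e, m + d = e + 1 := ⟨m + d - 1, by omega⟩
    rw [he, Nat.add_sub_cancel, pow_succ]
    ring
  have h6 : (q ^ (m + d)) ^ n ≠ 0 := (zpow_pos (pow_pos hq _) n).ne'
  have h7 : scale q m β ^ (m + d - 1) * (((q ^ (m + d)) ^ n)⁻¹ * ((q ^ (m + d)) ^ k
        * (q ^ (m + d)) ^ n * bigExp (q ^ 2) (-((q ^ 2) ^ (k + n) / (1 - q ^ 2)))))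
      = (q ^ k * scale q m β) ^ (m - 1) * (q ^ k * scale q m β) ^ d * q ^ k
        * bigExp (q ^ 2) (-((q ^ 2) ^ (k + n) / (1 - q ^ 2))) := by
    rw [h5]; field_simp
  rw [h7]
  push_cast
  ring

theorem integral_bigGauss (hq : 0 < q) (hq1 : q < 1) (hm : 1 ≤ m) {d : ℕ} {R : Poly q m}
    (hR : R ∈ homog q m d) {β : ℝ} (hβ : 0 < β) (n : ℤ) {a : ℝ} (ha : a = ((m + d : ℕ) : ℝ) / 2) :
    integral q m (scale q m β) (toSeries q m R * radial q m (bigGauss q m ((q ^ 2) ^ n * β)))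
      = (((q ^ 2 * mu q m / ((q ^ 2) ^ n * β)) ^ a * qGamma (q ^ 2) a / (1 + q) : ℝ) : ℂ)
        * sphereInt q m R := by
  obtain ⟨hp, hp1⟩ := sq_pos_lt_one hq hq1
  have hμ := mu_pos (m := m) hq
  have h1 : 0 < 1 - q ^ 2 := by linarith
  have hγ := scale_pos (m := m) hq hq1 hβ
  rw [integral, jackson, (hasSum_integral_bigGauss hq hq1 hm hR hβ n ha).tsum_eq, ← mul_assoc,
    ← Complex.ofReal_mul]
  congr 2
  have h2 : scale q m β * scale q m β ^ (m + d - 1) = (mu q m / ((1 - q ^ 2) * β)) ^ a := by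
    rw [← pow_succ', show m + d - 1 + 1 = m + d by omega, ← scale_sq hq hq1 hβ, ha,
      sq_rpow_half hγ]
  have h3 : ((q ^ 2) ^ n : ℝ) ^ a = ((q ^ 2) ^ a) ^ n := by
    rw [← Real.rpow_intCast, ← Real.rpow_intCast, ← Real.rpow_mul hp.le, ← Real.rpow_mul hp.le,
      mul_comm]
  have h4 : 0 < (q ^ 2) ^ n := zpow_pos hp n
  rw [show (1 - q) * scale q m β * (scale q m β ^ (m + d - 1) * ((((q ^ 2) ^ a) ^ n)⁻¹ *
        ((q ^ 2) ^ a * (qGamma (q ^ 2) a * (1 - q ^ 2) ^ (a - 1)))))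
      = (1 - q) * (scale q m β * scale q m β ^ (m + d - 1)) * ((((q ^ 2) ^ a) ^ n)⁻¹ *
        ((q ^ 2) ^ a * (qGamma (q ^ 2) a * (1 - q ^ 2) ^ (a - 1)))) by ring, h2, ← h3,
    Real.div_rpow hμ.le (by positivity), Real.mul_rpow h1.le hβ.le,
    Real.div_rpow (by positivity) (by positivity), Real.mul_rpow hp.le hμ.le,
    Real.mul_rpow h4.le hβ.le, Real.rpow_sub_one h1.ne']
  have e1 := (Real.rpow_pos_of_pos h1 a).ne'
  have e2 := (Real.rpow_pos_of_pos hβ a).ne'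
  have e3 := (Real.rpow_pos_of_pos h4 a).ne'
  have e4 : 1 + q ≠ 0 := by positivity
  have e5 := h1.ne'
  generalize (1 - q ^ 2) ^ a = x1 at *
  generalize ((q ^ 2) ^ n) ^ a = x2 at *
  generalize β ^ a = x3 at *
  field_simp
  ring

theorem converges_bigGauss (hq : 0 < q) (hq1 : q < 1) (hm : 1 ≤ m) {β : ℝ} (hβ : 0 < β) (n : ℤ)
    (P : Poly q m) : Converges q m (scale q m β)
      (toSeries q m P * radial q m (bigGauss q m ((q ^ 2) ^ n * β))) := by
  induction P using homog_induction with
  | add p r hp hr => rw [map_add, add_mul]; exact hp.add hq hr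
  | homog d p hp =>
    exact ⟨fun r => (hasSum_sphereMean hq hq1 hm hp (hasSum_bigGauss hq hq1 _ _)).summable,
      (hasSum_integral_bigGauss hq hq1 hm hp hβ n rfl).summable⟩

theorem converges_of_mem_chainSpan (hq : 0 < q) (hq1 : q < 1) (hm : 1 ≤ m) {β : ℝ} (hβ : 0 < β)
    {f : Series q m} (hf : f ∈ chainSpan q m fun n => bigGauss q m ((q ^ 2) ^ n * β))
    (p : Poly q m) : Converges q m (scale q m β) (f * toSeries q m p) := by
  induction hf using Submodule.span_induction with
  | zero =>
    have := (converges_bigGauss (m := m) hq hq1 hm hβ 0 1).smul 0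
    rw [zero_smul] at this
    rwa [zero_mul]
  | add f g _ _ hf hg => rw [add_mul]; exact hf.add hq hg
  | smul c f _ hf => rw [smul_mul_assoc]; exact hf.smul c
  | mem f hf =>
    obtain ⟨k, n, S, -, rfl⟩ := hf
    rw [mul_assoc, radial_comm hq, ← mul_assoc, ← map_mul]
    exact converges_bigGauss hq hq1 hm hβ n _

end Integral

/-! ### The first transform -/

section FirstTransform
variable {q : ℝ} {m : ℕ}
open PowerSeries

theorem isLinearMap_integral_mul (hq : 0 < q) {γ : ℝ} {f : Series q m}
    (hf : ∀ p, Converges q m γ (f * toSeries q m p)) :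
    IsLinearMap ℂ fun p => integral q m γ (f * toSeries q m p) where
  map_add p r := by rw [map_add, mul_add, integral_add hq (hf p) (hf r)]
  map_smul c p := by rw [map_smul, mul_smul_comm, integral_smul, smul_eq_mul]

theorem contract_tmul {φ : Poly q m → ℂ} (h : IsLinearMap ℂ φ) (p r : Poly q m) :
    contract q m φ (p ⊗ₜ r) = φ p • r := by
  rw [contract, dif_pos h]
  simp

theorem contract_add {φ ψ : Poly q m → ℂ} (hφ : IsLinearMap ℂ φ) (hψ : IsLinearMap ℂ ψ)
    (z : Poly q m ⊗[ℂ] Poly q m) :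
    contract q m (φ + ψ) z = contract q m φ z + contract q m ψ z := by
  have h : IsLinearMap ℂ (φ + ψ) := (hφ.mk' φ + hψ.mk' ψ).isLinear
  induction z with
  | zero => simp
  | add x y hx hy => rw [map_add, map_add, map_add, hx, hy]; abel
  | tmul p r => rw [contract_tmul h, contract_tmul hφ, contract_tmul hψ, Pi.add_apply, add_smul]

theorem contract_smul {φ : Poly q m → ℂ} (hφ : IsLinearMap ℂ φ) (c : ℂ)
    (z : Poly q m ⊗[ℂ] Poly q m) : contract q m (c • φ) z = c • contract q m φ z := by
  have h : IsLinearMap ℂ (c • φ) := (c • hφ.mk' φ).isLinear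
  induction z with
  | zero => simp
  | add x y hx hy => rw [map_add, map_add, hx, hy, smul_add]
  | tmul p r => rw [contract_tmul h, contract_tmul hφ, Pi.smul_apply, smul_assoc]

theorem firstFourier_add (hq : 0 < q) {s : ℂ} {β : ℝ} {f g : Series q m}
    (hf : ∀ p, Converges q m (scale q m β) (f * toSeries q m p))
    (hg : ∀ p, Converges q m (scale q m β) (g * toSeries q m p)) :
    firstFourier q m s β (f + g) = firstFourier q m s β f + firstFourier q m s β g := by
  have h : (fun p => integral q m (scale q m β) ((f + g) * toSeries q m p))
      = (fun p => integral q m (scale q m β) (f * toSeries q m p))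
        + fun p => integral q m (scale q m β) (g * toSeries q m p) := by
    funext p
    rw [add_mul, integral_add hq (hf p) (hg p), Pi.add_apply]
  ext l
  simp only [firstFourier, coeff_mk, map_add]
  rw [h, contract_add (isLinearMap_integral_mul hq hf) (isLinearMap_integral_mul hq hg), smul_add]

theorem firstFourier_smul (hq : 0 < q) {s : ℂ} {β : ℝ} {f : Series q m} (c : ℂ)
    (hf : ∀ p, Converges q m (scale q m β) (f * toSeries q m p)) :
    firstFourier q m s β (c • f) = c • firstFourier q m s β f := by
  have h : (fun p => integral q m (scale q m β) ((c • f) * toSeries q m p))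
      = c • fun p => integral q m (scale q m β) (f * toSeries q m p) := by
    funext p
    rw [smul_mul_assoc, integral_smul, Pi.smul_apply, smul_eq_mul]
  ext l
  simp only [firstFourier, coeff_mk, coeff_smul]
  rw [h, contract_smul (isLinearMap_integral_mul hq hf), smul_comm]

/-- The Bochner relations of the first transform. In degree `k + 2j` in `y` the integral over the sphere
is a multiple of the pairing with `x^{2j} S`, which the Fourier kernel turns into `y^{2j} S(y)`; the
factors `Γ_{q²}(m/2 + k + j)` of the radial and of the spherical integral cancel, and the remaining
series in `j` is that of `e_{q²}`. -/
theorem firstFourier_harmonic_mul_bigGauss (hq : 0 < q) (hq1 : q < 1) (hm : 1 ≤ m) {β : ℝ}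
    (hβ : 0 < β) {s : ℂ} (hs : s ^ 2 = -1) (n : ℤ) {k : ℕ} {S : Poly q m}
    (hS : S ∈ harmonics q m k) :
    firstFourier q m s β (toSeries q m S * radial q m (bigGauss q m ((q ^ 2) ^ n * β)))
      = (s ^ k * (((q ^ 2 / ((q ^ 2) ^ n * β)) ^ ((m : ℝ) / 2 + k) : ℝ) : ℂ)) •
        (toSeries q m S * radial q m (smallGauss q m (1 / ((q ^ 2) ^ n * β)))) := by
  obtain ⟨hp, hp1⟩ := sq_pos_lt_one hq hq1
  have hμ := mu_pos (m := m) hq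
  have hlin := isLinearMap_integral_mul (m := m) (γ := scale q m β) hq
    (f := toSeries q m S * radial q m (bigGauss q m ((q ^ 2) ^ n * β))) fun p => by
      rw [mul_assoc, radial_comm hq, ← mul_assoc, ← map_mul]
      exact converges_bigGauss hq hq1 hm hβ n _
  have hb : 0 < (q ^ 2) ^ n * β := mul_pos (zpow_pos hp n) hβ
  have hint (l : ℕ) (r : Poly q m) (hr : r ∈ homog q m l) := integral_bigGauss hq hq1 hm
    (mul_mem_homog hS.1 hr) hβ n rfl
  ext l
  rw [firstFourier, coeff_mk, map_smul, coeff_smul]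
  by_cases hl : ∃ j, l = k + 2 * j
  · obtain ⟨j, rfl⟩ := hl
    rw [coeff_toSeries_mul_radial hq hS.1]
    have ha : ((m + (k + (k + 2 * j)) : ℕ) : ℝ) / 2 = m / 2 + k + j := by push_cast; ring
    have ha0 : (0 : ℝ) < m / 2 + k + j := by
      have : (0 : ℝ) < m := by exact_mod_cast hm
      positivity
    rw [contract_kernel hq hq1 (k + 2 * j) hlin
      (p := (((q ^ 2 * mu q m / ((q ^ 2) ^ n * β)) ^ ((m : ℝ) / 2 + k + j)
        * qGamma (q ^ 2) (m / 2 + k + j) / (1 + q) *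
        (2 * qGamma (q ^ 2) (1 / 2) ^ m / (mu q m ^ (k + 2 * j) * qFactorial (q ^ 2) j
          * qGamma (q ^ 2) (m / 2 + k + j))) : ℝ) : ℂ) • (normSq q m ^ j * S))]
    · rw [smul_smul, smul_smul, smul_smul]
      congr 1
      have hs2 : s ^ (k + 2 * j) = s ^ k * ((-1 : ℝ) : ℂ) ^ j := by
        rw [pow_add, pow_mul, hs]; push_cast; ring
      rw [smallGauss, coeff_mk, hs2]
      have key : (1 + q) / (2 * mu q m ^ ((m : ℝ) / 2) * qGamma (q ^ 2) (1 / 2) ^ m) * (-1) ^ j *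
          ((q ^ 2 * mu q m / ((q ^ 2) ^ n * β)) ^ ((m : ℝ) / 2 + k + j)
        * qGamma (q ^ 2) (m / 2 + k + j) / (1 + q) *
        (2 * qGamma (q ^ 2) (1 / 2) ^ m / (mu q m ^ (k + 2 * j) * qFactorial (q ^ 2) j
          * qGamma (q ^ 2) (m / 2 + k + j))))
          = (q ^ 2 / ((q ^ 2) ^ n * β)) ^ ((m : ℝ) / 2 + k) * (smallExpCoeff (q ^ 2) j *
            (-(1 / ((q ^ 2) ^ n * β) * q ^ 2 / mu q m)) ^ j) := by
        have g1 := (qGamma_pos hp hp1 ha0).ne'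
        have g2 := (qGamma_pos hp hp1 (show (0 : ℝ) < 1 / 2 by norm_num)).ne'
        have g3 := (qFactorial_pos hq hq1 j).ne'
        have g4 := (Real.rpow_pos_of_pos hμ (m / 2)).ne'
        have g5 : 1 + q ≠ 0 := by positivity
        generalize qGamma (q ^ 2) (m / 2 + k + j) = G at *
        generalize qGamma (q ^ 2) (1 / 2) = G' at *
        generalize (q ^ 2) ^ n * β = b at *
        generalize q ^ 2 = p at *
        rw [show p * mu q m / b = (p / b) * mu q m by ring, Real.mul_rpow (by positivity) hμ.le,
          Real.rpow_add_natCast (by positivity), Real.rpow_add_natCast hμ.ne', Real.rpow_add_natCast hμ.ne',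
          smallExpCoeff, show 1 / b * p / mu q m = p / b / mu q m by ring]
        generalize p / b = x at *
        rw [neg_pow (x / _), div_pow]
        have g6 := hμ.ne'
        generalize mu q m = μ at *
        field_simp
        ring
      have key' := congrArg (Complex.ofReal) key
      rw [Complex.ofReal_mul, Complex.ofReal_mul, Complex.ofReal_mul _ (_ * _)] at key'
      rw [mul_assoc (s ^ k), ← key']
      push_cast
      ring
    · exact Submodule.smul_mem _ _ (by simpa using normSq_pow_mul_mem_homog j hS.1)
    · intro r hr
      rw [mul_assoc, radial_comm hq, ← mul_assoc, ← map_mul, hint _ r hr, ha,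
        sphereInt_harmonic_mul hq hq1 hS hr, ← mul_assoc, ← Complex.ofReal_mul, map_smul,
        LinearMap.smul_apply, smul_eq_mul]
  · push Not at hl
    rw [coeff_toSeries_mul_radial_of_ne hS.1 _ hl, smul_zero,
      contract_kernel hq hq1 l hlin (p := 0) (zero_mem _), smul_zero, smul_zero]
    intro r hr
    rw [mul_assoc, radial_comm hq, ← mul_assoc, ← map_mul, hint _ r hr,
      sphereInt_harmonic_mul_of_ne hq hq1 hS hr hl, mul_zero, map_zero, LinearMap.zero_apply]

end FirstTransform

/-! ### The Bochner relations -/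

section BochnerGraph
variable {q : ℝ} {m : ℕ}
open PowerSeries

/-- The uniqueness of the decomposition into spherical harmonics. -/
theorem eq_zero_of_sum_normSq_pow_mul (hq : 0 < q) (hq1 : q < 1) (hm : 1 ≤ m) (M : ℕ)
    {κ : ℕ → ℕ} {U : ℕ → Poly q m} (hU : ∀ i, U i ∈ harmonics q m (κ i))
    (h : ∑ i ∈ Finset.range M, normSq q m ^ i * U i = 0) : ∀ i < M, U i = 0 := by
  have hpow (j : ℕ) {k : ℕ} {S : Poly q m} (hS : S ∈ harmonics q m k) :
      ∃ c : ℂ, c ≠ 0 ∧ (laplace q m ^ j) (normSq q m ^ j * S) = c • S := by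
    induction j with
    | zero => exact ⟨1, one_ne_zero, by simp⟩
    | succ j ih =>
      obtain ⟨c, hc, h⟩ := ih
      refine ⟨((mu q m ^ 2 * brk q (j + 1) * brkHalf q m (k + j) : ℝ) : ℂ) * c,
        mul_ne_zero ?_ hc, ?_⟩
      · have h1 := mu_pos (m := m) hq
        have h2 := brk_succ_pos hq hq1 j
        have h3 := brkHalf_pos hq hq1 hm (k + j)
        have h4 : 0 < mu q m ^ 2 * brk q (j + 1) * brkHalf q m (k + j) := by positivity
        exact_mod_cast h4.ne'
      · rw [pow_succ, Module.End.mul_apply, laplace_normSq_pow_mul hq hq1 hm hS, map_smul, h,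
          smul_smul]
  have hzero (i t : ℕ) (hit : i < t) {k : ℕ} {S : Poly q m} (hS : S ∈ harmonics q m k) :
      (laplace q m ^ t) (normSq q m ^ i * S) = 0 := by
    obtain ⟨e, rfl⟩ := Nat.exists_eq_add_of_lt hit
    obtain ⟨c, -, h⟩ := hpow i hS
    rw [show i + e + 1 = e + (1 + i) by ring, pow_add, pow_add, pow_one, Module.End.mul_apply,
      Module.End.mul_apply, h, map_smul, show laplace q m S = 0 from hS.2, smul_zero, map_zero]
  induction M with
  | zero => simp
  | succ M ih =>
    have h1 := congrArg (laplace q m ^ M) h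
    obtain ⟨c, hc, h2⟩ := hpow M (hU M)
    rw [map_zero, map_sum, Finset.sum_range_succ, h2,
      Finset.sum_eq_zero fun i hi => hzero i M (Finset.mem_range.1 hi) (hU i), zero_add] at h1
    have h3 : U M = 0 := (smul_eq_zero.1 h1).resolve_left hc
    rw [Finset.sum_range_succ, h3, mul_zero, add_zero] at h
    intro i hi
    rcases Nat.lt_succ_iff_lt_or_eq.1 hi with hi | rfl
    · exact ih h i hi
    · exact h3

theorem coeff_toSeries_mul_radial_eq_sum (hq : 0 < q) {k : ℕ} {S : Poly q m}
    (hS : S ∈ homog q m k) (f : PowerSeries ℂ) (d : ℕ) :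
    coeff d (toSeries q m S * radial q m f) = ∑ i ∈ Finset.range (d + 1),
      normSq q m ^ i * (if k + 2 * i = d then coeff i f • S else 0) := by
  by_cases hd : ∃ j, d = k + 2 * j
  · obtain ⟨j, rfl⟩ := hd
    rw [coeff_toSeries_mul_radial hq hS, Finset.sum_eq_single j]
    · rw [if_pos rfl, mul_smul_comm]
    · intro i _ hi
      rw [if_neg (by omega), mul_zero]
    · intro h
      exact absurd (Finset.mem_range.2 (by omega)) h
  · push Not at hd
    rw [coeff_toSeries_mul_radial_of_ne hS _ hd, Finset.sum_eq_zero]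
    intro i _
    rw [if_neg (fun h => hd i h.symm), mul_zero]

/-- If a sum of products of spherical harmonics and `q`-Gaussians vanishes, then so does every sum
that is obtained from it by changing the radial functions, in each degree of the harmonics. -/
theorem sum_toSeries_mul_radial_eq_zero (hq : 0 < q) (hq1 : q < 1) (hm : 1 ≤ m) {ι : Type*}
    [Fintype ι] {k : ι → ℕ} {n : ι → ℤ} {S : ι → Poly q m} (hS : ∀ a, S a ∈ harmonics q m (k a))
    {G : ℤ → PowerSeries ℂ} {r : ℕ → ℂ} {lam : ℤ → ℂ} (hr : ∀ i, r i ≠ 0)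
    (hlam : Function.Injective lam) (hG : ∀ n i, coeff i (G n) = r i * lam n ^ i)
    (h : ∑ a, toSeries q m (S a) * radial q m (G (n a)) = 0) (F : ℕ → ℤ → PowerSeries ℂ) :
    ∑ a, toSeries q m (S a) * radial q m (F (k a) (n a)) = 0 := by
  classical
  have hsw (f : ι → PowerSeries ℂ) (d : ℕ) :
      coeff d (∑ a, toSeries q m (S a) * radial q m (f a)) = ∑ i ∈ Finset.range (d + 1),
        normSq q m ^ i * ∑ a, (if k a + 2 * i = d then coeff i (f a) • S a else 0) := by
    rw [map_sum]
    simp only [Finset.mul_sum]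
    rw [Finset.sum_comm]
    exact Finset.sum_congr rfl fun a _ => coeff_toSeries_mul_radial_eq_sum hq (hS a).1 _ _
  -- For each degree `K` of the harmonics, all power sums weighted with `lam (n a) ^ i` vanish.
  have h1 (K i : ℕ) : ∑ a, (if k a = K then lam (n a) ^ i • S a else 0) = 0 := by
    have h2 := hsw (fun a => G (n a)) (K + 2 * i)
    rw [h, map_zero] at h2
    have h3 := eq_zero_of_sum_normSq_pow_mul hq hq1 hm (K + 2 * i + 1)
      (κ := fun j => K + 2 * i - 2 * j) (fun j => Submodule.sum_mem _ fun a _ => ?_) h2.symm i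
      (by omega)
    · have h4 : r i • ∑ a, (if k a = K then lam (n a) ^ i • S a else 0) = 0 := by
        refine Eq.trans ?_ h3
        rw [Finset.smul_sum]
        refine Finset.sum_congr rfl fun a _ => ?_
        by_cases hk : k a = K
        · rw [if_pos hk, if_pos (by omega), hG, smul_smul]
        · rw [if_neg hk, if_neg (by omega), smul_zero]
      exact (smul_eq_zero.1 h4).resolve_left (hr i)
    · split_ifs with hk
      · refine Submodule.smul_mem _ _ ?_
        rw [← hk, Nat.add_sub_cancel]
        exact hS a
      · exact zero_mem _
  -- By linearity the weights may be the values of any polynomial at `lam (n a)`.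
  have h2 (K : ℕ) (p : Polynomial ℂ) :
      ∑ a, (if k a = K then p.eval (lam (n a)) • S a else 0) = 0 := by
    induction p using Polynomial.induction_on' with
    | add p r hp hr =>
      refine Eq.trans ?_ ((congrArg₂ (· + ·) hp hr).trans (add_zero 0))
      rw [← Finset.sum_add_distrib]
      refine Finset.sum_congr rfl fun a _ => ?_
      split_ifs
      · rw [Polynomial.eval_add, add_smul]
      · rw [add_zero]
    | monomial i c =>
      refine Eq.trans ?_ ((congrArg (c • ·) (h1 K i)).trans (smul_zero c))
      simp only [Finset.smul_sum]
      refine Finset.sum_congr rfl fun a _ => ?_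
      split_ifs
      · rw [Polynomial.eval_monomial, mul_smul]
      · rw [smul_zero]
  -- As the numbers `lam n` are different, arbitrary weights are interpolated by a polynomial.
  have h3 (K : ℕ) (ψ : ℤ → ℂ) : ∑ a, (if k a = K then ψ (n a) • S a else 0) = 0 := by
    refine Eq.trans ?_ (h2 K (Lagrange.interpolate (Finset.univ.image n) lam ψ))
    refine Finset.sum_congr rfl fun a _ => ?_
    rw [Lagrange.eval_interpolate_at_node _ hlam.injOn
      (Finset.mem_image_of_mem _ (Finset.mem_univ a))]
  ext d
  rw [hsw (fun a => F (k a) (n a)), map_zero]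
  refine Finset.sum_eq_zero fun i hi => ?_
  have h4 : ∑ a, (if k a + 2 * i = d then coeff i (F (k a) (n a)) • S a else 0) = 0 := by
    rcases Nat.lt_or_ge d (2 * i) with hd | hd
    · exact Finset.sum_eq_zero fun a _ => if_neg (by omega)
    · refine Eq.trans ?_ (h3 (d - 2 * i) fun l => coeff i (F (d - 2 * i) l))
      refine Finset.sum_congr rfl fun a _ => ?_
      by_cases hk : k a = d - 2 * i
      · rw [if_pos hk, if_pos (by omega), hk]
      · rw [if_neg hk, if_neg (by omega)]
  rw [h4, mul_zero]

/-- The graph spanned by the Bochner relations between the two families of `q`-Gaussians. -/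
noncomputable def bochnerGraph (q : ℝ) (m : ℕ) (s : ℂ) (α : ℝ) :
    Submodule ℂ (Series q m × Series q m) :=
  Submodule.span ℂ {z | ∃ (k : ℕ) (n : ℤ) (S : Poly q m), S ∈ harmonics q m k ∧
    z = (toSeries q m S * radial q m (smallGauss q m ((q ^ 2) ^ (-n) * α)),
      toSeries q m S * radial q m ((s ^ k *
        (((1 / ((q ^ 2) ^ (-n) * α * q ^ 2)) ^ ((m : ℝ) / 2 + k) : ℝ) : ℂ)) •
          bigGauss q m (1 / ((q ^ 2) ^ (-n) * α))))}

/-- The Bochner relations are consistent: the coefficients of degree `i` of the `q`-Gaussians are a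
nonzero constant times the `i`-th powers of the pairwise different numbers `q^{-2n}`. -/
theorem eq_zero_of_mem_bochnerGraph (hq : 0 < q) (hq1 : q < 1) (hm : 1 ≤ m) {s : ℂ} {α : ℝ}
    (hα : 0 < α) {g : Series q m} (h : (0, g) ∈ bochnerGraph q m s α) : g = 0 := by
  obtain ⟨hp, hp1⟩ := sq_pos_lt_one hq hq1
  have hμ := mu_pos (m := m) hq
  obtain ⟨N, c, v, hv⟩ := Submodule.mem_span_set'.1 h
  choose k n S hS hz using fun a => (v a).2
  have h1 := congrArg Prod.fst hv
  have h2 := congrArg Prod.snd hv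
  rw [Prod.fst_sum] at h1
  rw [Prod.snd_sum] at h2
  simp only [Prod.smul_fst, Prod.smul_snd, hz] at h1 h2
  rw [← h2]
  have h3 := sum_toSeries_mul_radial_eq_zero hq hq1 hm (S := fun a => c a • S a) (k := k) (n := n)
    (fun a => Submodule.smul_mem _ _ (hS a))
    (G := fun n => smallGauss q m ((q ^ 2) ^ (-n) * α))
    (r := fun i => ((smallExpCoeff (q ^ 2) i * (-(α * q ^ 2 / mu q m)) ^ i : ℝ) : ℂ))
    (lam := fun n => (((q ^ 2) ^ (-n) : ℝ) : ℂ)) (fun i => ?_) (fun a b hab => ?_) (fun n i => ?_)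
    (by simpa only [map_smul, smul_mul_assoc] using h1)
    (fun k n => (s ^ k * (((1 / ((q ^ 2) ^ (-n) * α * q ^ 2)) ^ ((m : ℝ) / 2 + k) : ℝ) : ℂ)) •
          bigGauss q m (1 / ((q ^ 2) ^ (-n) * α)))
  · simpa only [map_smul, smul_mul_assoc] using h3
  · have h4 : 0 < smallExpCoeff (q ^ 2) i := inv_pos.2 (qFactorial_pos hq hq1 i)
    have h5 : α * q ^ 2 / mu q m ≠ 0 := by positivity
    exact_mod_cast mul_ne_zero h4.ne' (pow_ne_zero _ (neg_ne_zero.2 h5))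
  · have h4 : (q ^ 2) ^ (-a) = (q ^ 2) ^ (-b) := Complex.ofReal_injective hab
    have h5 := zpow_right_injective₀ hp hp1.ne h4
    omega
  · rw [smallGauss, coeff_mk, ← Complex.ofReal_pow, ← Complex.ofReal_mul]
    congr 1
    rw [mul_assoc (smallExpCoeff _ _), ← mul_pow]
    congr 2
    ring

theorem bochnerGraph_unique (hq : 0 < q) (hq1 : q < 1) (hm : 1 ≤ m) {s : ℂ} {α : ℝ}
    (hα : 0 < α) {f g g' : Series q m} (h : (f, g) ∈ bochnerGraph q m s α)
    (h' : (f, g') ∈ bochnerGraph q m s α) : g = g' := by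
  have h1 := sub_mem h h'
  rw [Prod.mk_sub_mk, sub_self] at h1
  exact sub_eq_zero.1 (eq_zero_of_mem_bochnerGraph hq hq1 hm hα h1)

theorem snd_mem_of_mem_bochnerGraph (hq : 0 < q) {s : ℂ} {α : ℝ}
    {z : Series q m × Series q m} (h : z ∈ bochnerGraph q m s α) :
    z.2 ∈ chainSpan q m fun n => bigGauss q m ((q ^ 2) ^ n * (1 / α)) := by
  induction h using Submodule.span_induction with
  | zero => exact zero_mem _
  | add x y _ _ hx hy => exact add_mem hx hy
  | smul c x _ hx => exact Submodule.smul_mem _ _ hx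
  | mem z hz =>
    obtain ⟨k, n, S, hS, rfl⟩ := hz
    rw [radial_smul, mul_smul_comm]
    refine Submodule.smul_mem _ _ (Submodule.subset_span ⟨k, n, S, hS, ?_⟩)
    simp only
    congr 3
    rw [zpow_neg]
    have := (zpow_pos (pow_pos hq 2) n).ne'
    field_simp

/-- The first transform inverts the Bochner relations, since `s^k (-s)^k = 1` for `s² = -1` and the
powers of the parameter of the `q`-Gaussian are inverse to each other. -/
theorem firstFourier_of_mem_bochnerGraph (hq : 0 < q) (hq1 : q < 1) (hm : 1 ≤ m) {s : ℂ}
    (hs : s ^ 2 = -1) {α : ℝ} (hα : 0 < α) {z : Series q m × Series q m}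
    (h : z ∈ bochnerGraph q m s α) : firstFourier q m (-s) (1 / α) z.2 = z.1 := by
  obtain ⟨hp, hp1⟩ := sq_pos_lt_one hq hq1
  have hβ : 0 < 1 / α := by positivity
  have hconv (z : Series q m × Series q m) (h : z ∈ bochnerGraph q m s α) :=
    converges_of_mem_chainSpan hq hq1 hm hβ (snd_mem_of_mem_bochnerGraph hq h)
  induction h using Submodule.span_induction with
  | zero =>
    have := firstFourier_smul hq (s := -s) 0 (hconv 0 (zero_mem _))
    rwa [zero_smul, zero_smul] at this
  | add x y hx' hy' hx hy =>
    rw [Prod.snd_add, firstFourier_add hq (hconv x hx') (hconv y hy'), hx, hy, Prod.fst_add]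
  | smul c x hx' hx => rw [Prod.smul_snd, firstFourier_smul hq c (hconv x hx'), hx, Prod.smul_fst]
  | mem z hz =>
    obtain ⟨k, n, S, hS, rfl⟩ := hz
    have hn := zpow_pos hp n
    have h1 : 1 / ((q ^ 2) ^ (-n) * α) = (q ^ 2) ^ n * (1 / α) := by
      rw [zpow_neg]; field_simp
    have h2 : 1 / ((q ^ 2) ^ n * (1 / α)) = (q ^ 2) ^ (-n) * α := by
      rw [zpow_neg]; field_simp
    have hb : 0 < (q ^ 2) ^ (-n) * α := mul_pos (zpow_pos hp _) hα
    have h3 : q ^ 2 / ((q ^ 2) ^ n * (1 / α)) = (q ^ 2) ^ (-n) * α * q ^ 2 := by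
      rw [← h2]; ring
    simp only
    rw [radial_smul, mul_smul_comm, h1, firstFourier_smul hq _ (fun p => ?_),
      firstFourier_harmonic_mul_bigGauss hq hq1 hm hβ (by rw [neg_sq, hs]) n hS, smul_smul, h2, h3]
    · have h4 : (1 / ((q ^ 2) ^ (-n) * α * q ^ 2)) ^ ((m : ℝ) / 2 + k)
          * ((q ^ 2) ^ (-n) * α * q ^ 2) ^ ((m : ℝ) / 2 + k) = 1 := by
        rw [← Real.mul_rpow (by positivity) (by positivity), one_div_mul_cancel (by positivity),
          Real.one_rpow]
      have h5 : s ^ k * (-s) ^ k = 1 := by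
        rw [← mul_pow, mul_neg, ← sq, hs, neg_neg, one_pow]
      rw [mul_mul_mul_comm, h5, ← Complex.ofReal_mul, h4, Complex.ofReal_one, one_mul, one_smul]
    · rw [mul_assoc, radial_comm hq, ← mul_assoc, ← map_mul]
      exact converges_bigGauss hq hq1 hm hβ n _

end BochnerGraph

/-! ### The Hankel transform of `q`-Gaussians -/

section Hankel
variable {q : ℝ} {m : ℕ}
open PowerSeries

/-- The function `t ↦ e_{q²}(-α q² t² / μ)`. -/
noncomputable def gaussFun (q : ℝ) (m : ℕ) (α : ℝ) (t : ℝ) : ℂ :=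
  ((smallExp (q ^ 2) (-(α * q ^ 2 / mu q m) * t ^ 2) : ℝ) : ℂ)

theorem gaussFun_mul_sq (hq : 0 < q) (hq1 : q < 1) {b : ℝ} (hb : 0 < b) (t : ℝ) :
    gaussFun q m (b * q ^ 2) t = gaussFun q m b t
      + (((1 - q ^ 2) * (b * q ^ 2 / mu q m) : ℝ) : ℂ) * ((t : ℂ) ^ 2 * gaussFun q m b t) := by
  obtain ⟨hp, hp1⟩ := sq_pos_lt_one hq hq1
  have hμ := mu_pos (m := m) hq
  have h := smallExp_neg_mul hp hp1 (x := b * q ^ 2 / mu q m * t ^ 2) (by positivity)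
  rw [gaussFun, gaussFun, show -(b * q ^ 2 * q ^ 2 / mu q m) * t ^ 2
    = -(q ^ 2 * (b * q ^ 2 / mu q m * t ^ 2)) by ring, h, neg_mul]
  push_cast
  ring

/-- The `q`-Gaussians, as power series in `t²` and as functions of `t`, and the linear combinations
of these pairs. -/
noncomputable def gaussPairs (q : ℝ) (m : ℕ) (α : ℝ) : Submodule ℂ (PowerSeries ℂ × (ℝ → ℂ)) :=
  Submodule.span ℂ (Set.range fun n : ℤ =>
    (smallGauss q m ((q ^ 2) ^ (-n) * α), gaussFun q m ((q ^ 2) ^ (-n) * α)))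

/-- The functional equation of `e_{q²}` expresses `t²` times a `q`-Gaussian as a linear combination of
two `q`-Gaussians. -/
theorem X_mul_mem_gaussPairs (hq : 0 < q) (hq1 : q < 1) {α : ℝ} (hα : 0 < α)
    {z : PowerSeries ℂ × (ℝ → ℂ)} (hz : z ∈ gaussPairs q m α) :
    (X * z.1, fun t : ℝ => (t : ℂ) ^ 2 * z.2 t) ∈ gaussPairs q m α := by
  obtain ⟨hp, hp1⟩ := sq_pos_lt_one hq hq1
  have hμ := mu_pos (m := m) hq
  induction hz using Submodule.span_induction with
  | zero =>
    have : (X * (0 : PowerSeries ℂ × (ℝ → ℂ)).1,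
        fun t : ℝ => (t : ℂ) ^ 2 * (0 : PowerSeries ℂ × (ℝ → ℂ)).2 t) = 0 := by
      ext <;> simp
    rw [this]; exact zero_mem _
  | add x y _ _ hx hy =>
    have : (X * (x + y).1, fun t : ℝ => (t : ℂ) ^ 2 * (x + y).2 t)
        = (X * x.1, fun t : ℝ => (t : ℂ) ^ 2 * x.2 t)
          + (X * y.1, fun t : ℝ => (t : ℂ) ^ 2 * y.2 t) := by
      refine Prod.ext (mul_add _ _ _) (funext fun t => mul_add _ _ _)
    rw [this]; exact add_mem hx hy
  | smul c x _ hx =>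
    have : (X * (c • x).1, fun t : ℝ => (t : ℂ) ^ 2 * (c • x).2 t)
        = c • (X * x.1, fun t : ℝ => (t : ℂ) ^ 2 * x.2 t) := by
      refine Prod.ext (mul_smul_comm _ _ _) (funext fun t => mul_left_comm _ _ _)
    rw [this]; exact Submodule.smul_mem _ _ hx
  | mem z hz =>
    obtain ⟨n, rfl⟩ := hz
    have hb : 0 < (q ^ 2) ^ (-n) * α := mul_pos (zpow_pos hp _) hα
    have h1 : 0 < 1 - q ^ 2 := by linarith
    set c : ℝ := (1 - q ^ 2) * ((q ^ 2) ^ (-n) * α * q ^ 2 / mu q m) with hc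
    have hc0 : (c : ℂ) ≠ 0 := by
      have : 0 < c := by positivity
      exact_mod_cast this.ne'
    have h2 : (q ^ 2) ^ (-(n - 1)) * α = (q ^ 2) ^ (-n) * α * q ^ 2 := by
      have := zpow_neg_succ_mul_sq hq α (n - 1)
      rwa [sub_add_cancel] at this
    have h3 : (X * smallGauss q m ((q ^ 2) ^ (-n) * α),
        fun t : ℝ => (t : ℂ) ^ 2 * gaussFun q m ((q ^ 2) ^ (-n) * α) t)
        = (c : ℂ)⁻¹ • ((smallGauss q m ((q ^ 2) ^ (-(n - 1)) * α),
            gaussFun q m ((q ^ 2) ^ (-(n - 1)) * α))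
          - (smallGauss q m ((q ^ 2) ^ (-n) * α), gaussFun q m ((q ^ 2) ^ (-n) * α))) := by
      rw [h2, smallGauss_mul_sq hq hq1]
      refine Prod.ext ?_ (funext fun t => ?_)
      · simp only [Prod.smul_fst, Prod.fst_sub]
        rw [add_sub_cancel_left, smul_smul, ← hc, inv_mul_cancel₀ hc0, one_smul]
      · simp only [Prod.smul_snd, Prod.snd_sub, Pi.smul_apply, Pi.sub_apply, smul_eq_mul]
        rw [gaussFun_mul_sq hq hq1 hb, add_sub_cancel_left, ← hc, inv_mul_cancel_left₀ hc0]
    change (X * smallGauss q m ((q ^ 2) ^ (-n) * α),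
        fun t : ℝ => (t : ℂ) ^ 2 * gaussFun q m ((q ^ 2) ^ (-n) * α) t) ∈ _
    rw [h3]
    exact Submodule.smul_mem _ _ (sub_mem (Submodule.subset_span ⟨_, rfl⟩)
      (Submodule.subset_span ⟨_, rfl⟩))

theorem polynomial_mul_mem_gaussPairs (hq : 0 < q) (hq1 : q < 1) {α : ℝ} (hα : 0 < α)
    (a : Polynomial ℂ) {z : PowerSeries ℂ × (ℝ → ℂ)} (hz : z ∈ gaussPairs q m α) :
    ((a : PowerSeries ℂ) * z.1, fun t : ℝ => a.eval ((t : ℂ) ^ 2) * z.2 t)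
      ∈ gaussPairs q m α := by
  induction a using Polynomial.induction_on with
  | C c =>
    have : ((Polynomial.C c : PowerSeries ℂ) * z.1,
        fun t : ℝ => (Polynomial.C c).eval ((t : ℂ) ^ 2) * z.2 t) = c • z := by
      refine Prod.ext ?_ (funext fun t => ?_)
      · rw [Polynomial.coe_C, ← smul_eq_C_mul]; rfl
      · exact congrArg (· * z.2 t) Polynomial.eval_C
    rw [this]; exact Submodule.smul_mem _ _ hz
  | add a b ha hb =>
    have : (((a + b : Polynomial ℂ) : PowerSeries ℂ) * z.1,
        fun t : ℝ => (a + b).eval ((t : ℂ) ^ 2) * z.2 t)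
        = ((a : PowerSeries ℂ) * z.1, fun t : ℝ => a.eval ((t : ℂ) ^ 2) * z.2 t)
          + ((b : PowerSeries ℂ) * z.1, fun t : ℝ => b.eval ((t : ℂ) ^ 2) * z.2 t) := by
      refine Prod.ext ?_ (funext fun t => ?_)
      · rw [Polynomial.coe_add, add_mul]; rfl
      · exact (congrArg (· * z.2 t) Polynomial.eval_add).trans (add_mul _ _ _)
    rw [this]; exact add_mem ha hb
  | monomial n c h =>
    have h1 := X_mul_mem_gaussPairs hq hq1 hα h
    convert h1 using 1
    refine Prod.ext ?_ (funext fun t => ?_)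
    · simp only [Polynomial.coe_mul, Polynomial.coe_pow, Polynomial.coe_X, pow_succ']
      ring
    · simp only [Polynomial.eval_mul, Polynomial.eval_pow, Polynomial.eval_X, pow_succ']
      ring

/-- The terms of the Jackson integral in the second `q`-Hankel transform. -/
noncomputable def hankelTerm (q : ℝ) (m : ℕ) (ν γ : ℝ) (f : ℝ → ℂ) (r : ℝ) (l : ℤ) : ℂ :=
  ((besselTwo q ν (q * ((1 + q) / mu q m) * r * (q ^ l * γ)) / (r * (q ^ l * γ)) ^ ν *
    (q ^ l * γ) ^ (2 * ν + 1) : ℝ) : ℂ) * f (q ^ l * γ) * ((q ^ l : ℝ) : ℂ)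

theorem hankelTwo_eq_tsum (ν γ : ℝ) (f : ℝ → ℂ) (r : ℝ) : hankelTwo q m ν γ f r
    = (((1 + q) / mu q m * ((1 - q) * γ) : ℝ) : ℂ) * ∑' l, hankelTerm q m ν γ f r l := by
  rw [hankelTwo, jackson, ← mul_assoc, ← Complex.ofReal_mul]
  rfl

/-- The second `q`-Bessel function divided by the matching power of its argument, as a series in base
`q²`. -/
theorem besselTwo_div_rpow (hq : 0 < q) (a : ℝ) {x : ℝ} (hx : 0 < x) :
    besselTwo q (a - 1) (q * ((1 + q) / mu q m) * x) / x ^ (a - 1)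
      = q ^ ((a - 1) ^ 2) * (q / mu q m) ^ (a - 1) *
        ∑' i : ℕ, ((q ^ 2) ^ a) ^ i * (q ^ 2) ^ (i * (i - 1)) * (-1) ^ i /
          (qFactorial (q ^ 2) i * qGamma (q ^ 2) (a + i)) * (q ^ 2 / mu q m ^ 2 * x ^ 2) ^ i := by
  have hμ := mu_pos (m := m) hq
  have h1 : q * ((1 + q) / mu q m) * x / (1 + q) = q / mu q m * x := by
    have : 1 + q ≠ 0 := by positivity
    field_simp
  rw [besselTwo, h1, Real.mul_rpow (by positivity) hx.le]
  have h2 := (Real.rpow_pos_of_pos hx (a - 1)).ne'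
  rw [mul_div_right_comm, ← mul_assoc, mul_div_cancel_right₀ _ h2]
  congr 1
  refine tsum_congr fun i => ?_
  have h3 : q ^ (2 * (i : ℝ) * (i + (a - 1))) = ((q ^ 2) ^ a) ^ i * (q ^ 2) ^ (i * (i - 1)) := by
    have h4 : (((i * (i - 1) : ℕ) : ℝ)) = i * (i - 1) := by
      rcases i with _ | i
      · simp
      · push_cast [Nat.add_sub_cancel]; ring
    rw [← Real.rpow_natCast (q ^ 2), ← Real.rpow_natCast ((q ^ 2) ^ a), ← Real.rpow_natCast q,
      ← Real.rpow_mul hq.le, ← Real.rpow_mul hq.le, ← Real.rpow_mul hq.le, ← Real.rpow_add hq, h4]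
    congr 1
    push_cast
    ring
  rw [h3, show (i : ℝ) + (a - 1) + 1 = a + i by ring, pow_mul (q / mu q m * x), mul_pow (q / mu q m), div_pow]

/-- The Hankel transform of a `q`-Gaussian of the first kind at `r = √u` is a multiple of a `q`-Gaussian
of the second kind. -/
theorem hasSum_hankelTerm (hq : 0 < q) (hq1 : q < 1) {a b γ u : ℝ} (ha : 0 < a) (hb : 0 < b)
    (hγ : 0 < γ) (hu : 0 < u) :
    HasSum (hankelTerm q m (a - 1) γ (gaussFun q m b) √u)
      ((q ^ ((a - 1) ^ 2) * (q / mu q m) ^ (a - 1) * γ ^ (2 * a - 1) *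
        (gaussMoment (q ^ 2) (b * q ^ 2 * γ ^ 2 / mu q m) a / qGamma (q ^ 2) a *
          bigExp (q ^ 2) (-(u / (b * mu q m)))) : ℝ) : ℂ) := by
  obtain ⟨hp, hp1⟩ := sq_pos_lt_one hq hq1
  have hμ := mu_pos (m := m) hq
  have h := hasSum_bessel_smallExp hp hp1 (w := b * q ^ 2 * γ ^ 2 / mu q m) (by positivity) ha
    (q ^ 2 / mu q m ^ 2 * (u * γ ^ 2))
  have h1 : q ^ 2 / mu q m ^ 2 * (u * γ ^ 2) / (b * q ^ 2 * γ ^ 2 / mu q m)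
      = u / (b * mu q m) := by field_simp
  rw [h1] at h
  have h2 := h.mul_left (q ^ ((a - 1) ^ 2) * (q / mu q m) ^ (a - 1) * γ ^ (2 * a - 1))
  refine (Complex.hasSum_ofReal.2 h2).congr_fun fun l => ?_
  have hl : 0 < q ^ l := zpow_pos hq l
  have hlγ : 0 < q ^ l * γ := by positivity
  have hr : 0 < √u := Real.sqrt_pos.2 hu
  have h3 : (q ^ l) ^ 2 = (q ^ 2) ^ l := by
    rw [← zpow_natCast, ← zpow_natCast, ← zpow_mul, ← zpow_mul, mul_comm]
  rw [hankelTerm, gaussFun, ← Complex.ofReal_mul, ← Complex.ofReal_mul, mul_assoc _ √u,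
    besselTwo_div_rpow hq a (mul_pos hr hlγ), mul_pow √u, Real.sq_sqrt hu.le, mul_pow (q ^ l), h3]
  congr 1
  have h4 : (q ^ l * γ) ^ (2 * (a - 1) + 1) * q ^ l
      = γ ^ (2 * a - 1) * ((q ^ 2) ^ a) ^ l := by
    rw [show 2 * (a - 1) + 1 = 2 * a - 1 by ring, Real.mul_rpow hl.le hγ.le,
      Real.rpow_sub_one hl.ne', Real.rpow_mul hl.le, Real.rpow_two, h3]
    have h5 : ((q ^ 2) ^ l) ^ a = ((q ^ 2) ^ a) ^ l := by
      rw [← Real.rpow_intCast, ← Real.rpow_intCast, ← Real.rpow_mul hp.le, ← Real.rpow_mul hp.le,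
        mul_comm]
    rw [h5]
    field_simp
  have h6 (i : ℕ) : (q ^ 2 / mu q m ^ 2 * (u * ((q ^ 2) ^ l * γ ^ 2))) ^ i
      = (q ^ 2 / mu q m ^ 2 * (u * γ ^ 2) * (q ^ 2) ^ l) ^ i := by congr 1; ring
  simp only [h6]
  rw [show -(b * q ^ 2 / mu q m) * ((q ^ 2) ^ l * γ ^ 2)
    = -(b * q ^ 2 * γ ^ 2 / mu q m * (q ^ 2) ^ l) by ring]
  linear_combination (q ^ ((a - 1) ^ 2) * (q / mu q m) ^ (a - 1) *
    (∑' i : ℕ, ((q ^ 2) ^ a) ^ i * (q ^ 2) ^ (i * (i - 1)) * (-1) ^ i /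
          (qFactorial (q ^ 2) i * qGamma (q ^ 2) (a + i))
            * (q ^ 2 / mu q m ^ 2 * (u * γ ^ 2) * (q ^ 2) ^ l) ^ i)
      * smallExp (q ^ 2) (-(b * q ^ 2 * γ ^ 2 / mu q m * (q ^ 2) ^ l))) * h4

end Hankel

/-! ### The second transform -/

section SecondTransform
variable {q : ℝ} {m : ℕ}
open PowerSeries

theorem cConst_eq (hq : 0 < q) (hq1 : q < 1) {α γ : ℝ} (hα : 0 < α)
    (hγ : 0 < γ) : cConst q m α γ =
      ((q ^ (((m : ℝ) / 2 - 1) * ((m : ℝ) / 2)) / qGamma (q ^ 2) (m / 2) *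
        ((1 - q ^ 2) * ((α * q ^ 2 * γ ^ 2 / mu q m) ^ ((m : ℝ) / 2) *
          gaussMoment (q ^ 2) (α * q ^ 2 * γ ^ 2 / mu q m) (m / 2))) : ℝ) : ℂ) := by
  obtain ⟨hp, hp1⟩ := sq_pos_lt_one hq hq1
  have hμ := mu_pos (m := m) hq
  have hw : 0 < α * q ^ 2 * γ ^ 2 / mu q m := by positivity
  rw [cConst, jackson, Complex.ofReal_mul _ (_ * _)]
  congr 1
  generalize α * q ^ 2 * γ ^ 2 / mu q m = w at hw
  have hR : (1 - q ^ 2) * (w ^ ((m : ℝ) / 2) * gaussMoment (q ^ 2) w (m / 2))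
      = ∑' l : ℤ, (1 - q ^ 2) * (w ^ ((m : ℝ) / 2) *
        (((q ^ 2) ^ ((m : ℝ) / 2)) ^ l * smallExp (q ^ 2) (-(w * (q ^ 2) ^ l)))) := by
    rw [tsum_mul_left, tsum_mul_left, gaussMoment]
  rw [hR, Complex.ofReal_tsum, ← tsum_mul_left]
  refine tsum_congr fun l => ?_
  have hl : 0 < (q ^ 2) ^ l := zpow_pos hp l
  rw [← Complex.ofReal_mul, ← Complex.ofReal_mul]
  congr 1
  have h5 : ((q ^ 2) ^ l) ^ ((m : ℝ) / 2) = ((q ^ 2) ^ ((m : ℝ) / 2)) ^ l := by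
    rw [← Real.rpow_intCast, ← Real.rpow_intCast, ← Real.rpow_mul hp.le, ← Real.rpow_mul hp.le,
      mul_comm]
  rw [Real.mul_rpow hl.le hw.le, Real.rpow_sub_one hl.ne', Real.rpow_sub_one hw.ne', h5,
    mul_comm _ w]
  field_simp

theorem cConst_ne_zero (hq : 0 < q) (hq1 : q < 1) (hm : 1 ≤ m) {α γ : ℝ} (hα : 0 < α)
    (hγ : 0 < γ) : cConst q m α γ ≠ 0 := by
  obtain ⟨hp, hp1⟩ := sq_pos_lt_one hq hq1
  have hμ := mu_pos (m := m) hq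
  have hw : 0 < α * q ^ 2 * γ ^ 2 / mu q m := by positivity
  have hh : (0 : ℝ) < m / 2 := by
    have : (0 : ℝ) < m := by exact_mod_cast hm
    positivity
  have h1 : 0 < 1 - q ^ 2 := by linarith
  have h2 := gaussMoment_pos hp hp1 hw hh
  have h3 := qGamma_pos hp hp1 hh
  rw [cConst_eq hq hq1 hα hγ]
  exact Complex.ofReal_ne_zero.2 (by positivity)

/-- The normalization by `c(√α γ)` removes the dependence of the second transform on `γ`. -/
theorem hankel_constant (hq : 0 < q) (hq1 : q < 1) (hm : 1 ≤ m) {α γ : ℝ} (hα : 0 < α)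
    (hγ : 0 < γ) (n : ℤ) (k : ℕ) {a b : ℝ} (ha : a = (m : ℝ) / 2 + k)
    (hb : b = (q ^ 2) ^ (-n) * α) :
    (((1 + q) / mu q m * ((1 - q) * γ) * (q ^ ((a - 1) ^ 2) * (q / mu q m) ^ (a - 1) *
      γ ^ (2 * a - 1) * (gaussMoment (q ^ 2) (b * q ^ 2 * γ ^ 2 / mu q m) a / qGamma (q ^ 2) a)) :
        ℝ) : ℂ) = cConst q m α γ * (((1 / (b * q ^ 2)) ^ a : ℝ) : ℂ) := by
  obtain ⟨hp, hp1⟩ := sq_pos_lt_one hq hq1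
  have hμ := mu_pos (m := m) hq
  have hw : 0 < α * q ^ 2 * γ ^ 2 / mu q m := by positivity
  have hh : (0 : ℝ) < m / 2 := by
    have : (0 : ℝ) < m := by exact_mod_cast hm
    positivity
  have ha0 : 0 < a := by rw [ha]; positivity
  rw [cConst_eq hq hq1 hα hγ, ← Complex.ofReal_mul]
  congr 1
  have h1 : 0 < 1 - q ^ 2 := by linarith
  have h2 := gaussMoment_pos hp hp1 hw ha0
  have h3 := qGamma_pos hp hp1 hh
  have h4 := qGamma_pos hp hp1 ha0
  have h5 := gaussMoment_add_nat hp hp1 hw hh k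
  rw [← ha] at h5
  have h6 : b * q ^ 2 * γ ^ 2 / mu q m
      = (q ^ 2) ^ (-n) * (α * q ^ 2 * γ ^ 2 / mu q m) := by rw [hb]; ring
  have hn := zpow_pos hp n
  have hn' : (((q ^ 2) ^ n : ℝ)) ^ a = ((q ^ 2) ^ a) ^ n := by
    rw [← Real.rpow_intCast, ← Real.rpow_intCast, ← Real.rpow_mul hp.le, ← Real.rpow_mul hp.le,
      mul_comm]
  have h7 : (1 / (b * q ^ 2)) ^ a = ((q ^ 2) ^ a) ^ n / (α ^ a * (q ^ 2) ^ a) := by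
    rw [← hn', ← Real.mul_rpow hα.le hp.le, ← Real.div_rpow hn.le (by positivity), hb, zpow_neg]
    congr 1
    field_simp
  have h8 : γ * γ ^ (2 * a - 1) = (γ ^ 2) ^ a := by
    rw [← Real.rpow_natCast γ 2, ← Real.rpow_mul hγ.le, Real.rpow_sub_one hγ.ne']
    push_cast
    field_simp
  have h9 : (α * q ^ 2 * γ ^ 2 / mu q m) ^ a
      = (α * q ^ 2 * γ ^ 2 / mu q m) ^ ((m : ℝ) / 2) * (α * q ^ 2 * γ ^ 2 / mu q m) ^ k := by
    rw [ha, Real.rpow_add_natCast hw.ne']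
  have h10 : (α * q ^ 2 * γ ^ 2 / mu q m) ^ a
      = α ^ a * (q ^ 2) ^ a * (γ ^ 2) ^ a / mu q m ^ a := by
    rw [Real.div_rpow (by positivity) hμ.le, Real.mul_rpow (by positivity) (by positivity),
      Real.mul_rpow hα.le hp.le]
  have h11 : q ^ ((a - 1) ^ 2) * q ^ (a - 1) = q ^ (((m : ℝ) / 2 - 1) * ((m : ℝ) / 2)) *
      (((q ^ 2) ^ ((m : ℝ) / 2)) ^ k * (q ^ 2) ^ (k * (k - 1) / 2)) := by
    have e1 : (((k * (k - 1) / 2 : ℕ) : ℝ)) = k * (k - 1) / 2 := by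
      rw [Nat.cast_div (Nat.even_mul_pred_self k).two_dvd two_ne_zero]
      rcases k with _ | k
      · simp
      · push_cast [Nat.add_sub_cancel]; ring
    rw [← Real.rpow_natCast (q ^ 2) (k * (k - 1) / 2), ← Real.rpow_natCast ((q ^ 2) ^ ((m : ℝ) / 2)),
      ← Real.rpow_natCast q 2, ← Real.rpow_mul hq.le, ← Real.rpow_mul hq.le, ← Real.rpow_mul hq.le,
      ← Real.rpow_add hq, ← Real.rpow_add hq, ← Real.rpow_add hq, e1, ha]
    congr 1
    push_cast
    ring
  rw [h6, gaussMoment_zpow_mul hp, zpow_neg, inv_inv, h7, Real.div_rpow hq.le hμ.le,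
    Real.rpow_sub_one hμ.ne']
  have e1 := (Real.rpow_pos_of_pos hα a).ne'
  have e2 := (Real.rpow_pos_of_pos hp a).ne'
  have e3 := (Real.rpow_pos_of_pos hμ a).ne'
  have e4 := (Real.rpow_pos_of_pos hw (m / 2)).ne'
  have e5 := hμ.ne'
  generalize α * q ^ 2 * γ ^ 2 / mu q m = w at *
  rw [show (1 + q) / mu q m * ((1 - q) * γ) * (q ^ ((a - 1) ^ 2) * (q ^ (a - 1) /
      (mu q m ^ a / mu q m)) * γ ^ (2 * a - 1) * (((q ^ 2) ^ a) ^ n *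
        gaussMoment (q ^ 2) w a / qGamma (q ^ 2) a))
    = (1 - q ^ 2) * (q ^ ((a - 1) ^ 2) * q ^ (a - 1)) * (γ * γ ^ (2 * a - 1)) / mu q m ^ a
      * ((q ^ 2) ^ a) ^ n * gaussMoment (q ^ 2) w a / qGamma (q ^ 2) a by field_simp; ring, h8, h11]
  have h12 : (γ ^ 2) ^ a / mu q m ^ a = w ^ ((m : ℝ) / 2) * w ^ k / (α ^ a * (q ^ 2) ^ a) := by
    rw [← h9, h10]; field_simp
  have h13 : gaussMoment (q ^ 2) w (m / 2) = ((q ^ 2) ^ ((m : ℝ) / 2)) ^ k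
      * (q ^ 2) ^ (k * (k - 1) / 2) * w ^ k * gaussMoment (q ^ 2) w a * qGamma (q ^ 2) (m / 2)
        / qGamma (q ^ 2) a := by
    rw [h5]; field_simp
  rw [mul_div_assoc _ ((γ ^ 2) ^ a), h12, h13]
  field_simp

theorem hasSum_coeff_bigGauss (hq : 0 < q) (hq1 : q < 1) {b u : ℝ} (hu : 0 < u) :
    HasSum (fun i => coeff i (bigGauss q m (1 / b)) * (u : ℂ) ^ i)
      ((bigExp (q ^ 2) (-(u / (b * mu q m))) : ℝ) : ℂ) := by
  have h := hasSum_bigGauss (m := m) hq hq1 (1 / b) √u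
  rw [Real.sq_sqrt hu.le, show 1 / b / mu q m * u = u / (b * mu q m) by field_simp] at h
  refine h.congr_fun fun i => ?_
  rw [pow_mul, ← Complex.ofReal_pow √u 2, Real.sq_sqrt hu.le]

/-- The normalized Hankel transform of order `m/2 + k - 1` of a linear combination of `q`-Gaussians has
the convergent Taylor series `Ψ` in `u = r²`, and the relation that the second transform assigns to it
for a spherical harmonic of degree `k` belongs to `bochnerGraph`. The summability of the terms is
carried along to make the Jackson integral additive. -/
theorem exists_hankel (hq : 0 < q) (hq1 : q < 1) (hm : 1 ≤ m) {α γ : ℝ} (hα : 0 < α)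
    (hγ : 0 < γ) (k : ℕ) {z : PowerSeries ℂ × (ℝ → ℂ)} (hz : z ∈ gaussPairs q m α) :
    ∃ Ψ : PowerSeries ℂ,
      (∀ u : ℝ, 0 < u → Summable (hankelTerm q m ((m : ℝ) / 2 + k - 1) γ z.2 √u) ∧
        HasSum (fun n : ℕ => coeff n Ψ * (u : ℂ) ^ n)
          ((cConst q m α γ)⁻¹ * hankelTwo q m ((m : ℝ) / 2 + k - 1) γ z.2 √u)) ∧
      ∀ (s : ℂ) (S : Poly q m), S ∈ harmonics q m k →
        (toSeries q m S * radial q m z.1, s ^ k • (toSeries q m S * radial q m Ψ))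
          ∈ bochnerGraph q m s α := by
  obtain ⟨hp, hp1⟩ := sq_pos_lt_one hq hq1
  have radial_zero : radial q m 0 = 0 := by
    have := radial_smul (q := q) (m := m) 0 0
    rwa [zero_smul, zero_smul] at this
  induction hz using Submodule.span_induction with
  | zero =>
    have h0 (r : ℝ) : hankelTerm q m ((m : ℝ) / 2 + k - 1) γ 0 r = 0 := by
      funext l; simp [hankelTerm]
    refine ⟨0, fun u hu => ⟨?_, ?_⟩, fun s S hS => ?_⟩
    · rw [Prod.snd_zero, h0]; exact summable_zero
    · rw [Prod.snd_zero, hankelTwo_eq_tsum, h0]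
      simp
    · rw [Prod.fst_zero, radial_zero, mul_zero, smul_zero]
      exact zero_mem _
  | add x y _ _ hx hy =>
    obtain ⟨Ψ, h1, h2⟩ := hx
    obtain ⟨Ψ', h1', h2'⟩ := hy
    have h0 (r : ℝ) : hankelTerm q m ((m : ℝ) / 2 + k - 1) γ (x + y).2 r
        = fun l => hankelTerm q m ((m : ℝ) / 2 + k - 1) γ x.2 r l
          + hankelTerm q m ((m : ℝ) / 2 + k - 1) γ y.2 r l := by
      funext l
      simp only [hankelTerm, Prod.snd_add, Pi.add_apply]
      ring
    refine ⟨Ψ + Ψ', fun u hu => ⟨?_, ?_⟩, fun s S hS => ?_⟩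
    · rw [h0]; exact (h1 u hu).1.add (h1' u hu).1
    · rw [hankelTwo_eq_tsum, h0, (h1 u hu).1.tsum_add (h1' u hu).1, mul_add, mul_add,
        ← hankelTwo_eq_tsum, ← hankelTwo_eq_tsum]
      simpa only [map_add, add_mul] using (h1 u hu).2.add (h1' u hu).2
    · have := add_mem (h2 s S hS) (h2' s S hS)
      rwa [Prod.mk_add_mk, ← smul_add, ← mul_add, ← mul_add, ← radial_add, ← radial_add] at this
  | smul c x _ hx =>
    obtain ⟨Ψ, h1, h2⟩ := hx
    have h0 (r : ℝ) : hankelTerm q m ((m : ℝ) / 2 + k - 1) γ (c • x).2 r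
        = fun l => c * hankelTerm q m ((m : ℝ) / 2 + k - 1) γ x.2 r l := by
      funext l
      simp only [hankelTerm, Prod.smul_snd, Pi.smul_apply, smul_eq_mul]
      ring
    refine ⟨c • Ψ, fun u hu => ⟨?_, ?_⟩, fun s S hS => ?_⟩
    · rw [h0]; exact (h1 u hu).1.mul_left c
    · rw [hankelTwo_eq_tsum, h0, tsum_mul_left, mul_left_comm _ c, ← hankelTwo_eq_tsum,
        mul_left_comm _ c]
      simpa only [coeff_smul, smul_eq_mul, mul_assoc] using (h1 u hu).2.mul_left c
    · have := Submodule.smul_mem _ c (h2 s S hS)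
      rwa [Prod.smul_mk, smul_comm c, ← mul_smul_comm, ← mul_smul_comm, ← radial_smul,
        ← radial_smul] at this
  | mem z hz =>
    obtain ⟨n, rfl⟩ := hz
    have hb : 0 < (q ^ 2) ^ (-n) * α := mul_pos (zpow_pos hp _) hα
    have ha : (0 : ℝ) < m / 2 + k := by
      have : (0 : ℝ) < m := by exact_mod_cast hm
      positivity
    set b := (q ^ 2) ^ (-n) * α with hbdef
    set κ : ℂ := (((1 / (b * q ^ 2)) ^ ((m : ℝ) / 2 + k) : ℝ) : ℂ) with hκ
    refine ⟨κ • bigGauss q m (1 / b), fun u hu => ?_, fun s S hS => ?_⟩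
    · have h1 := hasSum_hankelTerm (m := m) hq hq1 ha hb hγ hu
      refine ⟨h1.summable, ?_⟩
      simp only
      rw [hankelTwo_eq_tsum, h1.tsum_eq, ← Complex.ofReal_mul, ← mul_assoc (_ * γ ^ _),
        ← mul_assoc (_ * (_ * γ)), Complex.ofReal_mul _ (bigExp _ _),
        hankel_constant hq hq1 hm hα hγ n k rfl hbdef, mul_assoc (cConst _ _ _ _),
        inv_mul_cancel_left₀ (cConst_ne_zero hq hq1 hm hα hγ), ← hκ]
      simpa only [coeff_smul, smul_eq_mul, mul_assoc] using
        (hasSum_coeff_bigGauss (m := m) (b := b) hq hq1 hu).mul_left κ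
    · refine Submodule.subset_span ⟨k, n, S, hS, ?_⟩
      rw [← mul_smul_comm, ← radial_smul, smul_smul]

/-- A power series is determined by its sum near the origin, on the positive side. -/
theorem IsTaylor.unique {g : ℝ → ℂ} {Φ Ψ : PowerSeries ℂ} (hΦ : IsTaylor g Φ)
    (hΨ : IsTaylor g Ψ) : Φ = Ψ := by
  have h1 : ∀ᶠ u : ℝ in 𝓝[>] 0,
      HasSum (fun n : ℕ => (coeff n Φ - coeff n Ψ) * (u : ℂ) ^ n) 0 := by
    filter_upwards [hΦ, hΨ] with u h h'
    simpa only [sub_mul, sub_self] using h.sub h'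
  obtain ⟨u₀, hu₀, h2⟩ := (mem_nhdsGT_iff_exists_Ioc_subset (a := (0 : ℝ))).1 h1
  have hu₀' : 0 < u₀ := hu₀
  set d : ℕ → ℂ := fun n => coeff n Φ - coeff n Ψ with hd
  have h3 (u : ℝ) (hu : u ∈ Set.Ioc 0 u₀) : HasSum (fun n : ℕ => d n * (u : ℂ) ^ n) 0 := h2 hu
  have h4 (n : ℕ) : d n = 0 := by
    induction n using Nat.strong_induction_on with
    | _ n ih =>
      have h5 (u : ℝ) (hu : u ∈ Set.Ioc 0 u₀) :
          HasSum (fun j : ℕ => d (j + n) * (u : ℂ) ^ j) 0 := by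
        have h6 := (hasSum_nat_add_iff' n).2 (h3 u hu)
        rw [Finset.sum_eq_zero fun i hi => by rw [ih i (Finset.mem_range.1 hi), zero_mul],
          sub_zero] at h6
        have hu0 : (u : ℂ) ^ n ≠ 0 := pow_ne_zero _ (Complex.ofReal_ne_zero.2 hu.1.ne')
        have h7 := h6.mul_left ((u : ℂ) ^ n)⁻¹
        rw [mul_zero] at h7
        refine h7.congr_fun fun j => ?_
        rw [pow_add]
        field_simp
      -- The series vanishes identically near the origin, and tends to its constant term `d n`.
      have h6 : Tendsto (fun u : ℝ => ∑' j : ℕ, d (j + n) * (u : ℂ) ^ j) (𝓝[>] 0)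
          (𝓝 (∑' j : ℕ, if j = 0 then d n else 0)) := by
        refine tendsto_tsum_of_dominated_convergence
          (bound := fun j => ‖d (j + n) * (u₀ : ℂ) ^ j‖)
          (h5 u₀ ⟨hu₀, le_rfl⟩).summable.norm (fun j => ?_) ?_
        · have h7 : Tendsto (fun u : ℝ => (u : ℂ)) (𝓝[>] 0) (𝓝 0) :=
            (Complex.continuous_ofReal.tendsto' 0 0 Complex.ofReal_zero).mono_left
              nhdsWithin_le_nhds
          rcases j with _ | j
          · simp
          · simpa using (h7.pow (j + 1)).const_mul (d (j + 1 + n))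
        · filter_upwards [Ioc_mem_nhdsGT hu₀'] with u hu j
          rw [norm_mul, norm_mul, norm_pow, norm_pow, Complex.norm_real, Complex.norm_real,
            Real.norm_of_nonneg hu.1.le, Real.norm_of_nonneg hu₀'.le]
          exact mul_le_mul_of_nonneg_left (pow_le_pow_left₀ hu.1.le hu.2 j) (norm_nonneg _)
      rw [tsum_ite_eq] at h6
      have h7 : Tendsto (fun u : ℝ => ∑' j : ℕ, d (j + n) * (u : ℂ) ^ j) (𝓝[>] 0) (𝓝 0) := by
        refine tendsto_const_nhds.congr' ?_
        filter_upwards [Ioc_mem_nhdsGT hu₀'] with u hu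
        exact (h5 u hu).tsum_eq.symm
      exact tendsto_nhds_unique h6 h7
  ext n
  exact sub_eq_zero.1 (h4 n)

theorem mem_gaussPairs_polynomial (hq : 0 < q) (hq1 : q < 1) {α : ℝ} (hα : 0 < α) (j : ℕ)
    (a : Polynomial ℂ) :
    ((a : PowerSeries ℂ) * smallGauss q m ((q ^ (2 * j))⁻¹ * α),
      fun t : ℝ => a.eval ((t : ℂ) ^ 2) *
        ((smallExp (q ^ 2) (-((q ^ (2 * j))⁻¹ * α * q ^ 2 / mu q m) * t ^ 2) : ℝ) : ℂ))
      ∈ gaussPairs q m α := by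
  have h : (smallGauss q m ((q ^ (2 * j))⁻¹ * α), gaussFun q m ((q ^ (2 * j))⁻¹ * α))
      ∈ gaussPairs q m α := by
    refine Submodule.subset_span ⟨j, ?_⟩
    simp only [zpow_neg, zpow_natCast, pow_mul]
  have h2 := polynomial_mul_mem_gaussPairs hq hq1 hα a h
  simp only [gaussFun] at h2
  exact h2

/-- The Bochner relations for a polynomial times a `q`-Gaussian follow from those for the pure
`q`-Gaussians. -/
theorem secondGraph_le_bochnerGraph (hq : 0 < q) (hq1 : q < 1) (hm : 1 ≤ m) (s : ℂ) {α γ : ℝ}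
    (hα : 0 < α) (hγ : 0 < γ) : secondGraph q m s α γ ≤ bochnerGraph q m s α := by
  refine Submodule.span_le.2 ?_
  rintro _ ⟨k, j, S, a, Φ, hS, hΦ, rfl⟩
  obtain ⟨Ψ, h1, h2⟩ := exists_hankel hq hq1 hm hα hγ k
    (mem_gaussPairs_polynomial (m := m) hq hq1 hα j a)
  have h3 : Φ = Ψ := hΦ.unique (by
    filter_upwards [self_mem_nhdsWithin] with u hu
    exact (h1 u hu).2)
  rw [h3]
  exact h2 s S hS

/-- The second transform is defined on all of `V_[α]`, by the decomposition into spherical harmonics. -/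
theorem exists_mem_secondGraph (hq : 0 < q) (hq1 : q < 1) (hm : 1 ≤ m) (s : ℂ) {α γ : ℝ}
    (hα : 0 < α) (hγ : 0 < γ) {f : Series q m} (hf : f ∈ VClass q m α) :
    ∃ g, (f, g) ∈ secondGraph q m s α γ := by
  obtain ⟨j, hj⟩ := Set.mem_iUnion.1 hf
  obtain ⟨P, rfl⟩ := hj
  simp only
  induction P using homog_induction with
  | add p r hp hr =>
    obtain ⟨g, hg⟩ := hp (Set.mem_iUnion.2 ⟨j, p, rfl⟩)
    obtain ⟨g', hg'⟩ := hr (Set.mem_iUnion.2 ⟨j, r, rfl⟩)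
    exact ⟨g + g', by rw [map_add, add_mul]; exact add_mem hg hg'⟩
  | homog d p hp =>
    have h := mem_span_harmonics hq hq1 hm hp
    clear hf hp
    induction h using Submodule.span_induction with
    | zero => exact ⟨0, by rw [map_zero, zero_mul]; exact zero_mem _⟩
    | add p r _ _ hp hr =>
      obtain ⟨g, hg⟩ := hp
      obtain ⟨g', hg'⟩ := hr
      exact ⟨g + g', by rw [map_add, add_mul]; exact add_mem hg hg'⟩
    | smul c p _ hp =>
      obtain ⟨g, hg⟩ := hp
      exact ⟨c • g, by rw [map_smul, smul_mul_assoc]; exact Submodule.smul_mem _ c hg⟩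
    | mem p hp =>
      obtain ⟨k, i, S, -, hS, rfl⟩ := hp
      obtain ⟨Ψ, h1, -⟩ := exists_hankel hq hq1 hm hα hγ k
        (mem_gaussPairs_polynomial (m := m) hq hq1 hα j (Polynomial.X ^ i))
      refine ⟨s ^ k • (toSeries q m S * radial q m Ψ), Submodule.subset_span
        ⟨k, j, S, Polynomial.X ^ i, Ψ, hS, ?_, ?_⟩⟩
      · filter_upwards [self_mem_nhdsWithin] with u hu
        exact (h1 u hu).2
      · rw [← normSq_pow_comm hq, map_mul, mul_assoc, toSeries_normSq_pow_mul_radial,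
          Polynomial.coe_pow, Polynomial.coe_X]

/-- The first transform of `f`, paired with `f`, is a Bochner relation. As the relations span all second
components, this follows from `firstFourier_of_mem_bochnerGraph`. -/
theorem mem_bochnerGraph_firstFourier (hq : 0 < q) (hq1 : q < 1) (hm : 1 ≤ m) {s : ℂ}
    (hs : s ^ 2 = -1) {β : ℝ} (hβ : 0 < β) {f : Series q m} (hf : f ∈ VBarClass q m β) :
    (firstFourier q m s β f, f) ∈ bochnerGraph q m (-s) (1 / β) := by
  obtain ⟨hp, hp1⟩ := sq_pos_lt_one hq hq1
  have hα : 0 < 1 / β := by positivity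
  rw [mem_VBarClass_iff hq hq1 hm hβ] at hf
  suffices h : ∃ h, (h, f) ∈ bochnerGraph q m (-s) (1 / β) by
    obtain ⟨h, hh⟩ := h
    have h1 := firstFourier_of_mem_bochnerGraph hq hq1 hm (by rw [neg_sq, hs]) hα hh
    rw [neg_neg, one_div_one_div] at h1
    simp only at h1
    rwa [h1]
  induction hf using Submodule.span_induction with
  | zero => exact ⟨0, zero_mem _⟩
  | add x y _ _ hx hy =>
    obtain ⟨g, hg⟩ := hx
    obtain ⟨g', hg'⟩ := hy
    exact ⟨g + g', add_mem hg hg'⟩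
  | smul c x _ hx =>
    obtain ⟨g, hg⟩ := hx
    exact ⟨c • g, Submodule.smul_mem _ c hg⟩
  | mem f hf =>
    obtain ⟨k, n, S, hS, rfl⟩ := hf
    have hn := zpow_pos hp n
    have h1 : 1 / ((q ^ 2) ^ (-n) * (1 / β)) = (q ^ 2) ^ n * β := by
      rw [zpow_neg]; field_simp
    set κ : ℂ := (-s) ^ k * (((1 / ((q ^ 2) ^ (-n) * (1 / β) * q ^ 2)) ^ ((m : ℝ) / 2 + k) : ℝ) : ℂ)
      with hκ
    have hκ0 : κ ≠ 0 := by
      refine mul_ne_zero (pow_ne_zero _ ?_) (Complex.ofReal_ne_zero.2 ?_)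
      · rintro h
        rw [neg_eq_zero] at h
        rw [h] at hs
        norm_num at hs
      · have : 0 < (q ^ 2) ^ (-n) := zpow_pos hp _
        exact (Real.rpow_pos_of_pos (by positivity) _).ne'
    have h2 : (toSeries q m S * radial q m (smallGauss q m ((q ^ 2) ^ (-n) * (1 / β))),
        toSeries q m S * radial q m (κ • bigGauss q m ((q ^ 2) ^ n * β)))
        ∈ bochnerGraph q m (-s) (1 / β) :=
      Submodule.subset_span ⟨k, n, S, hS, by rw [h1]⟩
    have h3 := Submodule.smul_mem _ κ⁻¹ h2
    rw [Prod.smul_mk, radial_smul, mul_smul_comm, smul_smul, inv_mul_cancel₀ hκ0, one_smul] at h3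
    exact ⟨_, h3⟩

theorem fst_mem_of_mem_bochnerGraph {s : ℂ} {α : ℝ} {z : Series q m × Series q m}
    (h : z ∈ bochnerGraph q m s α) :
    z.1 ∈ chainSpan q m fun n => smallGauss q m ((q ^ 2) ^ (-n) * α) := by
  induction h using Submodule.span_induction with
  | zero => exact zero_mem _
  | add x y _ _ hx hy => exact add_mem hx hy
  | smul c x _ hx => exact Submodule.smul_mem _ _ hx
  | mem z hz =>
    obtain ⟨k, n, S, hS, rfl⟩ := hz
    exact Submodule.subset_span ⟨k, n, S, hS, rfl⟩

theorem secondFourier_mem_bochnerGraph (hq : 0 < q) (hq1 : q < 1) (hm : 1 ≤ m) (s : ℂ) {α γ : ℝ}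
    (hα : 0 < α) (hγ : 0 < γ) {f : Series q m} (hf : f ∈ VClass q m α) :
    (f, secondFourier q m s α γ f) ∈ bochnerGraph q m s α := by
  have h := exists_mem_secondGraph hq hq1 hm s hα hγ hf
  rw [secondFourier, dif_pos h]
  exact secondGraph_le_bochnerGraph hq hq1 hm s hα hγ h.choose_spec

end SecondTransform
end QEuclid

open QEuclid in
theorem theorem4p8 (m : ℕ) (hm : 1 ≤ m) (q : ℝ) (hq0 : 0 < q) (hq1 : q < 1) :
    -- the partial derivatives and the Fourier kernel are well defined
    (∃! D, IsPartials q m D) ∧ (∃! e, IsKernel q m e) ∧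
    ∀ s : ℂ, s = Complex.I ∨ s = -Complex.I →
      (∀ α γ : ℝ, 0 < α → 0 < γ → ∀ f ∈ VClass q m α,
        -- the second transform is well defined by its Bochner relations
        (∃! g, (f, g) ∈ secondGraph q m s α γ) ∧
        secondFourier q m s α γ f ∈ VBarClass q m (1 / α) ∧
        firstFourier q m (-s) (1 / α) (secondFourier q m s α γ f) = f) ∧
      (∀ β γ : ℝ, 0 < β → 0 < γ → ∀ f ∈ VBarClass q m β,
        -- the integrals in the first transform converge
        (∀ p : Poly q m, Converges q m (scale q m β) (f * toSeries q m p)) ∧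
        firstFourier q m s β f ∈ VClass q m (1 / β) ∧
        secondFourier q m (-s) (1 / β) γ (firstFourier q m s β f) = f) := by
  refine ⟨existsUnique_isPartials hq0, existsUnique_isKernel hq0 hq1, fun s hs => ?_⟩
  have hs2 : s ^ 2 = -1 := by rcases hs with rfl | rfl <;> simp
  refine ⟨fun α γ hα hγ f hf => ?_, fun β γ hβ hγ f hf => ?_⟩
  · have h1 := secondFourier_mem_bochnerGraph hq0 hq1 hm s hα hγ hf
    have h2 := firstFourier_of_mem_bochnerGraph hq0 hq1 hm hs2 hα h1
    have h3 := snd_mem_of_mem_bochnerGraph hq0 h1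
    refine ⟨?_, ?_, h2⟩
    · obtain ⟨g, hg⟩ := exists_mem_secondGraph hq0 hq1 hm s hα hγ hf
      have hle := secondGraph_le_bochnerGraph hq0 hq1 hm s hα hγ
      exact ⟨g, hg, fun g' hg' => bochnerGraph_unique hq0 hq1 hm hα (hle hg') (hle hg)⟩
    · exact (mem_VBarClass_iff hq0 hq1 hm (by positivity) _).2 h3
  · have h1 := mem_bochnerGraph_firstFourier hq0 hq1 hm hs2 hβ hf
    have hα : 0 < 1 / β := by positivity
    have h3 := fst_mem_of_mem_bochnerGraph h1
    have h2 := (mem_VClass_iff hq0 hq1 hm hα _).2 h3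
    refine ⟨converges_of_mem_chainSpan hq0 hq1 hm hβ ((mem_VBarClass_iff hq0 hq1 hm hβ f).1 hf),
      h2, ?_⟩
    exact bochnerGraph_unique hq0 hq1 hm hα
      (secondFourier_mem_bochnerGraph hq0 hq1 hm (-s) hα hγ h2) h1
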